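/- Let $\mathcal V$ be a symmetric monoidal closed category whose underlying ordinary category is complete and cocomplete, and let $\Phi$ be a class of weights, that is, of $\mathcal V$-functors $F:\mathcal D\to\mathcal V$; the limit $\{F,S\}$ of $S:\mathcal D\to\mathcal C$ and the colimit $F*R$ of $R:\mathcal D^{\mathrm{op}}\to\mathcal C$ weighted by $F$ are defined by $\mathcal C(X,\{F,S\})\cong[\mathcal D,\mathcal V](F,\mathcal C(X,S-))$ and $\mathcal C(F*R,X)\cong[\mathcal D,\mathcal V](F,\mathcal C(R-,X))$. A $\mathcal V$-functor is $\Phi$-continuous if it preserves all limits with weight in $\Phi$ (the $\Phi$-limits), and a $\mathcal V$-category is $\Phi$-complete if it has all $\Phi$-limits. A weight $F:\mathcal D\to\mathcal V$ with $\mathcal D$ small is $\Phi$-flat if $F*-:[\mathcal D^{\mathrm{op}},\mathcal V]\to\mathcal V$ is $\Phi$-continuous, and a $\mathcal V$-functor is $\Phi$-accessible if it preserves all colimits with $\Phi$-flat weights. A $\mathcal V$-monad is $\Phi$-accessible if its underlying $\mathcal V$-functor is. Assume that for every small $\Phi$-complete $\mathcal V$-category $\mathcal A$, every $\Phi$-continuous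 $\mathcal V$-functor $\mathcal A\to\mathcal V$ is $\Phi$-flat. Let $\mathcal K$ be a locally $\Phi$-presentable $\mathcal V$-category, that is, one equivalent to the $\mathcal V$-category $\Phi\text{-}\mathbf{Cts}(\mathcal T,\mathcal V)$ of $\Phi$-continuous $\mathcal V$-functors $\mathcal T\to\mathcal V$ for some small $\Phi$-complete $\mathcal V$-category $\mathcal T$. Let $J:\mathcal K_\Phi\to\mathcal K$ be the inclusion of the full sub-$\mathcal V$-category of the $\Phi$-presentable objects, i.e. of those $X$ for which $\mathcal K(X,-):\mathcal K\to\mathcal V$ is $\Phi$-accessible. Let $E:\mathcal K_\Phi^{\mathrm{op}}\to\mathcal L$ be a Lawvere $\Phi$-theory, i.e. an identity-on-objects $\mathcal V$-functor which preserves $\Phi$-limits. Then the functor $\mathcal V$-categories $[\mathcal K_\Phi^{\mathrm{op}},\mathcal V]$ and $[\mathcal L,\mathcal V]$ exist. Let $\Phi\text{-}\mathbf{Cts}(\mathcal L,\mathcal V)$, the $\mathcal V$-category of models of the theory, be the pullback in $\mathcal V\text{-}\mathbf{Cat}$ of $\mathcal K(J,1):\mathcal K\to[\mathcal K_\Phi^{\mathrm{op}},\mathcal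 V]$, $X\mapsto\mathcal K(J-,X)$, along the restriction $[E,\mathcal V]:[\mathcal L,\mathcal V]\to[\mathcal K_\Phi^{\mathrm{op}},\mathcal V]$, and let $U:\Phi\text{-}\mathbf{Cts}(\mathcal L,\mathcal V)\to\mathcal K$ be the projection. The $\mathcal V$-functor $U$ is monadic via a $\Phi$-accessible monad: $U$ has a left adjoint $F$ as a $\mathcal V$-functor, the comparison $\mathcal V$-functor from $\Phi\text{-}\mathbf{Cts}(\mathcal L,\mathcal V)$ to the Eilenberg–Moore $\mathcal V$-category of the $\mathcal V$-monad induced by $F\dashv U$ is an equivalence, and this monad is $\Phi$-accessible. -/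

import Mathlib

open CategoryTheory MonoidalCategory Opposite
open scoped MonoidalClosed

set_option linter.unusedSectionVars false

universe w v u u₁ u₂ u₃

noncomputable section

namespace VCat

section Basic

variable {V : Type u} [Category.{v} V] [MonoidalCategory V]

variable {C : Type u₁} [EnrichedCategory V C] {D : Type u₂} [EnrichedCategory V D]

/-- Postcomposition `C(X, Y) ⟶ C(X, Z)` with an element `g : I ⟶ C(Y, Z)`. -/
def post {Y Z : C} (g : 𝟙_ V ⟶ (Y ⟶[V] Z)) (X : C) : (X ⟶[V] Y) ⟶ (X ⟶[V] Z) :=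
  (ρ_ _).inv ≫ (_ ◁ g) ≫ eComp V X Y Z

/-- Precomposition `C(Y, Z) ⟶ C(X, Z)` with an element `f : I ⟶ C(X, Y)`. -/
def pre {X Y : C} (f : 𝟙_ V ⟶ (X ⟶[V] Y)) (Z : C) : (Y ⟶[V] Z) ⟶ (X ⟶[V] Z) :=
  (λ_ _).inv ≫ (f ▷ _) ≫ eComp V X Y Z

/-- The composite `I ⟶ C(X, Z)` of elements `f : I ⟶ C(X, Y)` and `g : I ⟶ C(Y, Z)`. -/
def elComp {X Y Z : C} (f : 𝟙_ V ⟶ (X ⟶[V] Y)) (g : 𝟙_ V ⟶ (Y ⟶[V] Z)) :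
    𝟙_ V ⟶ (X ⟶[V] Z) :=
  (λ_ (𝟙_ V)).inv ≫ (f ⊗ₘ g) ≫ eComp V X Y Z

theorem comp_post {X Y Z : C} (f : 𝟙_ V ⟶ (X ⟶[V] Y)) (g : 𝟙_ V ⟶ (Y ⟶[V] Z)) :
    f ≫ post g X = elComp f g := by
  simp only [post, elComp, MonoidalCategory.tensorHom_def, Category.assoc,
    rightUnitor_inv_naturality_assoc, unitors_inv_equal]

theorem comp_pre {X Y Z : C} (f : 𝟙_ V ⟶ (X ⟶[V] Y)) (g : 𝟙_ V ⟶ (Y ⟶[V] Z)) :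
    g ≫ pre f Z = elComp f g := by
  simp only [pre, elComp, tensorHom_def', Category.assoc, leftUnitor_inv_naturality_assoc]

@[simp]
theorem post_eId (X Y : C) : post (eId V Y) X = 𝟙 _ := by
  simp [post]

@[simp]
theorem pre_eId (X Y : C) : pre (eId V X) Y = 𝟙 _ := by
  simp [pre]

theorem eComp_post {X Y Z Z' : C} (h : 𝟙_ V ⟶ (Z ⟶[V] Z')) :
    eComp V X Y Z ≫ post h X = (_ ◁ post h Y) ≫ eComp V X Y Z' := by
  simp only [post, MonoidalCategory.whiskerLeft_comp, Category.assoc]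
  rw [rightUnitor_inv_naturality_assoc, ← whisker_exchange_assoc, ← e_assoc]
  simp

theorem eComp_pre {X X' Y Z : C} (h : 𝟙_ V ⟶ (X' ⟶[V] X)) :
    eComp V X Y Z ≫ pre h Z = (pre h Y ▷ _) ≫ eComp V X' Y Z := by
  simp only [pre, comp_whiskerRight, Category.assoc]
  rw [leftUnitor_inv_naturality_assoc, whisker_exchange_assoc, ← e_assoc']
  simp

theorem post_eComp {X Y Y' Z : C} (h : 𝟙_ V ⟶ (Y ⟶[V] Y')) :
    (post h X ▷ _) ≫ eComp V X Y' Z = (_ ◁ pre h Z) ≫ eComp V X Y Z := by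
  simp only [pre, post, comp_whiskerRight, MonoidalCategory.whiskerLeft_comp, Category.assoc]
  rw [← e_assoc']
  simp

theorem post_post {X Y Z W : C} (g : 𝟙_ V ⟶ (Y ⟶[V] Z)) (h : 𝟙_ V ⟶ (Z ⟶[V] W)) :
    post g X ≫ post h X = post (elComp g h) X := by
  conv_lhs => rw [post, Category.assoc, Category.assoc, eComp_post,
    ← MonoidalCategory.whiskerLeft_comp_assoc, comp_post]
  rfl

theorem pre_pre {X Y Z W : C} (f : 𝟙_ V ⟶ (X ⟶[V] Y)) (g : 𝟙_ V ⟶ (Y ⟶[V] Z)) :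
    pre g W ≫ pre f W = pre (elComp f g) W := by
  conv_lhs => rw [pre, Category.assoc, Category.assoc, eComp_pre,
    ← comp_whiskerRight_assoc, comp_pre]
  rfl

theorem pre_post {X X' Y Y' : C} (f : 𝟙_ V ⟶ (X' ⟶[V] X)) (g : 𝟙_ V ⟶ (Y ⟶[V] Y')) :
    pre f Y ≫ post g X' = post g X ≫ pre f Y' := by
  conv_lhs => rw [pre, Category.assoc, Category.assoc, eComp_post, ← whisker_exchange_assoc,
    ← leftUnitor_inv_naturality_assoc]
  rfl

/-- The action of a `V`-functor on elements. -/
abbrev elMap (F : EnrichedFunctor V C D) {X Y : C} (f : 𝟙_ V ⟶ (X ⟶[V] Y)) :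
    𝟙_ V ⟶ (F.obj X ⟶[V] F.obj Y) :=
  f ≫ F.map X Y

theorem post_map (F : EnrichedFunctor V C D) {X Y Z : C} (g : 𝟙_ V ⟶ (Y ⟶[V] Z)) :
    post g X ≫ F.map X Z = F.map X Y ≫ post (elMap F g) (F.obj X) := by
  simp only [post, Category.assoc, EnrichedFunctor.map_comp, MonoidalCategory.whiskerLeft_comp,
    rightUnitor_inv_naturality_assoc, MonoidalCategory.tensorHom_def_assoc]
  rw [whisker_exchange_assoc]

theorem pre_map (F : EnrichedFunctor V C D) {X Y Z : C} (f : 𝟙_ V ⟶ (X ⟶[V] Y)) :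
    pre f Z ≫ F.map X Z = F.map Y Z ≫ pre (elMap F f) (F.obj Z) := by
  simp only [pre, Category.assoc, EnrichedFunctor.map_comp, comp_whiskerRight,
    leftUnitor_inv_naturality_assoc, tensorHom_def'_assoc]
  rw [← whisker_exchange_assoc]

theorem elMap_elComp (F : EnrichedFunctor V C D) {X Y Z : C} (f : 𝟙_ V ⟶ (X ⟶[V] Y))
    (g : 𝟙_ V ⟶ (Y ⟶[V] Z)) :
    elMap F (elComp f g) = elComp (elMap F f) (elMap F g) := by
  rw [elMap, ← comp_post, Category.assoc, post_map, ← comp_post, Category.assoc]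

theorem elMap_comp {E : Type u₃} [EnrichedCategory V E] (F : EnrichedFunctor V C D)
    (G : EnrichedFunctor V D E) {X Y : C} (f : 𝟙_ V ⟶ (X ⟶[V] Y)) :
    elMap (F.comp V G) f = elMap G (elMap F f) :=
  (Category.assoc _ _ _).symm

theorem elComp_assoc {W X Y Z : C} (f : 𝟙_ V ⟶ (W ⟶[V] X)) (g : 𝟙_ V ⟶ (X ⟶[V] Y))
    (h : 𝟙_ V ⟶ (Y ⟶[V] Z)) :
    elComp (elComp f g) h = elComp f (elComp g h) := by
  rw [← comp_post, ← comp_post, Category.assoc, post_post, comp_post]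

/-- A `V`-natural transformation `F ⟶ G`: a family of elements `I ⟶ D(F X, G X)` such that the two
composites `C(X, Y) ⟶ D(F X, G Y)` agree. -/
@[ext]
structure VNatTrans (F G : EnrichedFunctor V C D) where
  /-- the components -/
  app : ∀ X : C, 𝟙_ V ⟶ (F.obj X ⟶[V] G.obj X)
  naturality : ∀ X Y : C,
    F.map X Y ≫ post (app Y) (F.obj X) = G.map X Y ≫ pre (app X) (G.obj Y)

theorem sub_id_comp {X Y : C} {A B : V} (i : 𝟙_ V ⟶ A) (m : A ⊗ B ⟶ B)
    (a : A ⟶ (X ⟶[V] X)) (b : B ⟶ (X ⟶[V] Y)) (hi : i ≫ a = eId V X)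
    (hm : m ≫ b = (a ⊗ₘ b) ≫ eComp V X X Y) :
    ((λ_ B).inv ≫ i ▷ B ≫ m) ≫ b = b := by
  rw [Category.assoc, Category.assoc, hm, MonoidalCategory.tensorHom_def, Category.assoc,
    ← comp_whiskerRight_assoc, hi, ← whisker_exchange_assoc, ← leftUnitor_inv_naturality_assoc,
    e_id_comp, Category.comp_id]

theorem sub_comp_id {X Y : C} {A B : V} (i : 𝟙_ V ⟶ A) (m : B ⊗ A ⟶ B)
    (a : A ⟶ (Y ⟶[V] Y)) (b : B ⟶ (X ⟶[V] Y)) (hi : i ≫ a = eId V Y)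
    (hm : m ≫ b = (b ⊗ₘ a) ≫ eComp V X Y Y) :
    ((ρ_ B).inv ≫ B ◁ i ≫ m) ≫ b = b := by
  rw [Category.assoc, Category.assoc, hm, MonoidalCategory.tensorHom_def', Category.assoc,
    ← MonoidalCategory.whiskerLeft_comp_assoc, hi, whisker_exchange_assoc,
    ← rightUnitor_inv_naturality_assoc, e_comp_id, Category.comp_id]

theorem comp_comp_comp {W X Y Z : C} {A₁ A₂ A₃ : V} (a₁ : A₁ ⟶ (W ⟶[V] X))
    (a₂ : A₂ ⟶ (X ⟶[V] Y)) (a₃ : A₃ ⟶ (Y ⟶[V] Z)) :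
    (((a₁ ⊗ₘ a₂) ≫ eComp V W X Y) ⊗ₘ a₃) ≫ eComp V W Y Z =
      (α_ A₁ A₂ A₃).hom ≫ (a₁ ⊗ₘ ((a₂ ⊗ₘ a₃) ≫ eComp V X Y Z)) ≫ eComp V W X Z := by
  have e₁ : (((a₁ ⊗ₘ a₂) ≫ eComp V W X Y) ⊗ₘ a₃) =
      ((a₁ ⊗ₘ a₂) ⊗ₘ a₃) ≫ eComp V W X Y ▷ _ := by
    rw [← tensorHom_id, tensorHom_comp_tensorHom, Category.comp_id]
  have e₂ : (a₁ ⊗ₘ ((a₂ ⊗ₘ a₃) ≫ eComp V X Y Z)) = (a₁ ⊗ₘ (a₂ ⊗ₘ a₃)) ≫ _ ◁ eComp V X Y Z := by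
    rw [← id_tensorHom, tensorHom_comp_tensorHom, Category.comp_id]
  rw [e₁, e₂, Category.assoc, Category.assoc, ← associator_naturality_assoc, e_assoc']

theorem sub_assoc {W X Y Z : C} {A₁ A₂ A₃ A₁₂ A₂₃ A₁₂₃ : V}
    (m₁ : A₁ ⊗ A₂ ⟶ A₁₂) (m₂ : A₁₂ ⊗ A₃ ⟶ A₁₂₃) (m₃ : A₂ ⊗ A₃ ⟶ A₂₃) (m₄ : A₁ ⊗ A₂₃ ⟶ A₁₂₃)
    (a₁ : A₁ ⟶ (W ⟶[V] X)) (a₂ : A₂ ⟶ (X ⟶[V] Y)) (a₃ : A₃ ⟶ (Y ⟶[V] Z))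
    (a₁₂ : A₁₂ ⟶ (W ⟶[V] Y)) (a₂₃ : A₂₃ ⟶ (X ⟶[V] Z)) (a₁₂₃ : A₁₂₃ ⟶ (W ⟶[V] Z))
    (h₁ : m₁ ≫ a₁₂ = (a₁ ⊗ₘ a₂) ≫ eComp V W X Y)
    (h₂ : m₂ ≫ a₁₂₃ = (a₁₂ ⊗ₘ a₃) ≫ eComp V W Y Z)
    (h₃ : m₃ ≫ a₂₃ = (a₂ ⊗ₘ a₃) ≫ eComp V X Y Z)
    (h₄ : m₄ ≫ a₁₂₃ = (a₁ ⊗ₘ a₂₃) ≫ eComp V W X Z) :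
    ((α_ A₁ A₂ A₃).inv ≫ m₁ ▷ A₃ ≫ m₂) ≫ a₁₂₃ = (A₁ ◁ m₃ ≫ m₄) ≫ a₁₂₃ := by
  simp only [Category.assoc, h₂, h₄]
  have e₁ : m₁ ▷ A₃ ≫ (a₁₂ ⊗ₘ a₃) = ((a₁ ⊗ₘ a₂) ≫ eComp V W X Y) ⊗ₘ a₃ := by
    rw [← tensorHom_id, tensorHom_comp_tensorHom, h₁, Category.id_comp]
  have e₂ : A₁ ◁ m₃ ≫ (a₁ ⊗ₘ a₂₃) = a₁ ⊗ₘ ((a₂ ⊗ₘ a₃) ≫ eComp V X Y Z) := by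
    rw [← id_tensorHom, tensorHom_comp_tensorHom, h₃, Category.id_comp]
  rw [reassoc_of% e₁, reassoc_of% e₂, comp_comp_comp, Iso.inv_hom_id_assoc]

/-- A `V`-functor is fully faithful if its action on each hom-object is invertible. -/
def FullyFaithful (F : EnrichedFunctor V C D) : Prop :=
  ∀ X Y : C, IsIso (F.map X Y)

/-- A `V`-functor is an equivalence if it is fully faithful and essentially surjective. -/
def IsEquivalence (F : EnrichedFunctor V C D) : Prop :=
  FullyFaithful F ∧ F.forget.EssSurj

end Basic

section Monads

variable (V : Type u) [Category.{v} V] [MonoidalCategory V]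

/-- A `V`-monad on a `V`-category. -/
structure VMonad (K : Type u₁) [EnrichedCategory V K] where
  /-- the underlying `V`-functor -/
  T : EnrichedFunctor V K K
  /-- the unit -/
  η : VNatTrans (EnrichedFunctor.id V K) T
  /-- the multiplication -/
  μ : VNatTrans (T.comp V T) T
  assoc : ∀ X : K, elComp (elMap T (μ.app X)) (μ.app X) = elComp (μ.app (T.obj X)) (μ.app X)
  left_unit : ∀ X : K, elComp (η.app (T.obj X)) (μ.app X) = eId V (T.obj X)
  right_unit : ∀ X : K, elComp (elMap T (η.app X)) (μ.app X) = eId V (T.obj X)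

variable {V}

/-- An adjunction `F ⊣ U` between `V`-functors, given by unit and counit. -/
structure VAdjunction {K : Type u₁} [EnrichedCategory V K] {M : Type u₂} [EnrichedCategory V M]
    (F : EnrichedFunctor V K M) (U : EnrichedFunctor V M K) where
  /-- the unit -/
  unit : VNatTrans (EnrichedFunctor.id V K) (F.comp V U)
  /-- the counit -/
  counit : VNatTrans (U.comp V F) (EnrichedFunctor.id V M)
  left_triangle : ∀ X : K,
    elComp (elMap F (unit.app X)) (counit.app (F.obj X)) = eId V (F.obj X)
  right_triangle : ∀ A : M,
    elComp (unit.app (U.obj A)) (elMap U (counit.app A)) = eId V (U.obj A)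

variable {K : Type u₁} [EnrichedCategory V K] {M : Type u₂} [EnrichedCategory V M]

/-- The component `I ⟶ M(F U A, A)` of the counit. -/
def VAdjunction.ε {F : EnrichedFunctor V K M} {U : EnrichedFunctor V M K}
    (adj : VAdjunction F U) (A : M) : 𝟙_ V ⟶ (F.obj (U.obj A) ⟶[V] A) :=
  adj.counit.app A

theorem VAdjunction.ε_nat {F : EnrichedFunctor V K M} {U : EnrichedFunctor V M K}
    (adj : VAdjunction F U) (A B : M) :
    U.map A B ≫ F.map (U.obj A) (U.obj B) ≫ post (adj.ε B) (F.obj (U.obj A)) =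
      pre (adj.ε A) B :=
  (Category.assoc _ _ _).symm.trans ((adj.counit.naturality A B).trans (Category.id_comp _))

theorem VAdjunction.ε_assoc {F : EnrichedFunctor V K M} {U : EnrichedFunctor V M K}
    (adj : VAdjunction F U) (A : M) :
    elComp (elMap F (elMap U (adj.ε A))) (adj.ε A) = elComp (adj.ε (F.obj (U.obj A))) (adj.ε A) := by
  rw [← comp_pre (adj.ε (F.obj (U.obj A))), ← adj.ε_nat, ← comp_post]
  simp [elMap]

/-- The `V`-monad induced by an adjunction. -/
def VAdjunction.toMonad {F : EnrichedFunctor V K M} {U : EnrichedFunctor V M K}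
    (adj : VAdjunction F U) : VMonad V K where
  T := F.comp V U
  η := adj.unit
  μ :=
    { app := fun X => elMap U (adj.ε (F.obj X))
      naturality := fun X Y => by
        change ((F.map X Y ≫ U.map _ _) ≫ F.map _ _ ≫ U.map _ _) ≫ post (elMap U _) _ =
          (F.map X Y ≫ U.map _ _) ≫ pre (elMap U _) _
        rw [Category.assoc, Category.assoc, Category.assoc, Category.assoc,
          ← post_map, reassoc_of% adj.ε_nat, pre_map] }
  assoc := fun X => by
    have h := congrArg (elMap U) (adj.ε_assoc (F.obj X))
    rw [elMap_elComp, elMap_elComp] at h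
    exact (congrArg (elComp · _) (elMap_comp F U _)).trans h
  left_unit := fun X => adj.right_triangle (F.obj X)
  right_unit := fun X => by
    have h := (elMap_elComp U _ _).symm.trans ((congrArg (elMap U) (adj.left_triangle X)).trans
      (U.map_id _))
    exact (congrArg (elComp · _) (elMap_comp F U _)).trans h

/-- An algebra for a `V`-monad: an object `A` with an action `I ⟶ K(T A, A)`. -/
structure Algebra (T : VMonad V K) where
  /-- the underlying object -/
  A : K
  /-- the action -/
  a : 𝟙_ V ⟶ (T.T.obj A ⟶[V] A)
  unit : elComp (T.η.app A) a = eId V A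
  assoc : elComp (elMap T.T a) a = elComp (T.μ.app A) a

variable [Limits.HasEqualizers V]

/-- The hom-object of the Eilenberg–Moore `V`-category: the equalizer of
`K(a, B)` and `K(T A, b) ∘ T` from `K(A, B)` to `K(T A, B)`. -/
def algHom {T : VMonad V K} (X Y : Algebra T) : V :=
  Limits.equalizer (pre X.a Y.A) (T.T.map X.A Y.A ≫ post Y.a (T.T.obj X.A))

/-- The inclusion of the hom-object of algebras in the hom-object of underlying objects. -/
def algHomι {T : VMonad V K} (X Y : Algebra T) : algHom X Y ⟶ (X.A ⟶[V] Y.A) :=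
  Limits.equalizer.ι _ _

theorem algHomι_condition {T : VMonad V K} (X Y : Algebra T) :
    algHomι X Y ≫ pre X.a Y.A = algHomι X Y ≫ T.T.map X.A Y.A ≫ post Y.a (T.T.obj X.A) :=
  Limits.equalizer.condition _ _

instance {T : VMonad V K} (X Y : Algebra T) : Mono (algHomι X Y) :=
  Limits.equalizer.ι_mono

/-- Lifts into the hom-object of algebras. -/
def algLift {T : VMonad V K} {X Y : Algebra T} {W : V} (f : W ⟶ (X.A ⟶[V] Y.A))
    (hf : f ≫ pre X.a Y.A = f ≫ T.T.map X.A Y.A ≫ post Y.a (T.T.obj X.A)) : W ⟶ algHom X Y :=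
  Limits.equalizer.lift f hf

@[simp]
theorem algLift_ι {T : VMonad V K} {X Y : Algebra T} {W : V} (f : W ⟶ (X.A ⟶[V] Y.A))
    (hf : f ≫ pre X.a Y.A = f ≫ T.T.map X.A Y.A ≫ post Y.a (T.T.obj X.A)) :
    algLift f hf ≫ algHomι X Y = f :=
  Limits.equalizer.lift_ι _ _

/-- The identity of an algebra. -/
def algId {T : VMonad V K} (X : Algebra T) : 𝟙_ V ⟶ algHom X X :=
  algLift (eId V X.A) (by
    rw [EnrichedFunctor.map_id_assoc, comp_pre, comp_post, ← comp_post, post_eId, ← comp_pre,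
      pre_eId, Category.comp_id])

/-- Composition in the Eilenberg–Moore `V`-category. -/
def algComp {T : VMonad V K} (X Y Z : Algebra T) : algHom X Y ⊗ algHom Y Z ⟶ algHom X Z :=
  algLift ((algHomι X Y ⊗ₘ algHomι Y Z) ≫ eComp V X.A Y.A Z.A) (by
    simp only [Category.assoc, EnrichedFunctor.map_comp_assoc, eComp_pre, eComp_post]
    rw [tensorHom_def', Category.assoc, ← comp_whiskerRight_assoc, algHomι_condition]
    simp only [comp_whiskerRight, Category.assoc, post_eComp]
    rw [whisker_exchange_assoc, whisker_exchange_assoc, ← MonoidalCategory.whiskerLeft_comp_assoc,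
      algHomι_condition]
    simp only [MonoidalCategory.whiskerLeft_comp, Category.assoc,
      MonoidalCategory.tensorHom_def, whisker_exchange_assoc])

@[simp]
theorem algId_ι {T : VMonad V K} (X : Algebra T) : algId X ≫ algHomι X X = eId V X.A :=
  algLift_ι _ _

@[simp]
theorem algComp_ι {T : VMonad V K} (X Y Z : Algebra T) :
    algComp X Y Z ≫ algHomι X Z = (algHomι X Y ⊗ₘ algHomι Y Z) ≫ eComp V X.A Y.A Z.A :=
  algLift_ι _ _

/-- The Eilenberg–Moore `V`-category of algebras. -/
instance (T : VMonad V K) : EnrichedCategory V (Algebra T) where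
  Hom := algHom
  id := algId
  comp := algComp
  id_comp X Y := by
    rw [← cancel_mono (algHomι X Y), Category.id_comp]
    exact sub_id_comp _ _ _ _ (algId_ι X) (algComp_ι X X Y)
  comp_id X Y := by
    rw [← cancel_mono (algHomι X Y), Category.id_comp]
    exact sub_comp_id _ _ _ _ (algId_ι Y) (algComp_ι X Y Y)
  assoc X Y Z W := by
    rw [← cancel_mono (algHomι X W)]
    exact sub_assoc _ _ _ _ _ _ _ _ _ _ (algComp_ι _ _ _) (algComp_ι _ _ _) (algComp_ι _ _ _)
      (algComp_ι _ _ _)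

/-- The algebra `(U A, U ε_A)` associated to an object `A` of the domain of a right adjoint. -/
def VAdjunction.comparisonObj {F : EnrichedFunctor V K M} {U : EnrichedFunctor V M K}
    (adj : VAdjunction F U) (A : M) : Algebra adj.toMonad where
  A := U.obj A
  a := elMap U (adj.ε A)
  unit := adj.right_triangle A
  assoc := by
    have h := congrArg (elMap U) (adj.ε_assoc A)
    rw [elMap_elComp, elMap_elComp] at h
    exact (congrArg (elComp · _) (elMap_comp F U _)).trans h

/-- The action of the comparison `V`-functor on hom-objects. -/
def VAdjunction.comparisonMap {F : EnrichedFunctor V K M} {U : EnrichedFunctor V M K}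
    (adj : VAdjunction F U) (A B : M) :
    (A ⟶[V] B) ⟶ algHom (adj.comparisonObj A) (adj.comparisonObj B) :=
  algLift (X := adj.comparisonObj A) (Y := adj.comparisonObj B) (U.map A B) (by
    change U.map A B ≫ pre (elMap U _) _ = U.map A B ≫ (F.map _ _ ≫ U.map _ _) ≫ post (elMap U _) _
    rw [Category.assoc, ← post_map, reassoc_of% adj.ε_nat, pre_map])

theorem VAdjunction.comparisonMap_ι {F : EnrichedFunctor V K M} {U : EnrichedFunctor V M K}
    (adj : VAdjunction F U) (A B : M) :
    adj.comparisonMap A B ≫ algHomι (adj.comparisonObj A) (adj.comparisonObj B) = U.map A B :=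
  algLift_ι _ _

/-- The comparison `V`-functor from the domain of a right adjoint to the Eilenberg–Moore
`V`-category of the induced monad. -/
def VAdjunction.comparison {F : EnrichedFunctor V K M} {U : EnrichedFunctor V M K}
    (adj : VAdjunction F U) : EnrichedFunctor V M (Algebra adj.toMonad) where
  obj := adj.comparisonObj
  map := adj.comparisonMap
  map_id A := by
    refine (cancel_mono (algHomι _ _)).1 ?_
    refine (Category.assoc _ _ _).trans (Eq.trans (congrArg _ (adj.comparisonMap_ι _ _)) ?_)
    exact (U.map_id A).trans (algId_ι (adj.comparisonObj A)).symm
  map_comp A B C := by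
    refine (cancel_mono (algHomι _ _)).1 ?_
    refine (Category.assoc _ _ _).trans (Eq.trans (congrArg _ (adj.comparisonMap_ι _ _)) ?_)
    refine (U.map_comp A B C).trans (Eq.symm ?_)
    refine (Category.assoc _ _ _).trans (Eq.trans (congrArg _ (algComp_ι _ _ _)) ?_)
    refine (tensorHom_comp_tensorHom_assoc _ _ _ _ _).trans ?_
    exact congrArg₂ (fun s t => (s ⊗ₘ t) ≫ eComp V (U.obj A) (U.obj B) (U.obj C))
      (adj.comparisonMap_ι A B) (adj.comparisonMap_ι B C)

end Monads

section FunctorCategories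

variable {V : Type u} [Category.{v} V] [MonoidalCategory V] [SymmetricCategory V]

variable {C : Type u₁} [EnrichedCategory V C] {D : Type u₂} [EnrichedCategory V D]

/-- A family of morphisms `W ⟶ D(F X, G X)`, `V`-natural in `X`. -/
@[ext]
structure GradedNat (W : V) (F G : EnrichedFunctor V C D) where
  /-- the components -/
  app : ∀ X : C, W ⟶ (F.obj X ⟶[V] G.obj X)
  naturality : ∀ X Y : C,
    (β_ W (X ⟶[V] Y)).hom ≫ (F.map X Y ⊗ₘ app Y) ≫ eComp V (F.obj X) (F.obj Y) (G.obj Y) =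
      (app X ⊗ₘ G.map X Y) ≫ eComp V (F.obj X) (G.obj X) (G.obj Y)

/-- Reindexing of a `V`-natural family. -/
@[simps]
def GradedNat.reindex {W W' : V} (f : W' ⟶ W) {F G : EnrichedFunctor V C D}
    (σ : GradedNat W F G) : GradedNat W' F G where
  app X := f ≫ σ.app X
  naturality X Y := by
    have h := congrArg (fun t => f ▷ (X ⟶[V] Y) ≫ t) (σ.naturality X Y)
    simp only [BraidedCategory.braiding_naturality_left_assoc] at h
    convert h using 1
    · simp [MonoidalCategory.tensorHom_def']
    · simp [MonoidalCategory.tensorHom_def]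

/-- `π : N ⟶ D(F -, G -)` is the universal `V`-natural family, i.e. `N` is the object of
`V`-natural transformations from `F` to `G` (the end of `D(F -, G -)`). -/
def IsNatObj {N : V} {F G : EnrichedFunctor V C D} (π : GradedNat N F G) : Prop :=
  ∀ (W : V) (σ : GradedNat W F G), ∃! f : W ⟶ N, ∀ X : C, f ≫ π.app X = σ.app X

variable (V C D) in
/-- The functor `V`-category `[C, D]` exists: every two `V`-functors `C ⥤ D` have an object of
`V`-natural transformations. -/
class HasFunctorCategory : Prop where
  exists_natObj : ∀ F G : EnrichedFunctor V C D, ∃ (N : V) (π : GradedNat N F G), IsNatObj π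

section

variable [HasFunctorCategory V C D]

/-- The object of `V`-natural transformations from `F` to `G`. -/
def natObj (F G : EnrichedFunctor V C D) : V :=
  (HasFunctorCategory.exists_natObj F G).choose

/-- The universal family on the object of `V`-natural transformations. -/
def natObjFam (F G : EnrichedFunctor V C D) : GradedNat (natObj F G) F G :=
  (HasFunctorCategory.exists_natObj F G).choose_spec.choose

/-- The projections from the object of `V`-natural transformations. -/
def natObjπ (F G : EnrichedFunctor V C D) (X : C) : natObj F G ⟶ (F.obj X ⟶[V] G.obj X) :=
  (natObjFam F G).app X

theorem natObjFam_isNatObj (F G : EnrichedFunctor V C D) : IsNatObj (natObjFam F G) :=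
  (HasFunctorCategory.exists_natObj F G).choose_spec.choose_spec

/-- The morphism to the object of `V`-natural transformations given by a `V`-natural family. -/
def natLift {W : V} {F G : EnrichedFunctor V C D} (σ : GradedNat W F G) : W ⟶ natObj F G :=
  (natObjFam_isNatObj F G W σ).choose

@[simp]
theorem natLift_π {W : V} {F G : EnrichedFunctor V C D} (σ : GradedNat W F G) (X : C) :
    natLift σ ≫ natObjπ F G X = σ.app X :=
  (natObjFam_isNatObj F G W σ).choose_spec.1 X

theorem natObj_hom_ext {W : V} {F G : EnrichedFunctor V C D} {f g : W ⟶ natObj F G}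
    (h : ∀ X : C, f ≫ natObjπ F G X = g ≫ natObjπ F G X) : f = g :=
  (natObjFam_isNatObj F G W ((natObjFam F G).reindex g)).unique h (fun _ => rfl)

end

/-- The identity `V`-natural family. -/
@[simps]
def GradedNat.id (F : EnrichedFunctor V C D) : GradedNat (𝟙_ V) F F where
  app X := eId V (F.obj X)
  naturality X Y := by
    have h₁ := e_id_comp V (F.obj X) (F.obj Y)
    have h₂ := e_comp_id V (F.obj X) (F.obj Y)
    rw [Iso.inv_comp_eq, Category.comp_id] at h₁ h₂
    rw [MonoidalCategory.tensorHom_def, MonoidalCategory.tensorHom_def', Category.assoc,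
      Category.assoc, h₁, h₂, braiding_tensorUnit_left]
    simp

/-- Composition of `V`-natural families. -/
@[simps]
def GradedNat.comp {W W' : V} {F G H : EnrichedFunctor V C D} (σ : GradedNat W F G)
    (τ : GradedNat W' G H) : GradedNat (W ⊗ W') F H where
  app X := (σ.app X ⊗ₘ τ.app X) ≫ eComp V (F.obj X) (G.obj X) (H.obj X)
  naturality X Y := by
    rw [comp_comp_comp, ← τ.naturality X Y]
    have e₁ : σ.app X ⊗ₘ ((β_ W' (X ⟶[V] Y)).hom ≫ (G.map X Y ⊗ₘ τ.app Y) ≫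
        eComp V (G.obj X) (G.obj Y) (H.obj Y)) = W ◁ (β_ W' (X ⟶[V] Y)).hom ≫
          (σ.app X ⊗ₘ ((G.map X Y ⊗ₘ τ.app Y) ≫ eComp V (G.obj X) (G.obj Y) (H.obj Y))) := by
      rw [← id_tensorHom, tensorHom_comp_tensorHom, Category.id_comp]
    have e₂ := comp_comp_comp (σ.app X) (G.map X Y) (τ.app Y)
    rw [← Iso.inv_comp_eq, ← σ.naturality X Y] at e₂
    have e₃ : ((β_ W (X ⟶[V] Y)).hom ≫ (F.map X Y ⊗ₘ σ.app Y) ≫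
        eComp V (F.obj X) (F.obj Y) (G.obj Y)) ⊗ₘ τ.app Y = (β_ W (X ⟶[V] Y)).hom ▷ W' ≫
          (((F.map X Y ⊗ₘ σ.app Y) ≫ eComp V (F.obj X) (F.obj Y) (G.obj Y)) ⊗ₘ τ.app Y) := by
      rw [← tensorHom_id, tensorHom_comp_tensorHom, Category.id_comp]
    rw [e₁, Category.assoc, ← e₂, e₃, Category.assoc, comp_comp_comp,
      BraidedCategory.braiding_tensor_left_hom]
    simp only [Category.assoc]

section

variable [HasFunctorCategory V C D]

/-- The functor `V`-category `[C, D]`. -/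
instance functorCategory : EnrichedCategory V (EnrichedFunctor V C D) where
  Hom := natObj
  id F := natLift (GradedNat.id F)
  comp F G H := natLift ((natObjFam F G).comp (natObjFam G H))
  id_comp F G := natObj_hom_ext fun X => by
    rw [Category.id_comp]
    exact sub_id_comp _ _ _ _ (natLift_π _ X) (natLift_π _ X)
  comp_id F G := natObj_hom_ext fun X => by
    rw [Category.id_comp]
    exact sub_comp_id _ _ _ _ (natLift_π _ X) (natLift_π _ X)
  assoc F G H K := natObj_hom_ext fun X => by
    exact sub_assoc _ _ _ _ _ _ _ _ _ _ (natLift_π _ X) (natLift_π _ X) (natLift_π _ X)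
      (natLift_π _ X)

theorem functorCategory_eId_π (F : EnrichedFunctor V C D) (X : C) :
    eId V F ≫ natObjπ F F X = eId V (F.obj X) :=
  natLift_π _ X

theorem functorCategory_eComp_π (F G H : EnrichedFunctor V C D) (X : C) :
    eComp V F G H ≫ natObjπ F H X =
      (natObjπ F G X ⊗ₘ natObjπ G H X) ≫ eComp V (F.obj X) (G.obj X) (H.obj X) :=
  natLift_π _ X

end

end FunctorCategories

section HomFunctors

variable {V : Type u} [Category.{v} V] [MonoidalCategory V] [SymmetricCategory V]
  [MonoidalClosed V]

theorem uncurry_eComp {X Y Z A B : V} (f : A ⟶ (ihom X).obj Y) (g : B ⟶ (ihom Y).obj Z) :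
    MonoidalClosed.uncurry ((f ⊗ₘ g) ≫ eComp V X Y Z) =
      (α_ X A B).inv ≫ MonoidalClosed.uncurry f ▷ B ≫ MonoidalClosed.uncurry g := by
  rw [MonoidalClosed.uncurry_natural_left]
  have h : MonoidalClosed.uncurry (eComp V X Y Z) = (α_ X _ _).inv ≫
      (ihom.ev X).app Y ▷ _ ≫ (ihom.ev Y).app Z := by
    change MonoidalClosed.uncurry (MonoidalClosed.curry (MonoidalClosed.compTranspose X Y Z)) = _
    rw [MonoidalClosed.uncurry_curry]
    rfl
  rw [h, MonoidalClosed.uncurry_eq, MonoidalClosed.uncurry_eq]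
  have e : X ◁ (f ⊗ₘ g) ≫ (α_ X _ _).inv =
      (α_ X A B).inv ≫ (X ◁ f) ▷ B ≫ (X ⊗ (ihom X).obj Y) ◁ g := by
    rw [MonoidalCategory.tensorHom_def, MonoidalCategory.whiskerLeft_comp, Category.assoc]
    simp
  rw [reassoc_of% e, whisker_exchange_assoc, comp_whiskerRight, Category.assoc]
  rfl

theorem uncurry_eId (X : V) : MonoidalClosed.uncurry (eId V X) = (ρ_ X).hom :=
  MonoidalClosed.uncurry_curry _

variable {C : Type u₁} [EnrichedCategory V C] {D : Type u₂} [EnrichedCategory V D]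

/-- The representable `V`-functor `C(X, -) : C ⥤ V`. -/
def homFunctor (X : C) : EnrichedFunctor V C V where
  obj Y := X ⟶[V] Y
  map Y Z := MonoidalClosed.curry (eComp V X Y Z)
  map_id Y := by
    apply MonoidalClosed.uncurry_injective
    rw [uncurry_eId, MonoidalClosed.uncurry_natural_left, MonoidalClosed.uncurry_curry,
      ← Iso.inv_comp_eq_id, e_comp_id]
  map_comp Y Z W := by
    apply MonoidalClosed.uncurry_injective
    rw [uncurry_eComp, MonoidalClosed.uncurry_natural_left, MonoidalClosed.uncurry_curry,
      MonoidalClosed.uncurry_curry, MonoidalClosed.uncurry_curry, e_assoc]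

/-- The opposite of a `V`-functor. -/
def opFunctor (F : EnrichedFunctor V C D) : EnrichedFunctor V Cᵒᵖ Dᵒᵖ where
  obj X := op (F.obj X.unop)
  map X Y := F.map Y.unop X.unop
  map_id X := F.map_id X.unop
  map_comp X Y Z := by
    rw [eComp_op_eq, eComp_op_eq, Category.assoc, F.map_comp]
    exact (BraidedCategory.braiding_naturality_assoc (F.map Y.unop X.unop) (F.map Z.unop Y.unop)
      _).symm

/-- The `V`-functor `K(J -, X) : Cᵒᵖ ⥤ V` for `J : C ⥤ K` and `X : K`. -/
def nerveObj (J : EnrichedFunctor V C D) (X : D) : EnrichedFunctor V Cᵒᵖ V :=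
  (opFunctor J).comp V (homFunctor (op X))

theorem uncurry_nerveObj_map (J : EnrichedFunctor V C D) (X : D) (c c' : Cᵒᵖ) :
    MonoidalClosed.uncurry ((nerveObj J X).map c c') =
      (J.obj c.unop ⟶[V] X) ◁ J.map c'.unop c.unop ≫
        (β_ (J.obj c.unop ⟶[V] X) (J.obj c'.unop ⟶[V] J.obj c.unop)).hom ≫
          eComp V (J.obj c'.unop) (J.obj c.unop) X := by
  refine (MonoidalClosed.uncurry_natural_left _ _).trans ?_
  exact congrArg _ (MonoidalClosed.uncurry_curry _)

theorem nerve_aux {A B X Y : D} {H : V} (h : H ⟶ (A ⟶[V] B)) :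
    (B ⟶[V] X) ◁ (β_ (X ⟶[V] Y) H).hom ≫ (α_ _ _ _).inv ≫
        ((B ⟶[V] X) ◁ h ≫ (β_ _ _).hom ≫ eComp V A B X) ▷ (X ⟶[V] Y) ≫ eComp V A X Y =
      (α_ _ _ _).inv ≫ eComp V B X Y ▷ H ≫
        (B ⟶[V] Y) ◁ h ≫ (β_ _ _).hom ≫ eComp V A B Y := by
  rw [← whisker_exchange_assoc, BraidedCategory.braiding_naturality_left_assoc, ← e_assoc,
    BraidedCategory.braiding_tensor_left_hom]
  simp only [Category.assoc]
  rw [associator_naturality_right_assoc, Iso.inv_hom_id_assoc, Iso.hom_inv_id_assoc,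
    ← MonoidalCategory.whiskerLeft_comp_assoc, BraidedCategory.braiding_naturality_right,
    MonoidalCategory.whiskerLeft_comp_assoc, associator_inv_naturality_middle_assoc]
  simp only [comp_whiskerRight, Category.assoc]

/-- The `V`-natural family `K(X, Y) ⟶ [K(J c, X), K(J c, Y)]` given by composition. -/
def nerveFam (J : EnrichedFunctor V C D) (X Y : D) :
    GradedNat (X ⟶[V] Y) (nerveObj J X) (nerveObj J Y) where
  app c := (homFunctor (J.obj c.unop)).map X Y
  naturality c c' := by
    apply MonoidalClosed.uncurry_injective
    refine (MonoidalClosed.uncurry_natural_left _ _).trans ?_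
    refine (congrArg _ (uncurry_eComp _ _)).trans ?_
    refine Eq.trans ?_ (uncurry_eComp _ _).symm
    refine (congrArg₂ (fun s t => _ ◁ (β_ _ _).hom ≫ (α_ _ _ _).inv ≫ s ▷ (X ⟶[V] Y) ≫ t)
      (uncurry_nerveObj_map J X c c') (MonoidalClosed.uncurry_curry _)).trans ?_
    refine Eq.trans ?_ (congrArg₂ (fun s t => (α_ _ _ _).inv ≫ s ▷ (c ⟶[V] c') ≫ t)
      (MonoidalClosed.uncurry_curry _) (uncurry_nerveObj_map J Y c c')).symm
    exact nerve_aux (J.map c'.unop c.unop)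

/-- The `V`-functor `K(J, 1) : K ⥤ [Cᵒᵖ, V]` sending `X` to `K(J -, X)`. -/
def nerve [HasFunctorCategory V Cᵒᵖ V] (J : EnrichedFunctor V C D) :
    EnrichedFunctor V D (EnrichedFunctor V Cᵒᵖ V) where
  obj X := nerveObj J X
  map X Y := natLift (nerveFam J X Y)
  map_id X := natObj_hom_ext fun c => by
    refine (Category.assoc _ _ _).trans (Eq.trans (congrArg _ (natLift_π _ _)) ?_)
    exact ((homFunctor (J.obj c.unop)).map_id X).trans
      (functorCategory_eId_π (nerveObj J X) c).symm
  map_comp X Y Z := natObj_hom_ext fun c => by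
    refine (Category.assoc _ _ _).trans (Eq.trans (congrArg _ (natLift_π _ _)) ?_)
    refine ((homFunctor (J.obj c.unop)).map_comp X Y Z).trans (Eq.symm ?_)
    refine (Category.assoc _ _ _).trans (Eq.trans (congrArg _ (functorCategory_eComp_π _ _ _ _)) ?_)
    refine (tensorHom_comp_tensorHom_assoc _ _ _ _ _).trans ?_
    exact congrArg₂ (fun s t => (s ⊗ₘ t) ≫ eComp V _ _ _) (natLift_π _ _) (natLift_π _ _)

end HomFunctors

section Constructions

variable {V : Type u} [Category.{v} V] [MonoidalCategory V] [SymmetricCategory V]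

variable {A : Type u₁} [EnrichedCategory V A] {B : Type u₂} [EnrichedCategory V B]
  {C : Type u₃} [EnrichedCategory V C]

theorem whisker_aux₁ {P Q R S T : V} (f : P ⟶ Q) (g : Q ⟶ R) (h : S ⟶ T) {Z : V}
    (k : R ⊗ T ⟶ Z) : ((f ≫ g) ⊗ₘ h) ≫ k = f ▷ S ≫ (g ⊗ₘ h) ≫ k := by
  rw [MonoidalCategory.tensorHom_def, MonoidalCategory.tensorHom_def]
  simp

theorem whisker_aux₂ {P Q R S T : V} (f : P ⟶ Q) (g : Q ⟶ R) (h : S ⟶ T) {Z : V}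
    (k : T ⊗ R ⟶ Z) : S ◁ f ≫ (h ⊗ₘ g) ≫ k = (h ⊗ₘ (f ≫ g)) ≫ k := by
  rw [tensorHom_def', tensorHom_def']
  simp

/-- Restriction of a `V`-natural family along a `V`-functor. -/
@[simps]
def GradedNat.whisker {W : V} (E : EnrichedFunctor V A B) {M N : EnrichedFunctor V B C}
    (σ : GradedNat W M N) : GradedNat W (E.comp V M) (E.comp V N) where
  app X := σ.app (E.obj X)
  naturality X Y := by
    have h := congrArg (fun t => W ◁ E.map X Y ≫ t) (σ.naturality (E.obj X) (E.obj Y))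
    simp only [BraidedCategory.braiding_naturality_right_assoc] at h
    refine Eq.trans (congrArg (fun t => (β_ W (X ⟶[V] Y)).hom ≫ t) ?_) (h.trans ?_)
    · exact whisker_aux₁ (E.map X Y) (M.map _ _) _ _
    · exact whisker_aux₂ (E.map X Y) (N.map _ _) _ _

/-- The `V`-functor `[E, C] : [B, C] ⥤ [A, C]` given by restriction along `E`. -/
def precomp [HasFunctorCategory V A C] [HasFunctorCategory V B C] (E : EnrichedFunctor V A B) :
    EnrichedFunctor V (EnrichedFunctor V B C) (EnrichedFunctor V A C) where
  obj M := E.comp V M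
  map M N := natLift ((natObjFam M N).whisker E)
  map_id M := natObj_hom_ext fun X => by
    refine (Category.assoc _ _ _).trans (Eq.trans (congrArg _ (natLift_π _ _)) ?_)
    exact (functorCategory_eId_π M (E.obj X)).trans
      (functorCategory_eId_π (E.comp V M) X).symm
  map_comp M N P := natObj_hom_ext fun X => by
    refine (Category.assoc _ _ _).trans (Eq.trans (congrArg _ (natLift_π _ _)) ?_)
    refine (functorCategory_eComp_π _ _ _ _).trans (Eq.symm ?_)
    refine (Category.assoc _ _ _).trans (Eq.trans (congrArg _ (functorCategory_eComp_π _ _ _ _)) ?_)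
    refine (tensorHom_comp_tensorHom_assoc _ _ _ _ _).trans ?_
    exact congrArg₂ (fun s t => (s ⊗ₘ t) ≫ eComp V _ _ _) (natLift_π _ _) (natLift_π _ _)

end Constructions

section Subcategories

variable {V : Type u} [Category.{v} V] [MonoidalCategory V]

variable {A : Type u₁} [EnrichedCategory V A] {B : Type u₂} [EnrichedCategory V B]
  {C : Type u₃} [EnrichedCategory V C]

/-- The full sub-`V`-category on the objects satisfying `P`. -/
@[ext]
structure FullSub (P : C → Prop) where
  /-- the underlying object -/
  obj : C
  property : P obj

instance (P : C → Prop) : EnrichedCategory V (FullSub P) where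
  Hom X Y := X.obj ⟶[V] Y.obj
  id X := eId V X.obj
  comp X Y Z := eComp V X.obj Y.obj Z.obj
  id_comp X Y := e_id_comp V X.obj Y.obj
  comp_id X Y := e_comp_id V X.obj Y.obj
  assoc X Y Z W := e_assoc V X.obj Y.obj Z.obj W.obj

variable (V) in
/-- The inclusion of a full sub-`V`-category. -/
def FullSub.incl (P : C → Prop) : EnrichedFunctor V (FullSub P) C where
  obj X := X.obj
  map X Y := 𝟙 (X.obj ⟶[V] Y.obj)
  map_id X := Category.comp_id _
  map_comp X Y Z := by
    refine (Category.comp_id _).trans (Eq.symm ?_)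
    exact (congrArg (· ≫ eComp V X.obj Y.obj Z.obj) (id_tensorHom_id _ _)).trans
      (Category.id_comp _)

/-- The objects of the pullback in `V-Cat` of `F : A ⥤ C` and `G : B ⥤ C`: pairs of objects with
the same image. -/
structure VPullback (F : EnrichedFunctor V A C) (G : EnrichedFunctor V B C) where
  /-- the object of `A` -/
  fst : A
  /-- the object of `B` -/
  snd : B
  eq : F.obj fst = G.obj snd

namespace VPullback

theorem eComp_eqToHom {X Y Z X' Y' Z' : C} (hX : X = X') (hY : Y = Y') (hZ : Z = Z') :
    (eqToHom (by rw [hX, hY] : (X ⟶[V] Y) = (X' ⟶[V] Y')) ⊗ₘ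
      eqToHom (by rw [hY, hZ] : (Y ⟶[V] Z) = (Y' ⟶[V] Z'))) ≫ eComp V X' Y' Z' =
    eComp V X Y Z ≫ eqToHom (by rw [hX, hZ]) := by
  subst hX hY hZ
  simp

theorem eId_eqToHom {X X' : C} (hX : X = X') :
    eId V X ≫ eqToHom (by rw [hX] : (X ⟶[V] X) = (X' ⟶[V] X')) = eId V X' := by
  subst hX
  simp

variable {F : EnrichedFunctor V A C} {G : EnrichedFunctor V B C}

/-- The identification of hom-objects of `C` induced by the equalities of objects. -/
def homEq (P Q : VPullback F G) :
    (G.obj P.snd ⟶[V] G.obj Q.snd) ⟶ (F.obj P.fst ⟶[V] F.obj Q.fst) :=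
  eqToHom (by rw [P.eq, Q.eq])

variable [Limits.HasPullbacks V]

/-- The hom-objects of the pullback: the pullback of the hom-objects. -/
def hom (P Q : VPullback F G) : V :=
  Limits.pullback (F.map P.fst Q.fst) (G.map P.snd Q.snd ≫ homEq P Q)

/-- The first projection on hom-objects. -/
def homFst (P Q : VPullback F G) : hom P Q ⟶ (P.fst ⟶[V] Q.fst) := Limits.pullback.fst _ _

/-- The second projection on hom-objects. -/
def homSnd (P Q : VPullback F G) : hom P Q ⟶ (P.snd ⟶[V] Q.snd) := Limits.pullback.snd _ _

theorem hom_condition (P Q : VPullback F G) :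
    homFst P Q ≫ F.map P.fst Q.fst = homSnd P Q ≫ G.map P.snd Q.snd ≫ homEq P Q :=
  Limits.pullback.condition

theorem hom_ext {P Q : VPullback F G} {W : V} {f g : W ⟶ hom P Q}
    (h₁ : f ≫ homFst P Q = g ≫ homFst P Q) (h₂ : f ≫ homSnd P Q = g ≫ homSnd P Q) : f = g :=
  Limits.pullback.hom_ext h₁ h₂

/-- Morphisms into the hom-objects of the pullback. -/
def homLift {P Q : VPullback F G} {W : V} (f : W ⟶ (P.fst ⟶[V] Q.fst))
    (g : W ⟶ (P.snd ⟶[V] Q.snd))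
    (h : f ≫ F.map P.fst Q.fst = g ≫ G.map P.snd Q.snd ≫ homEq P Q) : W ⟶ hom P Q :=
  Limits.pullback.lift f g h

@[simp]
theorem homLift_fst {P Q : VPullback F G} {W : V} (f : W ⟶ (P.fst ⟶[V] Q.fst))
    (g : W ⟶ (P.snd ⟶[V] Q.snd))
    (h : f ≫ F.map P.fst Q.fst = g ≫ G.map P.snd Q.snd ≫ homEq P Q) :
    homLift f g h ≫ homFst P Q = f :=
  Limits.pullback.lift_fst _ _ _

@[simp]
theorem homLift_snd {P Q : VPullback F G} {W : V} (f : W ⟶ (P.fst ⟶[V] Q.fst))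
    (g : W ⟶ (P.snd ⟶[V] Q.snd))
    (h : f ≫ F.map P.fst Q.fst = g ≫ G.map P.snd Q.snd ≫ homEq P Q) :
    homLift f g h ≫ homSnd P Q = g :=
  Limits.pullback.lift_snd _ _ _

/-- Identities in the pullback. -/
def homId (P : VPullback F G) : 𝟙_ V ⟶ hom P P :=
  homLift (eId V P.fst) (eId V P.snd) (by
    rw [F.map_id, G.map_id_assoc]
    exact (eId_eqToHom P.eq.symm).symm)

/-- Composition in the pullback. -/
def homComp (P Q R : VPullback F G) : hom P Q ⊗ hom Q R ⟶ hom P R :=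
  homLift ((homFst P Q ⊗ₘ homFst Q R) ≫ eComp V _ _ _)
    ((homSnd P Q ⊗ₘ homSnd Q R) ≫ eComp V _ _ _) (by
      simp only [Category.assoc, F.map_comp, G.map_comp_assoc, tensorHom_comp_tensorHom_assoc,
        hom_condition]
      rw [← tensorHom_comp_tensorHom_assoc, ← tensorHom_comp_tensorHom_assoc]
      rw [tensorHom_comp_tensorHom_assoc]
      congr 1
      exact eComp_eqToHom P.eq.symm Q.eq.symm R.eq.symm)

/-- The pullback `V`-category. -/
instance : EnrichedCategory V (VPullback F G) where
  Hom := hom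
  id := homId
  comp := homComp
  id_comp P Q := by
    apply hom_ext
    · rw [Category.id_comp]
      exact sub_id_comp _ _ _ _ (homLift_fst _ _ _) (homLift_fst _ _ _)
    · rw [Category.id_comp]
      exact sub_id_comp _ _ _ _ (homLift_snd _ _ _) (homLift_snd _ _ _)
  comp_id P Q := by
    apply hom_ext
    · rw [Category.id_comp]
      exact sub_comp_id _ _ _ _ (homLift_fst _ _ _) (homLift_fst _ _ _)
    · rw [Category.id_comp]
      exact sub_comp_id _ _ _ _ (homLift_snd _ _ _) (homLift_snd _ _ _)
  assoc P Q R S := by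
    apply hom_ext
    · exact sub_assoc _ _ _ _ _ _ _ _ _ _ (homLift_fst _ _ _) (homLift_fst _ _ _)
        (homLift_fst _ _ _) (homLift_fst _ _ _)
    · exact sub_assoc _ _ _ _ _ _ _ _ _ _ (homLift_snd _ _ _) (homLift_snd _ _ _)
        (homLift_snd _ _ _) (homLift_snd _ _ _)

variable (F G)

/-- The projection from the pullback to `A`. -/
def fstFunctor : EnrichedFunctor V (VPullback F G) A where
  obj P := P.fst
  map P Q := homFst P Q
  map_id _ := homLift_fst _ _ _
  map_comp _ _ _ := homLift_fst _ _ _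

end VPullback

end Subcategories


section SmallFunctorCategories

variable {V : Type u} [Category.{v} V] [MonoidalCategory V] [SymmetricCategory V]
  [MonoidalClosed V]

theorem natural_iff {D : Type u₂} [EnrichedCategory V D] {W H : V} {A B A' B' : D}
    (F : H ⟶ (A ⟶[V] B)) (G : H ⟶ (A' ⟶[V] B')) (s : W ⟶ (B ⟶[V] B')) (t : W ⟶ (A ⟶[V] A')) :
    (β_ W H).hom ≫ (F ⊗ₘ s) ≫ eComp V A B B' = (t ⊗ₘ G) ≫ eComp V A A' B' ↔
      s ≫ MonoidalClosed.curry (F ▷ _ ≫ eComp V A B B') =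
        t ≫ MonoidalClosed.curry ((β_ _ _).hom ≫ _ ◁ G ≫ eComp V A A' B') := by
  rw [← MonoidalClosed.curry_natural_left, ← MonoidalClosed.curry_natural_left,
    MonoidalClosed.curry_injective.eq_iff, ← cancel_epi (β_ W H).hom (Y := H ⊗ W),
    BraidedCategory.braiding_naturality_right_assoc, SymmetricCategory.symmetry_assoc,
    ← tensorHom_def'_assoc, MonoidalCategory.tensorHom_def t G, Category.assoc]

variable {C : Type v} [EnrichedCategory V C] {D : Type u₂} [EnrichedCategory V D]

/-- The functor `V`-category `[C, D]` exists when `C` is small and `V` is complete. -/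
instance hasFunctorCategory_of_small [Limits.HasLimits V] : HasFunctorCategory V C D where
  exists_natObj F G := by
    let P : V := ∏ᶜ fun X : C => (F.obj X ⟶[V] G.obj X)
    let pr (X : C) : P ⟶ (F.obj X ⟶[V] G.obj X) := Limits.Pi.π _ X
    let Q (p : C × C) : V := (ihom (p.1 ⟶[V] p.2)).obj (F.obj p.1 ⟶[V] G.obj p.2)
    let r₁ : P ⟶ ∏ᶜ Q := Limits.Pi.lift fun p => pr p.2 ≫
      MonoidalClosed.curry (F.map p.1 p.2 ▷ _ ≫ eComp V _ _ _)
    let r₂ : P ⟶ ∏ᶜ Q := Limits.Pi.lift fun p => pr p.1 ≫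
      MonoidalClosed.curry ((β_ _ _).hom ≫ _ ◁ G.map p.1 p.2 ≫ eComp V _ _ _)
    have h₁ (p : C × C) : r₁ ≫ Limits.Pi.π Q p = _ := Limits.Pi.lift_π _ _
    have h₂ (p : C × C) : r₂ ≫ Limits.Pi.π Q p = _ := Limits.Pi.lift_π _ _
    refine ⟨Limits.equalizer r₁ r₂, ⟨fun X => Limits.equalizer.ι r₁ r₂ ≫ pr X, fun X Y => ?_⟩, ?_⟩
    · rw [natural_iff]
      have h := congrArg (fun t => t ≫ Limits.Pi.π Q (X, Y)) (Limits.equalizer.condition r₁ r₂)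
      simp only [Category.assoc, h₁, h₂] at h
      simpa only [Category.assoc] using h
    · intro W σ
      have hs (X : C) : Limits.Pi.lift σ.app ≫ pr X = σ.app X := Limits.Pi.lift_π _ _
      refine ⟨Limits.equalizer.lift (Limits.Pi.lift σ.app) ?_, ?_, ?_⟩
      · refine Limits.Pi.hom_ext _ _ fun p => ?_
        rw [Category.assoc, Category.assoc, h₁, h₂, ← Category.assoc, ← Category.assoc, hs, hs]
        exact (natural_iff _ _ _ _).1 (σ.naturality p.1 p.2)
      · intro X
        change _ ≫ Limits.equalizer.ι r₁ r₂ ≫ pr X = _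
        rw [Limits.equalizer.lift_ι_assoc, hs]
      · intro f hf
        refine Limits.equalizer.hom_ext (Limits.Pi.hom_ext _ _ fun X => ?_)
        rw [Limits.equalizer.lift_ι]
        refine (Category.assoc _ _ _).trans ((hf X).trans (hs X).symm)

end SmallFunctorCategories

section WeightedLimits

variable {V : Type u} [Category.{v} V] [MonoidalCategory V] [SymmetricCategory V]
  [MonoidalClosed V]

variable {D : Type w} [EnrichedCategory V D] {C : Type u₁} [EnrichedCategory V C]
  {C' : Type u₂} [EnrichedCategory V C']

/-- The action `F d ⊗ D(d, d') ⟶ F d'` of a `V`-functor `F : D ⥤ V`. -/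
def act (F : EnrichedFunctor V D V) (d d' : D) : F.obj d ⊗ (d ⟶[V] d') ⟶ F.obj d' :=
  MonoidalClosed.uncurry (F.map d d')

/-- A family `W ⊗ F d ⟶ C(X, S d)`, `V`-natural in `d`; equivalently, a morphism from `W` to
the object of `V`-natural transformations from `F` to `C(X, S -)`. -/
structure GradedCone (F : EnrichedFunctor V D V) (S : EnrichedFunctor V D C) (W : V) (X : C) where
  /-- the components -/
  app : ∀ d : D, W ⊗ F.obj d ⟶ (X ⟶[V] S.obj d)
  naturality : ∀ d d' : D,
    (α_ W (F.obj d) (d ⟶[V] d')).hom ≫ W ◁ act F d d' ≫ app d' =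
      (app d ⊗ₘ S.map d d') ≫ eComp V X (S.obj d) (S.obj d')

/-- A cone over `S : D ⥤ C` weighted by `F : D ⥤ V`: an object `pt` of `C` and a family
`F d ⟶ C(pt, S d)`, `V`-natural in `d`. -/
structure WCone (F : EnrichedFunctor V D V) (S : EnrichedFunctor V D C) where
  /-- the vertex -/
  pt : C
  /-- the projections -/
  π : ∀ d : D, F.obj d ⟶ (pt ⟶[V] S.obj d)
  naturality : ∀ d d' : D,
    act F d d' ≫ π d' = (π d ⊗ₘ S.map d d') ≫ eComp V pt (S.obj d) (S.obj d')

/-- A weighted cone with vertex `L` exhibits `L` as the weighted limit `{F, S}` if it induces an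
isomorphism between `C(X, L)` and the object of `V`-natural transformations from `F` to
`C(X, S -)`, for all `X`. -/
def WCone.IsLimit {F : EnrichedFunctor V D V} {S : EnrichedFunctor V D C} (c : WCone F S) : Prop :=
  ∀ (W : V) (X : C) (θ : GradedCone F S W X),
    ∃! f : W ⟶ (X ⟶[V] c.pt), ∀ d : D, (f ⊗ₘ c.π d) ≫ eComp V X c.pt (S.obj d) = θ.app d

/-- The image of a weighted cone under a `V`-functor. -/
def WCone.map {F : EnrichedFunctor V D V} {S : EnrichedFunctor V D C} (c : WCone F S)
    (G : EnrichedFunctor V C C') : WCone F (S.comp V G) where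
  pt := G.obj c.pt
  π d := c.π d ≫ G.map c.pt (S.obj d)
  naturality d d' := by
    refine (Category.assoc _ _ _).symm.trans ((congrArg (· ≫ G.map _ _) (c.naturality d d')).trans ?_)
    refine (Category.assoc _ _ _).trans ((congrArg _ (G.map_comp _ _ _)).trans ?_)
    exact tensorHom_comp_tensorHom_assoc _ _ _ _ _

/-- A family `F d ⊗ W ⟶ C(R d, X)`, `V`-natural in `d`; equivalently, a morphism from `W` to
the object of `V`-natural transformations from `F` to `C(R -, X)`. -/
structure GradedCocone (F : EnrichedFunctor V D V) (R : EnrichedFunctor V Dᵒᵖ C) (W : V)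
    (X : C) where
  /-- the components -/
  app : ∀ d : D, F.obj d ⊗ W ⟶ (R.obj (op d) ⟶[V] X)
  naturality : ∀ d d' : D,
    act F d d' ▷ W ≫ app d' =
      (β_ (F.obj d) (d ⟶[V] d')).hom ▷ W ≫ (α_ (d ⟶[V] d') (F.obj d) W).hom ≫
        (R.map (op d') (op d) ⊗ₘ app d) ≫ eComp V (R.obj (op d')) (R.obj (op d)) X

/-- A cocone under `R : Dᵒᵖ ⥤ C` weighted by `F : D ⥤ V`: an object `pt` of `C` and a family
`F d ⟶ C(R d, pt)`, `V`-natural in `d`. -/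
structure WCocone (F : EnrichedFunctor V D V) (R : EnrichedFunctor V Dᵒᵖ C) where
  /-- the vertex -/
  pt : C
  /-- the coprojections -/
  ι : ∀ d : D, F.obj d ⟶ (R.obj (op d) ⟶[V] pt)
  naturality : ∀ d d' : D,
    act F d d' ≫ ι d' =
      (β_ (F.obj d) (d ⟶[V] d')).hom ≫
        (R.map (op d') (op d) ⊗ₘ ι d) ≫ eComp V (R.obj (op d')) (R.obj (op d)) pt

/-- A weighted cocone with vertex `L` exhibits `L` as the weighted colimit `F * R` if it induces an
isomorphism between `C(L, X)` and the object of `V`-natural transformations from `F` to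
`C(R -, X)`, for all `X`. -/
def WCocone.IsColimit {F : EnrichedFunctor V D V} {R : EnrichedFunctor V Dᵒᵖ C}
    (c : WCocone F R) : Prop :=
  ∀ (W : V) (X : C) (θ : GradedCocone F R W X),
    ∃! f : W ⟶ (c.pt ⟶[V] X), ∀ d : D, (c.ι d ⊗ₘ f) ≫ eComp V (R.obj (op d)) c.pt X = θ.app d

/-- The image of a weighted cocone under a `V`-functor. -/
def WCocone.map {F : EnrichedFunctor V D V} {R : EnrichedFunctor V Dᵒᵖ C} (c : WCocone F R)
    (G : EnrichedFunctor V C C') : WCocone F (R.comp V G) where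
  pt := G.obj c.pt
  ι d := c.ι d ≫ G.map (R.obj (op d)) c.pt
  naturality d d' := by
    refine (Category.assoc _ _ _).symm.trans ((congrArg (· ≫ G.map _ _) (c.naturality d d')).trans ?_)
    refine (Category.assoc _ _ _).trans (congrArg (fun t => (β_ _ _).hom ≫ t) ?_)
    refine (Category.assoc _ _ _).trans ((congrArg _ (G.map_comp _ _ _)).trans ?_)
    exact tensorHom_comp_tensorHom_assoc _ _ _ _ _

/-- The family obtained by composing a weighted cocone with `f : W ⟶ C(pt, X)`. -/
def WCocone.extend {F : EnrichedFunctor V D V} {R : EnrichedFunctor V Dᵒᵖ C} (c : WCocone F R)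
    {W : V} {X : C} (f : W ⟶ (c.pt ⟶[V] X)) : GradedCocone F R W X where
  app d := (c.ι d ⊗ₘ f) ≫ eComp V (R.obj (op d)) c.pt X
  naturality d d' := by
    rw [← comp_comp_comp, ← whisker_aux₁, c.naturality, whisker_aux₁]

theorem WCocone.IsColimit.hom_ext {F : EnrichedFunctor V D V} {R : EnrichedFunctor V Dᵒᵖ C}
    {c : WCocone F R} (hc : c.IsColimit) {W : V} {X : C} {f g : W ⟶ (c.pt ⟶[V] X)}
    (h : ∀ d : D, (c.ι d ⊗ₘ f) ≫ eComp V (R.obj (op d)) c.pt X =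
      (c.ι d ⊗ₘ g) ≫ eComp V (R.obj (op d)) c.pt X) : f = g :=
  (hc W X (c.extend g)).unique h (fun _ => rfl)

variable (C) in
/-- All colimits in `C` weighted by `F` exist. -/
class HasWColimits (F : EnrichedFunctor V D V) : Prop where
  exists_colimit : ∀ R : EnrichedFunctor V Dᵒᵖ C, ∃ c : WCocone F R, c.IsColimit

section

variable (F : EnrichedFunctor V D V) [HasWColimits C F]

/-- A chosen colimit cocone. -/
def colimCocone (R : EnrichedFunctor V Dᵒᵖ C) : WCocone F R :=
  (HasWColimits.exists_colimit R).choose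

theorem colimCocone_isColimit (R : EnrichedFunctor V Dᵒᵖ C) : (colimCocone F R).IsColimit :=
  (HasWColimits.exists_colimit R).choose_spec

variable [HasFunctorCategory V Dᵒᵖ C]

theorem braid_aux (A B N : V) :
    (β_ (A ⊗ B) N).hom ≫ N ◁ (β_ A B).hom ≫ (α_ N B A).inv ≫ (β_ N B).hom ▷ A ≫ (α_ B N A).hom =
      (β_ A B).hom ▷ N ≫ (α_ B A N).hom ≫ B ◁ (β_ A N).hom := by
  rw [← BraidedCategory.braiding_naturality_left_assoc, BraidedCategory.braiding_tensor_left_hom]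
  simp only [Category.assoc, Iso.hom_inv_id_assoc]
  rw [← comp_whiskerRight_assoc, SymmetricCategory.symmetry]
  simp

theorem colimMap_aux {A A' B N : V} {X₁ X₂ Y₁ Y₂ Z : C} (a : A ⊗ B ⟶ A')
    (r : B ⟶ (X₁ ⟶[V] X₂)) (r' : B ⟶ (Y₁ ⟶[V] Y₂)) (p₁ : N ⟶ (X₁ ⟶[V] Y₁))
    (p₂ : N ⟶ (X₂ ⟶[V] Y₂)) (i : A ⟶ (Y₂ ⟶[V] Z)) (i' : A' ⟶ (Y₁ ⟶[V] Z))
    (hp : (β_ N B).hom ≫ (r ⊗ₘ p₂) ≫ eComp V X₁ X₂ Y₂ = (p₁ ⊗ₘ r') ≫ eComp V X₁ Y₁ Y₂)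
    (hi : a ≫ i' = (β_ A B).hom ≫ (r' ⊗ₘ i) ≫ eComp V Y₁ Y₂ Z) :
    a ▷ N ≫ (β_ A' N).hom ≫ (p₁ ⊗ₘ i') ≫ eComp V X₁ Y₁ Z =
      (β_ A B).hom ▷ N ≫ (α_ B A N).hom ≫
        (r ⊗ₘ ((β_ A N).hom ≫ (p₂ ⊗ₘ i) ≫ eComp V X₂ Y₂ Z)) ≫ eComp V X₁ X₂ Z := by
  have e := comp_comp_comp p₁ r' i
  rw [← Iso.inv_comp_eq, ← hp, whisker_aux₁, comp_comp_comp] at e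
  rw [BraidedCategory.braiding_naturality_left_assoc, whisker_aux₂, hi, ← whisker_aux₂, ← e,
    ← whisker_aux₂ (β_ A N).hom, ← reassoc_of% braid_aux A B N]

/-- The family `F d ⊗ [Dᵒᵖ, C](R, R') ⟶ C(R d, F * R')`. -/
def colimMapFam (R R' : EnrichedFunctor V Dᵒᵖ C) :
    GradedCocone F R (natObj R R') (colimCocone F R').pt where
  app d := (β_ (F.obj d) (natObj R R')).hom ≫
    (natObjπ R R' (op d) ⊗ₘ (colimCocone F R').ι d) ≫ eComp V _ _ _
  naturality d d' :=
    colimMap_aux (act F d d') (R.map (op d') (op d)) (R'.map (op d') (op d)) _ _ _ _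
      ((natObjFam R R').naturality (op d') (op d)) ((colimCocone F R').naturality d d')

/-- The action of `F * -` on hom-objects. -/
def colimMap (R R' : EnrichedFunctor V Dᵒᵖ C) :
    natObj R R' ⟶ ((colimCocone F R).pt ⟶[V] (colimCocone F R').pt) :=
  (colimCocone_isColimit F R _ _ (colimMapFam F R R')).choose

theorem ι_colimMap (R R' : EnrichedFunctor V Dᵒᵖ C) (d : D) :
    ((colimCocone F R).ι d ⊗ₘ colimMap F R R') ≫ eComp V (R.obj (op d)) _ _ =
      (β_ (F.obj d) (natObj R R')).hom ≫
        (natObjπ R R' (op d) ⊗ₘ (colimCocone F R').ι d) ≫ eComp V _ _ _ :=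
  (colimCocone_isColimit F R _ _ (colimMapFam F R R')).choose_spec.1 d

theorem colimId_aux {A N : V} {X Y : C} (i : A ⟶ (X ⟶[V] Y)) (j : 𝟙_ V ⟶ N)
    (p : N ⟶ (X ⟶[V] X)) (m : N ⟶ (Y ⟶[V] Y)) (hj : j ≫ p = eId V X)
    (h : (i ⊗ₘ m) ≫ eComp V X Y Y = (β_ A N).hom ≫ (p ⊗ₘ i) ≫ eComp V X X Y) :
    (i ⊗ₘ (j ≫ m)) ≫ eComp V X Y Y = (i ⊗ₘ eId V Y) ≫ eComp V X Y Y := by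
  have h₁ := e_id_comp V X Y
  have h₂ := e_comp_id V X Y
  rw [Iso.inv_comp_eq, Category.comp_id] at h₁ h₂
  rw [← whisker_aux₂, h, BraidedCategory.braiding_naturality_right_assoc, ← whisker_aux₁, hj,
    MonoidalCategory.tensorHom_def', Category.assoc, h₁,
    MonoidalCategory.tensorHom_def, Category.assoc, h₂, braiding_tensorUnit_right]
  simp

theorem colimComp_aux {A N N' M : V} {X X' X'' Y Y' Y'' : C} (i : A ⟶ (X ⟶[V] Y))
    (i' : A ⟶ (X' ⟶[V] Y')) (i'' : A ⟶ (X'' ⟶[V] Y'')) (p : N ⟶ (X ⟶[V] X'))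
    (p' : N' ⟶ (X' ⟶[V] X'')) (p'' : M ⟶ (X ⟶[V] X'')) (m : N ⟶ (Y ⟶[V] Y'))
    (m' : N' ⟶ (Y' ⟶[V] Y'')) (m'' : M ⟶ (Y ⟶[V] Y'')) (k : N ⊗ N' ⟶ M)
    (hk : k ≫ p'' = (p ⊗ₘ p') ≫ eComp V X X' X'')
    (h : (i ⊗ₘ m) ≫ eComp V X Y Y' = (β_ A N).hom ≫ (p ⊗ₘ i') ≫ eComp V X X' Y')
    (h' : (i' ⊗ₘ m') ≫ eComp V X' Y' Y'' = (β_ A N').hom ≫ (p' ⊗ₘ i'') ≫ eComp V X' X'' Y'')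
    (h'' : (i ⊗ₘ m'') ≫ eComp V X Y Y'' = (β_ A M).hom ≫ (p'' ⊗ₘ i'') ≫ eComp V X X'' Y'') :
    (i ⊗ₘ (k ≫ m'')) ≫ eComp V X Y Y'' =
      (i ⊗ₘ ((m ⊗ₘ m') ≫ eComp V Y Y' Y'')) ≫ eComp V X Y Y'' := by
  have e := comp_comp_comp i m m'
  rw [← Iso.inv_comp_eq, h, whisker_aux₁, comp_comp_comp, h', ← whisker_aux₂] at e
  rw [← e, ← whisker_aux₂, h'', BraidedCategory.braiding_naturality_right_assoc, ← whisker_aux₁,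
    hk, comp_comp_comp, BraidedCategory.braiding_tensor_right_hom]
  simp only [Category.assoc, Iso.inv_hom_id_assoc]

/-- The `V`-functor `F * - : [Dᵒᵖ, C] ⥤ C` sending `R` to its `F`-weighted colimit. -/
def colimFunctor : EnrichedFunctor V (EnrichedFunctor V Dᵒᵖ C) C where
  obj R := (colimCocone F R).pt
  map R R' := colimMap F R R'
  map_id R := (colimCocone_isColimit F R).hom_ext fun d =>
    colimId_aux _ (eId V R) (natObjπ R R (op d)) _ (functorCategory_eId_π R (op d))
      (ι_colimMap F R R d)
  map_comp R R' R'' := (colimCocone_isColimit F R).hom_ext fun d =>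
    colimComp_aux _ _ _ _ _ _ _ _ _ (eComp V R R' R'') (functorCategory_eComp_π R R' R'' (op d))
      (ι_colimMap F R R' d) (ι_colimMap F R' R'' d) (ι_colimMap F R R'' d)

end

end WeightedLimits

section ColimitsInV

variable {V : Type u} [Category.{v} V] [MonoidalCategory V] [SymmetricCategory V]
  [MonoidalClosed V]

section

variable {D : Type v} [EnrichedCategory V D]

theorem colimV_aux₁ {A A' B R R' W X : V} (a : A ⊗ B ⟶ A') (b : R' ⊗ B ⟶ R)
    (θ : R ⊗ (A ⊗ W) ⟶ X) (θ' : R' ⊗ (A' ⊗ W) ⟶ X) :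
    R' ◁ a ≫ MonoidalClosed.curry ((β_ W (R' ⊗ A')).hom ≫ (α_ R' A' W).hom ≫ θ') =
        (R' ◁ (β_ A B).hom ≫ (α_ R' B A).inv ≫ b ▷ A) ≫
          MonoidalClosed.curry ((β_ W (R ⊗ A)).hom ≫ (α_ R A W).hom ≫ θ) ↔
      R' ◁ (a ▷ W) ≫ θ' =
        R' ◁ ((β_ A B).hom ▷ W ≫ (α_ B A W).hom) ≫ (α_ R' B (A ⊗ W)).inv ≫ b ▷ (A ⊗ W) ≫ θ := by
  rw [← MonoidalClosed.curry_natural_left, ← MonoidalClosed.curry_natural_left,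
    MonoidalClosed.curry_injective.eq_iff, BraidedCategory.braiding_naturality_right_assoc,
    BraidedCategory.braiding_naturality_right_assoc, cancel_epi,
    ← cancel_epi (α_ R' (A ⊗ B) W).hom]
  simp

/-- `V` has all small weighted colimits when it is cocomplete. -/
instance hasWColimits_self [Limits.HasColimits V] (F : EnrichedFunctor V D V) :
    HasWColimits V F where
  exists_colimit R := by
    let P (d : D) : V := R.obj (op d) ⊗ F.obj d
    let P' (p : D × D) : V := R.obj (op p.2) ⊗ (F.obj p.1 ⊗ (p.1 ⟶[V] p.2))
    let b (d d' : D) : R.obj (op d') ⊗ (d ⟶[V] d') ⟶ R.obj (op d) :=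
      MonoidalClosed.uncurry (R.map (op d') (op d))
    let t₁ (p : D × D) : P' p ⟶ P p.2 := R.obj (op p.2) ◁ act F p.1 p.2
    let t₂ (p : D × D) : P' p ⟶ P p.1 :=
      R.obj (op p.2) ◁ (β_ (F.obj p.1) (p.1 ⟶[V] p.2)).hom ≫ (α_ _ _ _).inv ≫
        b p.1 p.2 ▷ F.obj p.1
    let r₁ : ∐ P' ⟶ ∐ P := Limits.Sigma.desc fun p => t₁ p ≫ Limits.Sigma.ι P p.2
    let r₂ : ∐ P' ⟶ ∐ P := Limits.Sigma.desc fun p => t₂ p ≫ Limits.Sigma.ι P p.1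
    have h₁ (p : D × D) : Limits.Sigma.ι P' p ≫ r₁ = _ := Limits.Sigma.ι_desc _ _
    have h₂ (p : D × D) : Limits.Sigma.ι P' p ≫ r₂ = _ := Limits.Sigma.ι_desc _ _
    let Q : V := Limits.coequalizer r₁ r₂
    let c (d : D) : P d ⟶ Q := Limits.Sigma.ι P d ≫ Limits.coequalizer.π r₁ r₂
    have hc (p : D × D) : t₁ p ≫ c p.2 = t₂ p ≫ c p.1 := by
      have h := congrArg (fun t => Limits.Sigma.ι P' p ≫ t) (Limits.coequalizer.condition r₁ r₂)
      rw [← Category.assoc, ← Category.assoc, h₁, h₂] at h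
      simpa only [c, Category.assoc] using h
    have hext {X : V} {f g : Q ⟶ X} (h : ∀ d, c d ≫ f = c d ≫ g) : f = g := by
      refine Limits.coequalizer.hom_ext (Limits.Sigma.hom_ext _ _ fun d => ?_)
      simpa only [c, Category.assoc] using h d
    have hdesc {X : V} (k : ∀ d, P d ⟶ X) (hk : ∀ p : D × D, t₁ p ≫ k p.2 = t₂ p ≫ k p.1) :
        ∃ f : Q ⟶ X, ∀ d, c d ≫ f = k d := by
      refine ⟨Limits.coequalizer.desc (Limits.Sigma.desc k) ?_, fun d => ?_⟩
      · refine Limits.Sigma.hom_ext _ _ fun p => ?_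
        rw [← Category.assoc, ← Category.assoc, h₁, h₂, Category.assoc, Category.assoc,
          Limits.Sigma.ι_desc, Limits.Sigma.ι_desc]
        exact hk p
      · simp only [c, Category.assoc, Limits.coequalizer.π_desc, Limits.Sigma.ι_desc]
    refine ⟨⟨Q, fun d => MonoidalClosed.curry (c d), fun d d' => ?_⟩, ?_⟩
    · apply MonoidalClosed.uncurry_injective
      refine (MonoidalClosed.uncurry_natural_left _ _).trans ?_
      refine (congrArg (fun t => R.obj (op d') ◁ act F d d' ≫ t)
        (MonoidalClosed.uncurry_curry (c d'))).trans ?_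
      refine Eq.trans ?_ (MonoidalClosed.uncurry_natural_left _ _).symm
      refine Eq.trans ?_ (congrArg _ (uncurry_eComp (R.map (op d') (op d)) _)).symm
      refine Eq.trans ?_ (congrArg (fun t => _ ≫ _ ≫ _ ≫ t)
        (MonoidalClosed.uncurry_curry (c d))).symm
      refine (hc (d, d')).trans ?_
      simp only [t₂, b, Category.assoc]
      rfl
    · intro W X θ
      have hθ (d : D) (f : W ⟶ (ihom Q).obj X) :
          (MonoidalClosed.curry (c d) ⊗ₘ f) ≫ eComp V (R.obj (op d)) Q X = θ.app d ↔
            c d ≫ MonoidalClosed.curry ((β_ W Q).hom ≫ MonoidalClosed.uncurry f) =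
              MonoidalClosed.curry ((β_ W (P d)).hom ≫ (α_ _ _ _).hom ≫
                MonoidalClosed.uncurry (θ.app d)) := by
        rw [← MonoidalClosed.uncurry_injective.eq_iff, uncurry_eComp,
          MonoidalClosed.uncurry_curry, ← MonoidalClosed.curry_natural_left,
          MonoidalClosed.curry_injective.eq_iff, BraidedCategory.braiding_naturality_right_assoc,
          cancel_epi, Iso.inv_comp_eq]
      have hk : ∀ p : D × D, t₁ p ≫ MonoidalClosed.curry ((β_ W (P p.2)).hom ≫ (α_ _ _ _).hom ≫
            MonoidalClosed.uncurry (θ.app p.2)) =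
          t₂ p ≫ MonoidalClosed.curry ((β_ W (P p.1)).hom ≫ (α_ _ _ _).hom ≫
            MonoidalClosed.uncurry (θ.app p.1)) := by
        intro p
        refine (colimV_aux₁ _ _ _ _).2 ?_
        have h := congrArg MonoidalClosed.uncurry (θ.naturality p.1 p.2)
        refine (MonoidalClosed.uncurry_natural_left _ _).symm.trans (h.trans ?_)
        refine (congrArg _ (Category.assoc _ _ _).symm).trans ?_
        refine (MonoidalClosed.uncurry_natural_left _ _).trans ?_
        exact congrArg _ (uncurry_eComp (R.map (op p.2) (op p.1)) _)
      obtain ⟨g, hg⟩ := hdesc (fun d => MonoidalClosed.curry ((β_ W (P d)).hom ≫ (α_ _ _ _).hom ≫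
        MonoidalClosed.uncurry (θ.app d))) hk
      refine ⟨MonoidalClosed.curry ((β_ Q W).hom ≫ MonoidalClosed.uncurry g), fun d => ?_,
        fun f hf => ?_⟩
      · refine (hθ d _).2 ?_
        rw [MonoidalClosed.uncurry_curry, SymmetricCategory.symmetry_assoc,
          MonoidalClosed.curry_uncurry]
        exact hg d
      · have h : MonoidalClosed.curry ((β_ W Q).hom ≫ MonoidalClosed.uncurry f) = g :=
          hext fun d => ((hθ d f).1 (hf d)).trans (hg d).symm
        rw [← h, MonoidalClosed.uncurry_curry, SymmetricCategory.symmetry_assoc,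
          MonoidalClosed.curry_uncurry]

end

end ColimitsInV

section Weights

variable (V : Type u) [Category.{v} V] [MonoidalCategory V] [SymmetricCategory V]
  [MonoidalClosed V]

/-- A weight: a `V`-functor `fn : Dom ⥤ V`. Limits with this weight are limits of `V`-functors with
domain `Dom`, colimits with this weight are colimits of `V`-functors with domain `Domᵒᵖ`. -/
structure Weight where
  /-- the indexing `V`-category -/
  Dom : Type w
  [cat : EnrichedCategory V Dom]
  /-- the weight itself -/
  fn : EnrichedFunctor V Dom V

attribute [instance] Weight.cat

variable {V}

variable {D : Type w} [EnrichedCategory V D] {C : Type u₁} [EnrichedCategory V C]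
  {C' : Type u₂} [EnrichedCategory V C']

/-- `G` preserves the limits weighted by `F` that exist in its domain. -/
def PreservesWLimits (F : EnrichedFunctor V D V) (G : EnrichedFunctor V C C') : Prop :=
  ∀ (S : EnrichedFunctor V D C) (c : WCone F S), c.IsLimit → (c.map G).IsLimit

/-- `G` preserves the colimits weighted by `F` that exist in its domain. -/
def PreservesWColimits (F : EnrichedFunctor V D V) (G : EnrichedFunctor V C C') : Prop :=
  ∀ (R : EnrichedFunctor V Dᵒᵖ C) (c : WCocone F R), c.IsColimit → (c.map G).IsColimit

variable (Φ : Set (Weight.{w} V))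

variable (C) in
/-- `C` is `Φ`-complete. -/
def IsComplete : Prop :=
  ∀ φ ∈ Φ, ∀ S : EnrichedFunctor V φ.Dom C, ∃ c : WCone φ.fn S, c.IsLimit

/-- `G` is `Φ`-continuous: it preserves `Φ`-limits. -/
def IsContinuous (G : EnrichedFunctor V C C') : Prop :=
  ∀ φ ∈ Φ, PreservesWLimits φ.fn G

/-- The `V`-category `Φ-Cts(T, V)` of `Φ`-continuous `V`-functors from `T` to `V`. -/
abbrev Cts (T : Type v) [EnrichedCategory V T] : Type (max u v) :=
  FullSub fun M : EnrichedFunctor V T V => IsContinuous Φ M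

variable [Limits.HasLimits V] [Limits.HasColimits V]

/-- A weight `F : D ⥤ V` on a small `V`-category is `Φ`-flat if
`F * - : [Dᵒᵖ, V] ⥤ V` is `Φ`-continuous. -/
def IsFlat {D : Type v} [EnrichedCategory V D] (F : EnrichedFunctor V D V) : Prop :=
  IsContinuous Φ (colimFunctor (C := V) F)

/-- Every `Φ`-continuous `V`-functor `T ⥤ V` on a small `Φ`-complete `V`-category `T` is
`Φ`-flat. -/
def ContinuousFlat : Prop :=
  ∀ (T : Type v) [EnrichedCategory V T], IsComplete T Φ →
    ∀ F : EnrichedFunctor V T V, IsContinuous Φ F → IsFlat Φ F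

/-- `G` is `Φ`-accessible: it preserves `Φ`-flat colimits. -/
def IsAccessible (G : EnrichedFunctor V C C') : Prop :=
  ∀ (D : Type v) [EnrichedCategory V D] (F : EnrichedFunctor V D V), IsFlat Φ F →
    PreservesWColimits F G

/-- `X` is `Φ`-presentable: `C(X, -)` preserves `Φ`-flat colimits. -/
def IsPresentable (X : C) : Prop :=
  IsAccessible Φ (homFunctor (V := V) X)

/-- `K` is locally `Φ`-presentable: it is equivalent to `Φ-Cts(T, V)` for a small `Φ`-complete
`V`-category `T`. -/
def IsLocallyPresentable (K : Type u₁) [EnrichedCategory V K] : Prop :=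
  ∃ (T : Type v) (_ : EnrichedCategory V T), IsComplete T Φ ∧
    ∃ W : EnrichedFunctor V K (Cts Φ T), IsEquivalence W

/-- The full sub-`V`-category `K_Φ` of `Φ`-presentable objects. -/
abbrev Presentables (K : Type u₁) [EnrichedCategory V K] : Type u₁ :=
  FullSub fun X : K => IsPresentable Φ X

end Weights

section Theories

variable (V : Type u) [Category.{v} V] [MonoidalCategory V]

/-- An identity-on-objects `V`-functor out of a `V`-category `C`: a second `V`-category structure
on the objects of `C`, and a `V`-functor to it from `C` which is the identity on objects. -/
structure IdOnObjects (C : Type u₁) [EnrichedCategory V C] where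
  /-- the hom-objects of the codomain -/
  hom : C → C → V
  /-- the identities of the codomain -/
  id : ∀ X : C, 𝟙_ V ⟶ hom X X
  /-- composition in the codomain -/
  comp : ∀ X Y Z : C, hom X Y ⊗ hom Y Z ⟶ hom X Z
  id_comp : ∀ X Y : C, (λ_ (hom X Y)).inv ≫ id X ▷ hom X Y ≫ comp X X Y = 𝟙 (hom X Y)
  comp_id : ∀ X Y : C, (ρ_ (hom X Y)).inv ≫ hom X Y ◁ id Y ≫ comp X Y Y = 𝟙 (hom X Y)
  assoc : ∀ W X Y Z : C, (α_ (hom W X) (hom X Y) (hom Y Z)).inv ≫ comp W X Y ▷ hom Y Z ≫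
    comp W Y Z = hom W X ◁ comp X Y Z ≫ comp W X Z
  /-- the action of the functor on hom-objects -/
  map : ∀ X Y : C, (X ⟶[V] Y) ⟶ hom X Y
  map_id : ∀ X : C, eId V X ≫ map X X = id X
  map_comp : ∀ X Y Z : C, eComp V X Y Z ≫ map X Z = (map X Y ⊗ₘ map Y Z) ≫ comp X Y Z

variable {V}

/-- The objects of the codomain of an identity-on-objects `V`-functor. -/
def IdOnObjects.Cod {C : Type u₁} [EnrichedCategory V C] (_ : IdOnObjects V C) : Type u₁ := C

/-- The codomain of an identity-on-objects `V`-functor. -/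
instance {C : Type u₁} [EnrichedCategory V C] (L : IdOnObjects V C) : EnrichedCategory V L.Cod where
  Hom := L.hom
  id := L.id
  comp := L.comp
  id_comp := L.id_comp
  comp_id := L.comp_id
  assoc := L.assoc

/-- The underlying `V`-functor of an identity-on-objects `V`-functor. -/
def IdOnObjects.functor {C : Type u₁} [EnrichedCategory V C] (L : IdOnObjects V C) :
    EnrichedFunctor V C L.Cod where
  obj X := X
  map := L.map
  map_id := L.map_id
  map_comp := L.map_comp

variable [SymmetricCategory V] [MonoidalClosed V] [Limits.HasLimits V] [Limits.HasColimits V]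
  (Φ : Set (Weight.{w} V)) (K : Type u₁) [EnrichedCategory V K]

/-- A Lawvere `Φ`-theory on `K`: an identity-on-objects `V`-functor `E : K_Φᵒᵖ ⥤ L` which preserves
`Φ`-limits. -/
structure LawvereTheory extends IdOnObjects V (Presentables Φ K)ᵒᵖ where
  continuous : IsContinuous Φ toIdOnObjects.functor

namespace LawvereTheory

variable {Φ K} (L : LawvereTheory Φ K) [HasFunctorCategory V (Presentables Φ K)ᵒᵖ V]
  [HasFunctorCategory V L.Cod V]

/-- The `V`-category `Φ-Cts(L, V)` of models of a Lawvere `Φ`-theory: the pullback in `V-Cat` of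
`K(J, 1) : K ⥤ [K_Φᵒᵖ, V]`, for `J` the inclusion of `K_Φ` in `K`, along
`[E, V] : [L, V] ⥤ [K_Φᵒᵖ, V]`. -/
abbrev Models : Type _ :=
  VPullback (nerve (FullSub.incl V fun X : K => IsPresentable Φ X))
    (precomp (C := V) L.functor)

/-- The forgetful `V`-functor from models to `K`. -/
abbrev forget : EnrichedFunctor V L.Models K :=
  VPullback.fstFunctor _ _

end LawvereTheory

end Theories

end VCat

end

/-! Write `K` as `Φ-Cts(T, V)` with `T` small and `Φ`-complete. Representables are `Φ`-continuous,
so they give a `V`-functor `j : T ⥤ Kᵒᵖ` for which `K(j -, X)` is the continuous functor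
corresponding to `X`. This `j` is dense, and up to isomorphism the `Φ`-continuous functors on `T`
are exactly the `K(j -, X)`: see `exists_isDense` and `Presents`. The argument takes place in `B =
Kᵒᵖ`, where colimits of `K` are limit cones and `K(j -, X)` is the right module `B(X, j -)`.

Flatness enters through `IsFlat.continuous_lan`: the left Kan extension of a `Φ`-flat weight,
restricted along a functor on which the representables involved are `Φ`-continuous, is
`Φ`-continuous. It is used twice.

The first use shows that `Φ`-flat colimits in `K` are computed pointwise on `T`
(`Presents.isCoend_of_isLimit`). Hence every `j t` is `Φ`-presentable and `j` factors through some
`p : T ⥤ K_Φᵒᵖ`. By the standing assumption the weight `K(j -, X)` is `Φ`-flat. By density `X` is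
the colimit of `j` with this weight, and a presentable `k` preserves that colimit, so `K(k, X)` is
the coend over `t` of `K(j t, X) ⊗ K(k, j t)` (`Presents.isCoend_comp`). Thus `p` is absolutely
dense: every module over `K_Φᵒᵖ` is recovered from its restriction to `T` by a coend. This settles
the question of size, because natural families over `K_Φᵒᵖ` and over `L` reduce to natural families
over small `V`-categories, so both functor `V`-categories exist.

The second use constructs free models. A model is an object `X` with an action of `L` on `K(J -, X)`
extending the canonical action of `K_Φᵒᵖ` (`Algebraic`). The left Kan extension of `K(j -, X)` along
`T ⥤ L` is an `L`-module that is `Φ`-continuous on `T`, since `E` and `p` preserve `Φ`-limits. It is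
therefore of the form `K(J -, X')`, and `X'` is the free model on `X` (`exists_free`,
`IsFree.existsUnique`).

Monadicity is proved directly, without Beck's theorem. An algebra `α : U F X ⟶ X` makes `L` act on
`X` by `K(k, X) ⊗ L(k, l) ⟶ K(k, U F X) ⊗ L(k, l) ⟶ K(l, U F X) ⟶ K(l, X)`, using the unit, the
action on the free model, and `α`. The resulting model has `α` as its algebra
(`Algebraic.exists_map_eq`), and algebra morphisms are the same as equivariant morphisms
(`Algebraic.comparison_fullyFaithful`).

For accessibility, `K(j t, U F X)` is the coend over `s` of `K(j s, X) ⊗ L(s, t)`. The functors `K(j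
s, -)` preserve `Φ`-flat colimits, coends commute with coends, and the functors `K(j t, -)` jointly
detect colimits (`Algebraic.isAccessible`). -/

noncomputable section

namespace VCat

set_option linter.unusedSectionVars false

/-! ### Modules over a `V`-category, presented by actions so that no internal hom occurs -/

section Modules

variable {V : Type u} [Category.{v} V] [MonoidalCategory V]

/-- A right module over a `V`-category: a `V`-functor to `V`, given by its action. -/
structure RMod (C : Type u₁) [EnrichedCategory V C] where
  /-- the values -/
  obj : C → V
  /-- the action -/
  act : ∀ c d : C, obj c ⊗ (c ⟶[V] d) ⟶ obj d
  act_id : ∀ c, obj c ◁ eId V c ≫ act c c = (ρ_ (obj c)).hom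
  act_act : ∀ c d e, act c d ▷ (d ⟶[V] e) ≫ act d e =
      (α_ (obj c) (c ⟶[V] d) (d ⟶[V] e)).hom ≫ obj c ◁ eComp V c d e ≫ act c e

variable {C : Type u₁} [EnrichedCategory V C] {D : Type u₂} [EnrichedCategory V D]

namespace RMod

/-- Restriction of a module along a `V`-functor. -/
abbrev restrict (J : EnrichedFunctor V C D) (M : RMod (V := V) D) : RMod (V := V) C where
  obj c := M.obj (J.obj c)
  act c d := M.obj (J.obj c) ◁ J.map c d ≫ M.act (J.obj c) (J.obj d)
  act_id c := by
    rw [← MonoidalCategory.whiskerLeft_comp_assoc, J.map_id, M.act_id]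
  act_act c d e := by
    rw [comp_whiskerRight_assoc, ← whisker_exchange_assoc, M.act_act,
      ← MonoidalCategory.whiskerLeft_comp_assoc, J.map_comp,
      MonoidalCategory.whiskerLeft_comp_assoc, MonoidalCategory.tensorHom_def]
    simp

variable (V) in
/-- The representable module. -/
abbrev hom (X : C) : RMod (V := V) C where
  obj Y := X ⟶[V] Y
  act Y Z := eComp V X Y Z
  act_id Y := by rw [← Iso.inv_comp_eq_id, e_comp_id]
  act_act Y Z W := by rw [← e_assoc, Iso.hom_inv_id_assoc]

/-- A family `W ⊗ M c ⟶ N c` compatible with the actions. -/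
def IsHom (W : V) (M N : RMod (V := V) C) (σ : ∀ c, W ⊗ M.obj c ⟶ N.obj c) : Prop :=
  ∀ c d, (α_ W (M.obj c) (c ⟶[V] d)).hom ≫ W ◁ M.act c d ≫ σ d =
    σ c ▷ (c ⟶[V] d) ≫ N.act c d

theorem IsHom.reindex {W W' : V} {M N : RMod (V := V) C} {σ : ∀ c, W ⊗ M.obj c ⟶ N.obj c}
    (hσ : IsHom W M N σ) (f : W' ⟶ W) : IsHom W' M N (fun c => f ▷ M.obj c ≫ σ c) := by
  intro c d
  have h := hσ c d
  beta_reduce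
  rw [comp_whiskerRight_assoc, ← h, whisker_exchange_assoc, associator_naturality_left_assoc]

theorem IsHom.comp {W W' : V} {M N P : RMod (V := V) C}
    {σ : ∀ c, W ⊗ M.obj c ⟶ N.obj c} (hσ : IsHom W M N σ) {τ : ∀ c, W' ⊗ N.obj c ⟶ P.obj c}
    (hτ : IsHom W' N P τ) :
    IsHom (W' ⊗ W) M P (fun c => (α_ W' W (M.obj c)).hom ≫ W' ◁ σ c ≫ τ c) := by
  intro c d
  have h := hτ c d
  simp only [comp_whiskerRight, Category.assoc]
  rw [← h, associator_naturality_middle_assoc, ← MonoidalCategory.whiskerLeft_comp_assoc,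
    ← hσ c d]
  simp

theorem IsHom.restrict {W : V} {M N : RMod (V := V) D} {σ : ∀ c, W ⊗ M.obj c ⟶ N.obj c}
    (hσ : IsHom W M N σ) (J : EnrichedFunctor V C D) :
    IsHom W (M.restrict J) (N.restrict J) (fun c => σ (J.obj c)) := by
  intro c d
  have h := hσ (J.obj c) (J.obj d)
  simp only [MonoidalCategory.whiskerLeft_comp, Category.assoc]
  rw [← associator_naturality_right_assoc, h, whisker_exchange_assoc]

/-- An isomorphism of modules. -/
structure Iso (M N : RMod (V := V) C) where
  /-- the components -/
  e : ∀ c, M.obj c ≅ N.obj c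
  act_hom : ∀ c d, M.act c d ≫ (e d).hom = (e c).hom ▷ _ ≫ N.act c d

/-- The inverse of an isomorphism of modules. -/
def Iso.symm {M N : RMod (V := V) C} (e : Iso M N) : Iso N M where
  e c := (e.e c).symm
  act_hom c d := by
    rw [← cancel_mono (e.e d).hom]
    simp [e.act_hom]

/-- The composite of two isomorphisms of modules. -/
def Iso.trans {M N P : RMod (V := V) C} (e : Iso M N) (f : Iso N P) : Iso M P where
  e c := e.e c ≪≫ f.e c
  act_hom c d := by
    simp [f.act_hom, reassoc_of% e.act_hom c d]

theorem Iso.act_inv {M N : RMod (V := V) C} (e : Iso M N) (c d : C) :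
    N.act c d ≫ (e.e d).inv = (e.e c).inv ▷ _ ≫ M.act c d :=
  e.symm.act_hom c d

theorem IsHom.comp_iso {W : V} {M N P : RMod (V := V) C} {σ : ∀ c, W ⊗ M.obj c ⟶ N.obj c}
    (hσ : IsHom W M N σ) (e : Iso N P) : IsHom W M P (fun c => σ c ≫ (e.e c).hom) := by
  intro c d
  have h := hσ c d
  simp only [comp_whiskerRight, Category.assoc]
  rw [← e.act_hom, ← reassoc_of% h]

theorem IsHom.iso_comp {W : V} {M N P : RMod (V := V) C} {σ : ∀ c, W ⊗ M.obj c ⟶ N.obj c}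
    (hσ : IsHom W M N σ) (e : Iso P M) : IsHom W P N (fun c => W ◁ (e.e c).hom ≫ σ c) := by
  intro c d
  have h := hσ c d
  simp only [comp_whiskerRight, Category.assoc]
  rw [← h, ← MonoidalCategory.whiskerLeft_comp_assoc, e.act_hom]
  simp

/-- The family `W ⊗ B(X, J c) ⟶ B(Z, J c)` given by `f : W ⟶ B(Z, X)`. -/
theorem isHom_hom {W : V} {X Z : C} (f : W ⟶ (Z ⟶[V] X)) :
    IsHom W (hom V X) (hom V Z) (fun c => f ▷ _ ≫ eComp V Z X c) := by
  intro c d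
  have h := (hom V Z).act_act X c d
  simp only [comp_whiskerRight, Category.assoc]
  rw [h, whisker_exchange_assoc, associator_naturality_left_assoc]

end RMod

end Modules

/-! ### Translation between `V`-functors to `V` and modules -/

section Comparison

variable {V : Type u} [Category.{v} V] [MonoidalCategory V] [SymmetricCategory V]
  [MonoidalClosed V]

variable {C : Type u₁} [EnrichedCategory V C] {D : Type u₂} [EnrichedCategory V D]

/-- The module underlying a `V`-functor to `V`. -/
abbrev RMod.of (F : EnrichedFunctor V C V) : RMod (V := V) C where
  obj := F.obj
  act := VCat.act F
  act_id c := by rw [VCat.act, ← MonoidalClosed.uncurry_natural_left, F.map_id, uncurry_eId]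
  act_act c d e := by
    rw [← Iso.inv_comp_eq, VCat.act, VCat.act, VCat.act, ← MonoidalClosed.uncurry_natural_left,
      F.map_comp,
      uncurry_eComp]

/-- The `V`-functor to `V` determined by a module. -/
def RMod.toFunctor (M : RMod (V := V) C) : EnrichedFunctor V C V where
  obj := M.obj
  map c d := MonoidalClosed.curry (M.act c d)
  map_id c := by
    apply MonoidalClosed.uncurry_injective
    rw [uncurry_eId, MonoidalClosed.uncurry_natural_left, MonoidalClosed.uncurry_curry, M.act_id]
  map_comp c d e := by
    apply MonoidalClosed.uncurry_injective
    rw [uncurry_eComp, MonoidalClosed.uncurry_natural_left, MonoidalClosed.uncurry_curry,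
      MonoidalClosed.uncurry_curry, MonoidalClosed.uncurry_curry, M.act_act, Iso.inv_hom_id_assoc]

theorem act_toFunctor (M : RMod (V := V) C) (c d : C) : act M.toFunctor c d = M.act c d :=
  MonoidalClosed.uncurry_curry _

/-- The round trip is an equality, not just an isomorphism, because `uncurry` undoes `curry` on the
nose. Continuity can therefore be moved between a module and its functor by rewriting. -/
theorem RMod.of_toFunctor (M : RMod (V := V) C) : RMod.of M.toFunctor = M := by
  obtain ⟨o, a, h, k⟩ := M
  have : (fun c d => VCat.act (RMod.toFunctor ⟨o, a, h, k⟩) c d) = a := by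
    funext c d
    exact act_toFunctor _ c d
  simp only [RMod.of]
  congr

theorem act_homFunctor (X Y Z : C) : act (homFunctor X) Y Z = eComp V X Y Z :=
  MonoidalClosed.uncurry_curry _

theorem act_comp_functor (J : EnrichedFunctor V C D) (F : EnrichedFunctor V D V) (c d : C) :
    act (J.comp V F) c d = F.obj (J.obj c) ◁ J.map c d ≫ act F (J.obj c) (J.obj d) :=
  MonoidalClosed.uncurry_natural_left _ _

theorem RMod.of_homFunctor (X : C) : RMod.of (homFunctor X) = RMod.hom V X := by
  have : VCat.act (homFunctor X) = fun Y Z => eComp V X Y Z := by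
    funext Y Z
    exact act_homFunctor X Y Z
  simp only [RMod.of]
  congr

theorem RMod.restrict_comp {E : Type u₃} [EnrichedCategory V E] (J : EnrichedFunctor V C D)
    (J' : EnrichedFunctor V D E) (M : RMod (V := V) E) :
    M.restrict (J.comp V J') = (M.restrict J').restrict J := by
  have : (fun c d => M.obj (J'.obj (J.obj c)) ◁ (J.map c d ≫ J'.map _ _) ≫ M.act _ _) =
    fun c d => M.obj (J'.obj (J.obj c)) ◁ J.map c d ≫ M.obj (J'.obj (J.obj c)) ◁ J'.map _ _ ≫
      M.act _ _ := by
    funext Y Z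
    simp
  simp only [RMod.restrict]
  congr

/-- Uncurrying turns composition in the internal hom into composition of tensors, and the symmetry
moves `W` to the left. `V`-naturality becomes compatibility with two actions, the form in which
natural families are handled from here on. -/
theorem natural_iff_uncurry {W H A A' B B' : V} (f : H ⟶ (ihom A).obj A')
    (g : H ⟶ (ihom B).obj B') (s : W ⟶ (ihom A).obj B) (s' : W ⟶ (ihom A').obj B') :
    (β_ W H).hom ≫ (f ⊗ₘ s') ≫ eComp V A A' B' = (s ⊗ₘ g) ≫ eComp V A B B' ↔
      (α_ W A H).hom ≫ W ◁ MonoidalClosed.uncurry f ≫ (β_ W A').hom ≫ MonoidalClosed.uncurry s' =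
        ((β_ W A).hom ≫ MonoidalClosed.uncurry s) ▷ H ≫ MonoidalClosed.uncurry g := by
  rw [← MonoidalClosed.uncurry_injective.eq_iff, MonoidalClosed.uncurry_natural_left,
    uncurry_eComp, uncurry_eComp, ← cancel_epi ((β_ W A).hom ▷ H ≫ (α_ A W H).hom),
    BraidedCategory.braiding_naturality_right_assoc, BraidedCategory.braiding_tensor_right_hom]
  simp only [Category.assoc, comp_whiskerRight, Iso.hom_inv_id_assoc]

theorem gradedNat_iff {W : V} (F G : EnrichedFunctor V C V)
    (s : ∀ c, W ⟶ (ihom (F.obj c)).obj (G.obj c)) :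
    (∀ X Y : C, (β_ W (X ⟶[V] Y)).hom ≫ (F.map X Y ⊗ₘ s Y) ≫
        eComp V (F.obj X) (F.obj Y) (G.obj Y) =
      (s X ⊗ₘ G.map X Y) ≫ eComp V (F.obj X) (G.obj X) (G.obj Y)) ↔
    RMod.IsHom W (RMod.of F) (RMod.of G)
      (fun c => (β_ W (F.obj c)).hom ≫ MonoidalClosed.uncurry (s c)) :=
  forall₂_congr fun X Y => natural_iff_uncurry (F.map X Y) (G.map X Y) (s X) (s Y)

/-- The `V`-natural family associated to a family compatible with the actions. -/
def gradedNatOfHom {W : V} {F G : EnrichedFunctor V C V} (σ : ∀ c, W ⊗ F.obj c ⟶ G.obj c)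
    (hσ : RMod.IsHom W (RMod.of F) (RMod.of G) σ) : GradedNat W F G where
  app c := MonoidalClosed.curry ((β_ (F.obj c) W).hom ≫ σ c)
  naturality := by
    refine (gradedNat_iff F G _).2 ?_
    convert hσ using 2 with c
    rw [MonoidalClosed.uncurry_curry, SymmetricCategory.symmetry_assoc]

/-- The family compatible with the actions associated to a `V`-natural family. -/
def homOfGradedNat {W : V} {F G : EnrichedFunctor V C V} (s : GradedNat W F G) (c : C) :
    W ⊗ F.obj c ⟶ G.obj c :=
  (β_ W (F.obj c)).hom ≫ MonoidalClosed.uncurry (s.app c)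

theorem isHom_homOfGradedNat {W : V} {F G : EnrichedFunctor V C V} (s : GradedNat W F G) :
    RMod.IsHom W (RMod.of F) (RMod.of G) (homOfGradedNat s) :=
  (gradedNat_iff F G _).1 s.naturality

theorem homOfGradedNat_ofHom {W : V} {F G : EnrichedFunctor V C V}
    (σ : ∀ c, W ⊗ F.obj c ⟶ G.obj c) (hσ : RMod.IsHom W (RMod.of F) (RMod.of G) σ) (c : C) :
    homOfGradedNat (gradedNatOfHom σ hσ) c = σ c := by
  simp only [homOfGradedNat, gradedNatOfHom]
  rw [MonoidalClosed.uncurry_curry, SymmetricCategory.symmetry_assoc]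

end Comparison

/-! ### Weighted limits tested by modules -/

section LimitsInV

variable {V : Type u} [Category.{v} V] [MonoidalCategory V] [SymmetricCategory V]
  [MonoidalClosed V]

variable {D : Type w} [EnrichedCategory V D] {C : Type u₁} [EnrichedCategory V C]
  {C' : Type u₂} [EnrichedCategory V C']

/-- The image of a weighted cone under a module is a limit in `V`. -/
def IsLimV {φ : EnrichedFunctor V D V} {S : EnrichedFunctor V D C} (c : WCone φ S)
    (G : RMod (V := V) C) : Prop :=
  ∀ (W : V) (θ : ∀ d, W ⊗ φ.obj d ⟶ G.obj (S.obj d)), RMod.IsHom W (RMod.of φ) (G.restrict S) θ →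
    ∃! f : W ⟶ G.obj c.pt, ∀ d, (f ⊗ₘ c.π d) ≫ G.act c.pt (S.obj d) = θ d

theorem isHom_restrict_hom {φ : EnrichedFunctor V D V} {S : EnrichedFunctor V D C} {W : V}
    {X : C} (θ : ∀ d, W ⊗ φ.obj d ⟶ (X ⟶[V] S.obj d)) :
    RMod.IsHom W (RMod.of φ) ((RMod.hom V X).restrict S) θ ↔
      ∀ d d' : D, (α_ W (φ.obj d) (d ⟶[V] d')).hom ≫ W ◁ act φ d d' ≫ θ d' =
        (θ d ⊗ₘ S.map d d') ≫ eComp V X (S.obj d) (S.obj d') := by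
  refine forall₂_congr fun d d' => ?_
  rw [MonoidalCategory.tensorHom_def, Category.assoc]

/-- The definition of a weighted limit asks for exactly this: representables turn the cone into a
limit in `V`. -/
theorem isLimit_iff_isLimV {φ : EnrichedFunctor V D V} {S : EnrichedFunctor V D C}
    (c : WCone φ S) : c.IsLimit ↔ ∀ X, IsLimV c (RMod.hom V X) := by
  constructor
  · intro h X W θ hθ
    exact h W X ⟨θ, (isHom_restrict_hom θ).1 hθ⟩
  · intro h W X θ
    exact h X W θ.app ((isHom_restrict_hom _).2 θ.naturality)

theorem RMod.isHom_restrict_comp {W : V} {M : RMod (V := V) D} (S : EnrichedFunctor V D C)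
    (J : EnrichedFunctor V C C') (G : RMod (V := V) C')
    (θ : ∀ d, W ⊗ M.obj d ⟶ G.obj (J.obj (S.obj d))) :
    RMod.IsHom W M (G.restrict (S.comp V J)) θ ↔ RMod.IsHom W M ((G.restrict J).restrict S) θ := by
  refine forall₂_congr fun d d' => ?_
  have e : G.obj (J.obj (S.obj d)) ◁ (S.map d d' ≫ J.map _ _) ≫ G.act _ (J.obj (S.obj d')) =
    G.obj (J.obj (S.obj d)) ◁ S.map d d' ≫ G.obj (J.obj (S.obj d)) ◁ J.map _ _ ≫ G.act _ _ := by
    simp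
  exact Eq.congr rfl (congrArg (fun t => θ d ▷ _ ≫ t) e)

theorem isLimV_map_iff {φ : EnrichedFunctor V D V} {S : EnrichedFunctor V D C}
    (c : WCone φ S) (J : EnrichedFunctor V C C') (G : RMod (V := V) C') :
    IsLimV (c.map J) G ↔ IsLimV c (G.restrict J) := by
  refine forall₂_congr fun W θ => ?_
  refine imp_congr (RMod.isHom_restrict_comp _ _ _ _)
    (existsUnique_congr fun f => forall_congr' fun d => ?_)
  have h (f : W ⟶ G.obj (J.obj c.pt)) :
      (f ⊗ₘ (c.π d ≫ J.map _ _)) ≫ G.act (J.obj c.pt) (J.obj (S.obj d)) =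
        (f ⊗ₘ c.π d) ≫ G.obj (J.obj c.pt) ◁ J.map _ _ ≫ G.act _ _ := by
    simp [MonoidalCategory.tensorHom_def]
  exact Eq.congr (h f) rfl

theorem IsLimV.of_iso {φ : EnrichedFunctor V D V} {S : EnrichedFunctor V D C}
    {c : WCone φ S} {G G' : RMod (V := V) C} (e : RMod.Iso G G') (h : IsLimV c G) :
    IsLimV c G' := by
  intro W θ hθ
  obtain ⟨f, hf, hu⟩ := h W (fun d => θ d ≫ (e.e (S.obj d)).inv) (by
    intro d d'
    have h := hθ d d'
    simp only [comp_whiskerRight, Category.assoc]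
    rw [reassoc_of% h, e.act_inv, whisker_exchange_assoc])
  refine ⟨f ≫ (e.e c.pt).hom, fun d => ?_, fun g hg => ?_⟩
  · have := congrArg (fun t => t ≫ (e.e _).hom) (hf d)
    simp only [Category.assoc, e.act_hom, Iso.inv_hom_id, Category.comp_id] at this
    rw [← this, MonoidalCategory.tensorHom_def', MonoidalCategory.tensorHom_def']
    simp
  · rw [← Iso.comp_inv_eq]
    refine hu _ fun d => ?_
    rw [← hg d, Category.assoc, e.act_inv, MonoidalCategory.tensorHom_def',
      MonoidalCategory.tensorHom_def']
    simp

theorem uncurry_eComp_map {W P X : V} {A B : C} (G : EnrichedFunctor V C V)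
    (f : W ⟶ (ihom X).obj (G.obj A)) (p : P ⟶ (A ⟶[V] B)) :
    MonoidalClosed.uncurry ((f ⊗ₘ (p ≫ G.map A B)) ≫ eComp V X (G.obj A) (G.obj B)) =
      (α_ X W P).inv ≫ (MonoidalClosed.uncurry f ⊗ₘ p) ≫ act G A B := by
  rw [uncurry_eComp, MonoidalCategory.tensorHom_def, MonoidalClosed.uncurry_natural_left]
  simp only [Category.assoc]
  rfl

/-- A family `W ⊗ φ d ⟶ [X, G (S d)]` is the same as a family `(X ⊗ W) ⊗ φ d ⟶ G (S d)`. Hence in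
`V` the vertex `X` can be absorbed in the parameter `W`, and the single condition `IsLimV` replaces
the test over all `X`. -/
theorem isLimit_map_iff {φ : EnrichedFunctor V D V} {S : EnrichedFunctor V D C}
    (c : WCone φ S) (G : EnrichedFunctor V C V) :
    (c.map G).IsLimit ↔ IsLimV c (RMod.of G) := by
  have key {W X : V} (θ : ∀ d, W ⊗ φ.obj d ⟶ (ihom X).obj (G.obj (S.obj d))) :
      (∀ d d' : D, (α_ W (φ.obj d) (d ⟶[V] d')).hom ≫ W ◁ act φ d d' ≫ θ d' =
        (θ d ⊗ₘ (S.map d d' ≫ G.map _ _)) ≫ eComp V X (G.obj (S.obj d)) (G.obj (S.obj d'))) ↔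
      RMod.IsHom (X ⊗ W) (RMod.of φ) ((RMod.of G).restrict S)
        (fun d => (α_ X W (φ.obj d)).hom ≫ MonoidalClosed.uncurry (θ d)) := by
    refine forall₂_congr fun d d' => ?_
    refine MonoidalClosed.uncurry_injective.eq_iff.symm.trans ?_
    rw [uncurry_eComp_map,
      MonoidalClosed.uncurry_natural_left, MonoidalClosed.uncurry_natural_left,
      ← cancel_epi (α_ X (W ⊗ φ.obj d) (d ⟶[V] d')).hom,
      ← cancel_epi ((α_ X W (φ.obj d)).hom ▷ (d ⟶[V] d')), MonoidalCategory.tensorHom_def]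
    simp
  have hclean : (c.map G).IsLimit ↔ ∀ (W X : V)
      (θ : ∀ d, W ⊗ φ.obj d ⟶ (ihom X).obj (G.obj (S.obj d))),
      (∀ d d' : D, (α_ W (φ.obj d) (d ⟶[V] d')).hom ≫ W ◁ act φ d d' ≫ θ d' =
        (θ d ⊗ₘ (S.map d d' ≫ G.map _ _)) ≫ eComp V X (G.obj (S.obj d)) (G.obj (S.obj d'))) →
      ∃! f : W ⟶ (ihom X).obj (G.obj c.pt), ∀ d, (f ⊗ₘ (c.π d ≫ G.map _ _)) ≫
        eComp V X (G.obj c.pt) (G.obj (S.obj d)) = θ d :=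
    ⟨fun h W X θ hθ => h W X ⟨θ, hθ⟩, fun h W X θ => h W X θ.app θ.naturality⟩
  rw [hclean]
  constructor
  · intro h W (θ : ∀ d, W ⊗ φ.obj d ⟶ G.obj (S.obj d)) hθ
    have hcond (f : W ⟶ (ihom (𝟙_ V)).obj (G.obj c.pt)) (d : D) :
        (f ⊗ₘ (c.π d ≫ G.map _ _)) ≫ eComp V (𝟙_ V) (G.obj c.pt) (G.obj (S.obj d)) =
            MonoidalClosed.curry ((λ_ _).hom ≫ θ d) ↔
          (((λ_ W).inv ≫ MonoidalClosed.uncurry f) ⊗ₘ c.π d) ≫ act G _ _ = θ d := by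
      refine MonoidalClosed.uncurry_injective.eq_iff.symm.trans ?_
      rw [uncurry_eComp_map,
        MonoidalClosed.uncurry_curry, ← cancel_epi (λ_ (W ⊗ φ.obj d)).inv]
      rw [whisker_aux₁]
      simp
    -- The vertex is taken to be the unit, for which `[I, Z]` is `Z`.
    obtain ⟨f, hf, hu⟩ := h W (𝟙_ V) (fun d => MonoidalClosed.curry ((λ_ _).hom ≫ θ d)) (by
      refine (key _).2 ?_
      have := hθ.reindex (λ_ W).hom
      convert this using 2 with d
      rw [MonoidalClosed.uncurry_curry]
      simp)
    refine ⟨(λ_ W).inv ≫ MonoidalClosed.uncurry f, fun d => (hcond f d).1 (hf d),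
      fun (g : W ⟶ G.obj c.pt) hg => ?_⟩
    have := hu (MonoidalClosed.curry ((λ_ W).hom ≫ g)) fun d => (hcond _ d).2 (by
      rw [MonoidalClosed.uncurry_curry, Iso.inv_hom_id_assoc]
      exact hg d)
    rw [← this, MonoidalClosed.uncurry_curry, Iso.inv_hom_id_assoc]
  · intro h W X θ hθ
    obtain ⟨f, hf, hu⟩ := h (X ⊗ W) _ ((key θ).1 hθ)
    have hcond (f : W ⟶ (ihom X).obj (G.obj c.pt)) (d : D) :
        (f ⊗ₘ (c.π d ≫ G.map _ _)) ≫ eComp V X (G.obj c.pt) (G.obj (S.obj d)) = θ d ↔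
          (MonoidalClosed.uncurry f ⊗ₘ c.π d) ≫ act G _ _ =
            (α_ X W (φ.obj d)).hom ≫ MonoidalClosed.uncurry (θ d) := by
      refine MonoidalClosed.uncurry_injective.eq_iff.symm.trans ?_
      rw [uncurry_eComp_map, Iso.inv_comp_eq]
    refine ⟨MonoidalClosed.curry f, fun d => (hcond _ d).2 ?_, fun g hg => ?_⟩
    · rw [MonoidalClosed.uncurry_curry]
      exact hf d
    · rw [MonoidalClosed.eq_curry_iff]
      exact hu _ fun d => (hcond g d).1 (hg d)

end LimitsInV

/-! ### Elements of modules and the maps out of representables they determine -/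

section Yoneda

variable {V : Type u} [Category.{v} V] [MonoidalCategory V]

variable {C : Type u₁} [EnrichedCategory V C] {D : Type u₂} [EnrichedCategory V D]

namespace RMod

/-- The map `C(X, Z) ⟶ M Z` determined by an element of `M X`. -/
def elt (M : RMod (V := V) C) {X : C} (x : 𝟙_ V ⟶ M.obj X) (Z : C) : (X ⟶[V] Z) ⟶ M.obj Z :=
  (λ_ _).inv ≫ x ▷ _ ≫ M.act X Z

theorem elt_act (M : RMod (V := V) C) {X : C} (x : 𝟙_ V ⟶ M.obj X) (Y Z : C) :
    M.elt x Y ▷ (Y ⟶[V] Z) ≫ M.act Y Z = eComp V X Y Z ≫ M.elt x Z := by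
  simp only [elt, comp_whiskerRight, Category.assoc, M.act_act]
  rw [leftUnitor_inv_naturality_assoc, associator_naturality_left_assoc, whisker_exchange_assoc]
  simp

theorem eId_elt (M : RMod (V := V) C) {X : C} (x : 𝟙_ V ⟶ M.obj X) : eId V X ≫ M.elt x X = x := by
  simp only [elt]
  rw [leftUnitor_inv_naturality_assoc, whisker_exchange_assoc, M.act_id]
  rw [rightUnitor_naturality, ← unitors_equal, Iso.inv_hom_id_assoc]

theorem pre_elt (M : RMod (V := V) C) {X X' : C} (x : 𝟙_ V ⟶ M.obj X) (i : 𝟙_ V ⟶ (X ⟶[V] X'))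
    (Z : C) : M.elt (i ≫ M.elt x X') Z = pre i Z ≫ M.elt x Z := by
  rw [pre, Category.assoc, Category.assoc, ← elt_act, elt, comp_whiskerRight_assoc]

theorem restrict_elt (J : EnrichedFunctor V C D) (M : RMod (V := V) D) {X : C}
    (x : 𝟙_ V ⟶ M.obj (J.obj X)) (Z : C) :
    (M.restrict J).elt x Z = J.map X Z ≫ M.elt x (J.obj Z) := by
  simp only [elt]
  rw [leftUnitor_inv_naturality_assoc, whisker_exchange_assoc]

/-- The action of an element. -/
def elAct (M : RMod (V := V) C) {X Y : C} (i : 𝟙_ V ⟶ (X ⟶[V] Y)) : M.obj X ⟶ M.obj Y :=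
  (ρ_ _).inv ≫ _ ◁ i ≫ M.act X Y

theorem elAct_eId (M : RMod (V := V) C) (X : C) : M.elAct (eId V X) = 𝟙 _ := by
  rw [elAct, M.act_id, Iso.inv_hom_id]

theorem elAct_elAct (M : RMod (V := V) C) {X Y Z : C} (i : 𝟙_ V ⟶ (X ⟶[V] Y))
    (j : 𝟙_ V ⟶ (Y ⟶[V] Z)) : M.elAct i ≫ M.elAct j = M.elAct (elComp i j) := by
  simp only [elAct, ← comp_post, post, Category.assoc, MonoidalCategory.whiskerLeft_comp]
  rw [rightUnitor_inv_naturality_assoc, rightUnitor_inv_naturality_assoc,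
    ← whisker_exchange_assoc, M.act_act]
  simp

theorem isIso_pre {X X' : C} (i : 𝟙_ V ⟶ (X ⟶[V] X')) (i' : 𝟙_ V ⟶ (X' ⟶[V] X))
    (h : elComp i i' = eId V X) (h' : elComp i' i = eId V X') (Z : C) : IsIso (pre i Z) :=
  ⟨pre i' Z, by rw [pre_pre, h', pre_eId], by rw [pre_pre, h, pre_eId]⟩

end RMod

end Yoneda

/-! ### Evaluation on functor `V`-categories and the Yoneda lemma -/

section Evaluation

theorem unit_braid {V : Type u} [Category.{v} V] [MonoidalCategory V] [SymmetricCategory V]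
    {A P T Z : V} (u : 𝟙_ V ⟶ P) (k : (P ⊗ T) ⊗ A ⟶ Z) :
    (λ_ A).inv ▷ T ≫ u ▷ A ▷ T ≫ (α_ P A T).hom ≫ P ◁ (β_ A T).hom ≫ (α_ P T A).inv ≫ k =
      (β_ A T).hom ≫ (λ_ T).inv ▷ A ≫ u ▷ T ▷ A ≫ k := by
  rw [associator_naturality_left_assoc, ← whisker_exchange_assoc,
    associator_inv_naturality_left_assoc,
    show (λ_ A).inv ▷ T = (λ_ (A ⊗ T)).inv ≫ (α_ _ _ _).inv by simp, Category.assoc,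
    Iso.inv_hom_id_assoc, ← leftUnitor_inv_naturality_assoc]
  simp

theorem yonedaHom_yonedaEval_aux {V : Type u} [Category.{v} V] [MonoidalCategory V] [SymmetricCategory V]
    {A N G₁ G₂ H : V} (u : 𝟙_ V ⟶ H) (a : H ⊗ A ⟶ A) (ha : u ▷ A ≫ a = (λ_ A).hom)
    (e₁ : H ⊗ N ⟶ G₁) (e₂ : A ⊗ N ⟶ G₂) (g : G₁ ⊗ A ⟶ G₂)
    (h : e₁ ▷ A ≫ g = (α_ _ _ _).hom ≫ H ◁ (β_ _ _).hom ≫ (α_ _ _ _).inv ≫ a ▷ N ≫ e₂) :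
    A ◁ ((λ_ N).inv ≫ u ▷ N ≫ e₁) ≫ (β_ _ _).hom ≫ g = e₂ := by
  rw [BraidedCategory.braiding_naturality_right_assoc]
  simp only [comp_whiskerRight, Category.assoc]
  rw [h, unit_braid, SymmetricCategory.symmetry_assoc, ← comp_whiskerRight_assoc,
    ← comp_whiskerRight_assoc]
  simp [ha]

theorem yonedaEval_yonedaHom_aux {V : Type u} [Category.{v} V] [MonoidalCategory V] [SymmetricCategory V]
    {H N G : V} (u : 𝟙_ V ⟶ H) (f : G ⟶ N) (e : H ⊗ N ⟶ G) (g : G ⊗ H ⟶ G)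
    (hf : H ◁ f ≫ e = (β_ _ _).hom ≫ g) (hg : G ◁ u ≫ g = (ρ_ G).hom) :
    f ≫ (λ_ N).inv ≫ u ▷ N ≫ e = 𝟙 _ := by
  rw [leftUnitor_inv_naturality_assoc, whisker_exchange_assoc, hf,
    BraidedCategory.braiding_naturality_left_assoc, hg, braiding_tensorUnit_left]
  simp

variable {V : Type u} [Category.{v} V] [MonoidalCategory V] [SymmetricCategory V]
  [MonoidalClosed V]

variable {C : Type u₁} [EnrichedCategory V C]

section

variable [HasFunctorCategory V C V]

/-- Evaluation `F c ⊗ [C, V](F, G) ⟶ G c`. -/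
def ev (F G : EnrichedFunctor V C V) (c : C) : F.obj c ⊗ natObj F G ⟶ G.obj c :=
  MonoidalClosed.uncurry (natObjπ F G c)

theorem ev_natLift {W : V} {F G : EnrichedFunctor V C V} (σ : GradedNat W F G) (c : C) :
    F.obj c ◁ natLift σ ≫ ev F G c = MonoidalClosed.uncurry (σ.app c) := by
  rw [ev, ← MonoidalClosed.uncurry_natural_left, natLift_π]

theorem natObj_ext_ev {W : V} {F G : EnrichedFunctor V C V} {f g : W ⟶ natObj F G}
    (h : ∀ c, F.obj c ◁ f ≫ ev F G c = F.obj c ◁ g ≫ ev F G c) : f = g := by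
  refine natObj_hom_ext fun c => MonoidalClosed.uncurry_injective ?_
  rw [MonoidalClosed.uncurry_natural_left, MonoidalClosed.uncurry_natural_left]
  exact h c

variable (V) in
/-- The evaluation module of the functor category. -/
abbrev evMod (c : C) : RMod (V := V) (EnrichedFunctor V C V) where
  obj F := F.obj c
  act F G := ev F G c
  act_id F := by
    rw [ev, ← MonoidalClosed.uncurry_natural_left, functorCategory_eId_π, uncurry_eId]
  act_act F G H := by
    rw [← Iso.inv_comp_eq, ev, ev, ev, ← MonoidalClosed.uncurry_natural_left]
    exact (uncurry_eComp _ _).symm.trans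
      (congrArg _ (functorCategory_eComp_π F G H c).symm)

/-- This is the naturality of the universal family, uncurried. It says that the actions of `[C, V]`
and of `C` on the values `F c` commute, which is the axiom `comm` of `Bimod`. -/
theorem ev_act (F G : EnrichedFunctor V C V) (c d : C) :
    ev F G c ▷ (c ⟶[V] d) ≫ act G c d = (α_ _ _ _).hom ≫ F.obj c ◁ (β_ _ _).hom ≫
      (α_ _ _ _).inv ≫ act F c d ▷ _ ≫ ev F G d := by
  have h := isHom_homOfGradedNat (natObjFam F G) c d
  simp only [homOfGradedNat, comp_whiskerRight, Category.assoc] at h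
  rw [BraidedCategory.braiding_naturality_right_assoc,
    BraidedCategory.braiding_tensor_right_hom] at h
  simp only [Category.assoc, Iso.hom_inv_id_assoc, cancel_epi] at h
  exact h.symm

theorem existsUnique_natObj {W : V} {F G : EnrichedFunctor V C V}
    (σ : ∀ c, W ⊗ F.obj c ⟶ G.obj c) (hσ : RMod.IsHom W (RMod.of F) (RMod.of G) σ) :
    ∃! f : W ⟶ natObj F G, ∀ c, F.obj c ◁ f ≫ ev F G c = (β_ _ _).hom ≫ σ c := by
  refine ⟨natLift (gradedNatOfHom σ hσ), fun c => ?_, fun g hg => natObj_ext_ev fun c => ?_⟩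
  · rw [ev_natLift]
    exact MonoidalClosed.uncurry_curry _
  · rw [hg c, ev_natLift]
    exact (MonoidalClosed.uncurry_curry _).symm

/-- The Yoneda lemma. -/
theorem isIso_elt_eId (c : C) (G : EnrichedFunctor V C V) :
    IsIso ((evMod V c).elt (X := homFunctor c) (eId V c) G) := by
  have hσ : RMod.IsHom (G.obj c) (RMod.of (homFunctor c)) (RMod.of G) (fun d => act G c d) := by
    intro d e
    have h := (RMod.of G).act_act c d e
    refine Eq.trans ?_ h.symm
    exact congrArg (fun t => (α_ _ _ _).hom ≫ G.obj c ◁ t ≫ act G c e) (act_homFunctor c d e)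
  obtain ⟨f, hf, -⟩ := existsUnique_natObj _ hσ
  refine ⟨f, ?_, ?_⟩
  · refine natObj_ext_ev (F := homFunctor c) fun d => ?_
    rw [MonoidalCategory.whiskerLeft_comp, Category.assoc, hf, MonoidalCategory.whiskerLeft_id,
      Category.id_comp]
    refine yonedaHom_yonedaEval_aux (eId V c) (act (homFunctor c) c d) ?_ _ _ _ (ev_act (homFunctor c) G c d)
    refine (congrArg (fun t => _ ≫ t) (act_homFunctor c c d)).trans ?_
    exact (cancel_epi (λ_ (c ⟶[V] d)).inv).1 ((e_id_comp V c d).trans (Iso.inv_hom_id _).symm)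
  · exact yonedaEval_yonedaHom_aux (eId V c) f _ _ (hf c) ((RMod.of G).act_id c)

end

end Evaluation

/-! ### Pointwise representable bimodules define functors of representing objects -/

section Pairings

variable {V : Type u} [Category.{v} V] [MonoidalCategory V] [SymmetricCategory V]

/-- A `V`-functor from `K` to modules over `T`, presented by two commuting actions. -/
structure Bimod (K : Type u₁) [EnrichedCategory V K] (T : Type u₂) [EnrichedCategory V T] where
  /-- the values -/
  obj : K → T → V
  /-- the action of `K` -/
  actK : ∀ t X Y, obj X t ⊗ (X ⟶[V] Y) ⟶ obj Y t
  /-- the action of `T` -/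
  actT : ∀ X s t, obj X s ⊗ (s ⟶[V] t) ⟶ obj X t
  actK_id : ∀ t X, obj X t ◁ eId V X ≫ actK t X X = (ρ_ (obj X t)).hom
  actK_act : ∀ t X Y Z, actK t X Y ▷ (Y ⟶[V] Z) ≫ actK t Y Z =
      (α_ (obj X t) (X ⟶[V] Y) (Y ⟶[V] Z)).hom ≫ obj X t ◁ eComp V X Y Z ≫ actK t X Z
  actT_id : ∀ X t, obj X t ◁ eId V t ≫ actT X t t = (ρ_ (obj X t)).hom
  actT_act : ∀ X r s t, actT X r s ▷ (s ⟶[V] t) ≫ actT X s t =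
      (α_ (obj X r) (r ⟶[V] s) (s ⟶[V] t)).hom ≫ obj X r ◁ eComp V r s t ≫ actT X r t
  comm : ∀ X Y s t, actK s X Y ▷ (s ⟶[V] t) ≫ actT Y s t = (α_ _ _ _).hom ≫
    obj X s ◁ (β_ _ _).hom ≫ (α_ _ _ _).inv ≫ actT X s t ▷ _ ≫ actK t X Y

namespace Bimod

variable {K : Type u₁} [EnrichedCategory V K] {T : Type u₂} [EnrichedCategory V T]
  (P : Bimod (V := V) K T)

/-- The `T`-module at an object of `K`. -/
abbrev modT (X : K) : RMod (V := V) T where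
  obj := P.obj X
  act := P.actT X
  act_id := P.actT_id X
  act_act := P.actT_act X

/-- The `K`-module at an object of `T`. -/
abbrev modK (t : T) : RMod (V := V) K where
  obj X := P.obj X t
  act := P.actK t
  act_id := P.actK_id t
  act_act := P.actK_act t

variable {P} {o : T → K} (x : ∀ t : T, 𝟙_ V ⟶ P.obj (o t) t)
  [hx : ∀ t X, IsIso ((P.modK t).elt (x t) X)]

/-- The action on hom-objects of the functor of representing objects. -/
def reprMap (s t : T) : (s ⟶[V] t) ⟶ (o t ⟶[V] o s) :=
  (P.modT (o s)).elt (x s) t ≫ inv ((P.modK t).elt (x t) (o s))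

theorem reprMap_elt (s t : T) :
    reprMap x s t ≫ (P.modK t).elt (x t) (o s) = (P.modT (o s)).elt (x s) t := by
  simp [reprMap]

/-- Under the representing isomorphisms, composition with `reprMap` becomes the action of `T`. This
yields both the functoriality of `repr` and the linearity of `reprIso`; it rests on the commutation
of the two actions. -/
theorem comp_reprMap_elt (X : K) (s t : T) :
    (o s ⟶[V] X) ◁ reprMap x s t ≫ ((β_ _ _).hom ≫ eComp V (o t) (o s) X) ≫
        (P.modK t).elt (x t) X =
      (P.modK s).elt (x s) X ▷ _ ≫ P.actT X s t := by
  rw [Category.assoc, ← RMod.elt_act, BraidedCategory.braiding_naturality_right_assoc,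
    ← comp_whiskerRight_assoc, reprMap_elt]
  simp only [RMod.elt, comp_whiskerRight, Category.assoc]
  rw [P.comm, unit_braid]

/-- The functor of representing objects. -/
def repr : EnrichedFunctor V T Kᵒᵖ where
  obj t := op (o t)
  map s t := reprMap x s t
  map_id t := by
    refine (cancel_mono ((P.modK t).elt (x t) (o t))).1 ?_
    rw [Category.assoc, reprMap_elt, RMod.eId_elt]
    exact (RMod.eId_elt (P.modK t) _).symm
  map_comp r s t := by
    refine (cancel_mono ((P.modK t).elt (x t) (o r))).1 ?_
    rw [Category.assoc, reprMap_elt, MonoidalCategory.tensorHom_def]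
    have h := comp_reprMap_elt x (o r) s t
    refine Eq.trans ?_ (Category.assoc _ _ _).symm
    refine Eq.trans ?_ (Category.assoc _ _ _).symm
    refine Eq.trans ?_ (congrArg (fun t => reprMap x r s ▷ _ ≫ t) h.symm)
    rw [← comp_whiskerRight_assoc, reprMap_elt]
    exact (RMod.elt_act (P.modT (o r)) (x r) s t).symm

/-- The modules of `P` are represented by the functor of representing objects. -/
def reprIso (X : K) : RMod.Iso ((RMod.hom V (op X)).restrict (repr x)) (P.modT X) where
  e t := (asIso ((P.modK t).elt (x t) X) : (o t ⟶[V] X) ≅ P.obj X t)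
  act_hom s t := by
    refine (Category.assoc _ _ _).trans ?_
    exact comp_reprMap_elt x X s t

end Bimod

end Pairings

/-! ### A locally `Φ`-presentable `V`-category has a dense presentation by `T` -/

section Dense

variable {V : Type u} [Category.{v} V] [MonoidalCategory V] [SymmetricCategory V]
  [MonoidalClosed V]

/-- Commuting actions still commute after one of them is restricted along a map of hom-objects. It
is applied to evaluation, restricted along a functor into a functor `V`-category. -/
theorem comm_whiskerLeft {F F' N Q S G G' : V} (m : Q ⟶ N) {e₁ : F ⊗ N ⟶ G} {e₂ : F' ⊗ N ⟶ G'}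
    {a : F ⊗ S ⟶ F'} {g : G ⊗ S ⟶ G'}
    (h : e₁ ▷ S ≫ g = (α_ _ _ _).hom ≫ F ◁ (β_ _ _).hom ≫ (α_ _ _ _).inv ≫ a ▷ _ ≫ e₂) :
    (F ◁ m ≫ e₁) ▷ S ≫ g =
      (α_ _ _ _).hom ≫ F ◁ (β_ _ _).hom ≫ (α_ _ _ _).inv ≫ a ▷ _ ≫ F' ◁ m ≫ e₂ := by
  rw [comp_whiskerRight_assoc, h, associator_naturality_middle_assoc,
    ← MonoidalCategory.whiskerLeft_comp_assoc, BraidedCategory.braiding_naturality_left]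
  simp only [MonoidalCategory.whiskerLeft_comp, Category.assoc]
  rw [associator_inv_naturality_right_assoc, whisker_exchange_assoc]

theorem comm_element {F F' N S G G' : V} (m : 𝟙_ V ⟶ N) {e₁ : F ⊗ N ⟶ G} {e₂ : F' ⊗ N ⟶ G'}
    {a : F ⊗ S ⟶ F'} {g : G ⊗ S ⟶ G'}
    (h : e₁ ▷ S ≫ g = (α_ _ _ _).hom ≫ F ◁ (β_ _ _).hom ≫ (α_ _ _ _).inv ≫ a ▷ _ ≫ e₂) :
    a ≫ (ρ_ _).inv ≫ F' ◁ m ≫ e₂ = ((ρ_ _).inv ≫ F ◁ m ≫ e₁) ▷ S ≫ g := by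
  rw [comp_whiskerRight_assoc, comm_whiskerLeft m h, braiding_tensorUnit_left]
  simp

theorem conj_iff {Q K A B P R : V} (f : Q ⟶ K) (c : A ⊗ K ⟶ B) (e : A ≅ P) (e' : B ≅ R)
    (a : P ⊗ K ⟶ R) (h : c ≫ e'.hom = e.hom ▷ K ≫ a) (s : Q ⊗ A ⟶ B) :
    f ▷ A ≫ (β_ _ _).hom ≫ c = s ↔
      P ◁ f ≫ a = (β_ _ _).hom ≫ (Q ◁ e.inv ≫ s) ≫ e'.hom := by
  rw [← cancel_mono e'.hom, ← cancel_epi (Q ◁ e.inv), ← cancel_epi (β_ P Q).hom]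
  simp only [Category.assoc, h]
  refine Eq.congr ?_ rfl
  rw [← BraidedCategory.braiding_naturality_left_assoc,
    ← BraidedCategory.braiding_naturality_right_assoc, SymmetricCategory.symmetry_assoc,
    whisker_exchange_assoc, ← comp_whiskerRight_assoc]
  simp

theorem exists_iso_of_essSurj {C : Type u₁} [EnrichedCategory V C] {D : Type u₂}
    [EnrichedCategory V D] (F : EnrichedFunctor V C D) (hF : F.forget.EssSurj) (Y : D) :
    ∃ (X : C) (i : 𝟙_ V ⟶ (F.obj X ⟶[V] Y)) (i' : 𝟙_ V ⟶ (Y ⟶[V] F.obj X)),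
      elComp i i' = eId V _ ∧ elComp i' i = eId V _ := by
  obtain ⟨X, ⟨e⟩⟩ := hF.mem_essImage (ForgetEnrichment.of V Y)
  refine ⟨ForgetEnrichment.to V X, ForgetEnrichment.homTo V e.hom, ForgetEnrichment.homTo V e.inv,
    ?_, ?_⟩
  · refine (Category.assoc _ _ _).symm.trans ((ForgetEnrichment.homTo_comp V e.hom e.inv).symm.trans ?_)
    rw [e.hom_inv_id]
    exact ForgetEnrichment.homTo_id V _
  · refine (Category.assoc _ _ _).symm.trans ((ForgetEnrichment.homTo_comp V e.inv e.hom).symm.trans ?_)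
    rw [e.inv_hom_id]
    exact ForgetEnrichment.homTo_id V _

/-- A module is `Φ`-continuous if it sends `Φ`-limits to limits in `V`. -/
def RMod.Continuous (Φ : Set (Weight.{w} V)) {C : Type u₁} [EnrichedCategory V C]
    (M : RMod (V := V) C) : Prop :=
  ∀ φ ∈ Φ, ∀ (S : EnrichedFunctor V φ.Dom C) (c : WCone φ.fn S), c.IsLimit → IsLimV c M

variable {Φ : Set (Weight.{w} V)} {C : Type u₁} [EnrichedCategory V C]

theorem isContinuous_iff (G : EnrichedFunctor V C V) :
    IsContinuous Φ G ↔ (RMod.of G).Continuous Φ :=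
  forall₂_congr fun _ _ => forall₂_congr fun _ _ => imp_congr Iff.rfl (isLimit_map_iff _ _)

theorem RMod.Continuous.of_iso {M N : RMod (V := V) C} (hM : M.Continuous Φ) (e : RMod.Iso M N) :
    N.Continuous Φ :=
  fun φ hφ S c hc => (hM φ hφ S c hc).of_iso e

theorem RMod.continuous_hom (X : C) : (RMod.hom V X).Continuous Φ :=
  fun _ _ _ c hc => (isLimit_iff_isLimV c).1 hc X

theorem isContinuous_homFunctor (X : C) : IsContinuous Φ (homFunctor (V := V) X) := by
  rw [isContinuous_iff, RMod.of_homFunctor]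
  exact RMod.continuous_hom X

variable {T : Type u₂} [EnrichedCategory V T]

/-- The module `B(X, j -)`. -/
abbrev nerveMod (j : EnrichedFunctor V T C) (X : C) : RMod (V := V) T :=
  (RMod.hom V X).restrict j

/-- Every object `X` is the limit of `j` weighted by `C(X, j -)`. -/
def IsDense (j : EnrichedFunctor V T C) : Prop :=
  ∀ (X Z : C) (W : V) (σ : ∀ t, W ⊗ (X ⟶[V] j.obj t) ⟶ (Z ⟶[V] j.obj t)),
    RMod.IsHom W (nerveMod j X) (nerveMod j Z) σ →
      ∃! f : W ⟶ (Z ⟶[V] X), ∀ t, f ▷ _ ≫ eComp V Z X (j.obj t) = σ t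

section

variable [HasFunctorCategory V T V]

/-- An isomorphism in the functor category induces an isomorphism of modules. -/
def isoOfElements {F G : EnrichedFunctor V T V} (i : 𝟙_ V ⟶ (F ⟶[V] G)) (i' : 𝟙_ V ⟶ (G ⟶[V] F))
    (h : elComp i i' = eId V F) (h' : elComp i' i = eId V G) :
    RMod.Iso (RMod.of F) (RMod.of G) where
  e t :=
    { hom := (evMod V t).elAct i
      inv := (evMod V t).elAct i'
      hom_inv_id := by rw [RMod.elAct_elAct, h, RMod.elAct_eId]
      inv_hom_id := by rw [RMod.elAct_elAct, h', RMod.elAct_eId] }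
  act_hom s t := by
    exact comm_element i (ev_act F G s t)

/-- The actions presenting a `V`-functor to a functor category. -/
def Bimod.ofFunctor {K : Type u₁} [EnrichedCategory V K]
    (N : EnrichedFunctor V K (EnrichedFunctor V T V)) : Bimod (V := V) K T where
  obj X t := (N.obj X).obj t
  actK t := ((evMod V t).restrict N).act
  actT X := act (N.obj X)
  actK_id t := ((evMod V t).restrict N).act_id
  actK_act t := ((evMod V t).restrict N).act_act
  actT_id X := (RMod.of (N.obj X)).act_id
  actT_act X := (RMod.of (N.obj X)).act_act
  comm X Y s t := by
    exact comm_whiskerLeft (N.map X Y) (ev_act (N.obj X) (N.obj Y) s t)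

end

/-- The representable `T(t, -)` is `Φ`-continuous, so it is the image of some `o t` under the
equivalence `W`. By Yoneda `K(o t, X)` is the value of `W X` at `t`, which makes `o` a functor `j`
with `K(j -, X)` isomorphic to `W X`. Density of `j` is then full faithfulness of `W`, and
representability of continuous modules is its essential surjectivity. -/
theorem exists_isDense [Limits.HasLimits V] [Limits.HasColimits V] {K : Type u₁}
    [EnrichedCategory V K] (hK : IsLocallyPresentable Φ K) :
    ∃ (T : Type v) (_ : EnrichedCategory V T) (j : EnrichedFunctor V T Kᵒᵖ), IsComplete T Φ ∧
      IsDense j ∧ (∀ X, (nerveMod j X).Continuous Φ) ∧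
        ∀ M : RMod (V := V) T, M.Continuous Φ → ∃ X, Nonempty (RMod.Iso M (nerveMod j X)) := by
  obtain ⟨T, _, hT, W, hW, hW'⟩ := hK
  let N : EnrichedFunctor V K (EnrichedFunctor V T V) := W.comp V (FullSub.incl V _)
  have hN (X Y : K) : IsIso (N.map X Y) := by
    have := hW X Y
    have h : N.map X Y = W.map X Y := Category.comp_id _
    rw [h]
    exact this
  have hN' (F : EnrichedFunctor V T V) (hF : IsContinuous Φ F) :
      ∃ (X : K) (i : 𝟙_ V ⟶ (N.obj X ⟶[V] F)) (i' : 𝟙_ V ⟶ (F ⟶[V] N.obj X)),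
        elComp i i' = eId V _ ∧ elComp i' i = eId V _ :=
    exists_iso_of_essSurj W hW' ⟨F, hF⟩
  choose o i i' h₁ h₂ using fun t : T => hN' (homFunctor t) (isContinuous_homFunctor t)
  let P := Bimod.ofFunctor N
  -- The universal element of `N (o t)` at `t`: the identity of `t`, carried along the isomorphism
  -- from `T(t, -)` to `N (o t)`.
  let x (t : T) : 𝟙_ V ⟶ P.obj (o t) t := i' t ≫ (evMod V t).elt (X := homFunctor t) (eId V t) _
  -- The map defined by `x t` is the composite of three isomorphisms: the action of `N` on homs,
  -- precomposition with `i' t`, and Yoneda.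
  have hx (t : T) (X : K) : IsIso ((P.modK t).elt (x t) X) := by
    have e : (P.modK t).elt (x t) X = N.map (o t) X ≫ (evMod V t).elt (x t) (N.obj X) :=
      RMod.restrict_elt N (evMod V t) (x t) X
    have e' : (evMod V t).elt (x t) (N.obj X) = pre (i' t) _ ≫ _ := RMod.pre_elt _ _ _ _
    rw [e, e']
    exact IsIso.comp_isIso' (hN _ _) (IsIso.comp_isIso'
      (RMod.isIso_pre (i' t) (i t) (h₂ t) (h₁ t) (N.obj X)) (isIso_elt_eId t (N.obj X)))
  refine ⟨T, _, Bimod.repr x, hT, ?_, fun X => ?_, fun M hM => ?_⟩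
  · intro X Z Q σ hσ
    let eX := Bimod.reprIso x X.unop
    let eZ := Bimod.reprIso x Z.unop
    -- Conjugated by the representing isomorphisms, `σ` is a natural family from `N X` to `N Z`;
    -- since `N` is fully faithful, the morphism classifying it lifts to `K(X, Z)`.
    obtain ⟨g, hg, hu⟩ := existsUnique_natObj (F := N.obj X.unop) (G := N.obj Z.unop) _
      ((hσ.iso_comp eX.symm).comp_iso eZ)
    have hcond (f : Q ⟶ (X.unop ⟶[V] Z.unop)) (t : T) :
        f ▷ (o t ⟶[V] X.unop) ≫ (β_ _ _).hom ≫ eComp V (o t) X.unop Z.unop = σ t ↔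
          (N.obj X.unop).obj t ◁ (f ≫ N.map _ _) ≫ ev (N.obj X.unop) (N.obj Z.unop) t =
            (β_ _ _).hom ≫ (Q ◁ (eX.e t).inv ≫ σ t) ≫ (eZ.e t).hom := by
      rw [MonoidalCategory.whiskerLeft_comp, Category.assoc]
      exact conj_iff f (eComp V (o t) X.unop Z.unop) (eX.e t) (eZ.e t) _
        (RMod.elt_act (P.modK t) (x t) X.unop Z.unop).symm (σ t)
    refine ⟨g ≫ inv (N.map _ _), fun t => (hcond _ t).2 ?_, fun f hf => ?_⟩
    · rw [Category.assoc, IsIso.inv_hom_id, Category.comp_id]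
      exact hg t
    · refine (IsIso.eq_comp_inv (N.map X.unop Z.unop)).2 ?_
      exact hu _ fun t => (hcond f t).1 (hf t)
  · have h : (P.modT X.unop).Continuous Φ := (isContinuous_iff _).1 (W.obj X.unop).property
    exact h.of_iso (Bimod.reprIso x X.unop).symm
  · obtain ⟨X, i, i', h, h'⟩ := hN' M.toFunctor (by
      rw [isContinuous_iff, RMod.of_toFunctor]
      exact hM)
    refine ⟨op X, ⟨?_⟩⟩
    have e : RMod.Iso (P.modT X) (RMod.of M.toFunctor) := isoOfElements i i' h h'
    rw [RMod.of_toFunctor] at e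
    exact e.symm.trans (Bimod.reprIso x X).symm

end Dense

/-! ### Coends in `V`, and weighted colimits in `V` as coends -/

section Coends

variable {V : Type u} [Category.{v} V] [MonoidalCategory V]

variable {D : Type w} [EnrichedCategory V D]

/-- A family `F d ⊗ G d ⟶ Z` is balanced with respect to a right action on `F` and a left action
on `G`. -/
def Balanced (F : RMod (V := V) D) {G : D → V} (l : ∀ d d' : D, (d ⟶[V] d') ⊗ G d' ⟶ G d) {Z : V}
    (h : ∀ d, F.obj d ⊗ G d ⟶ Z) : Prop :=
  ∀ d d', F.act d d' ▷ G d' ≫ h d' = (α_ _ _ _).hom ≫ F.obj d ◁ l d d' ≫ h d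

/-- The family `q` exhibits `Q` as the tensor product over `D` of a right and a left module. -/
structure IsCoend (F : RMod (V := V) D) {G : D → V}
    (l : ∀ d d' : D, (d ⟶[V] d') ⊗ G d' ⟶ G d) {Q : V} (q : ∀ d, F.obj d ⊗ G d ⟶ Q) : Prop where
  balanced : Balanced F l q
  existsUnique : ∀ (Z : V) (h : ∀ d, F.obj d ⊗ G d ⟶ Z), Balanced F l h →
    ∃! f : Q ⟶ Z, ∀ d, q d ≫ f = h d

/-- The left action on `B(J -, X)`. -/
abbrev lhom {B : Type u₁} [EnrichedCategory V B] (J : EnrichedFunctor V D B) (X : B) (d d' : D) :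
    (d ⟶[V] d') ⊗ (J.obj d' ⟶[V] X) ⟶ (J.obj d ⟶[V] X) :=
  J.map d d' ▷ _ ≫ eComp V (J.obj d) (J.obj d') X

variable {F : RMod (V := V) D} {G : D → V} {l : ∀ d d' : D, (d ⟶[V] d') ⊗ G d' ⟶ G d}

theorem Balanced.postcomp {Z Z' : V} {h : ∀ d, F.obj d ⊗ G d ⟶ Z} (hh : Balanced F l h)
    (f : Z ⟶ Z') : Balanced F l (fun d => h d ≫ f) := by
  intro d d'
  have := hh d d'
  rw [reassoc_of% this]

theorem IsCoend.hom_ext {Q : V} {q : ∀ d, F.obj d ⊗ G d ⟶ Q} (hq : IsCoend F l q) {Z : V}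
    {f g : Q ⟶ Z} (h : ∀ d, q d ≫ f = q d ≫ g) : f = g :=
  (hq.existsUnique Z _ (hq.balanced.postcomp g)).unique h fun _ => rfl

variable [MonoidalClosed V]

/-- Tensoring with `P` has a right adjoint, so it preserves coends. The lemmas that follow give the
existence part and the versions with `P` on the right or on both sides. -/
theorem IsCoend.hom_ext_left {Q : V} {q : ∀ d, F.obj d ⊗ G d ⟶ Q} (hq : IsCoend F l q) {P Z : V}
    {f g : P ⊗ Q ⟶ Z} (h : ∀ d, P ◁ q d ≫ f = P ◁ q d ≫ g) : f = g := by
  refine MonoidalClosed.curry_injective (hq.hom_ext fun d => ?_)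
  rw [← MonoidalClosed.curry_natural_left, ← MonoidalClosed.curry_natural_left, h]

theorem IsCoend.existsUnique_left {Q : V} {q : ∀ d, F.obj d ⊗ G d ⟶ Q} (hq : IsCoend F l q)
    {P Z : V} (h : ∀ d, P ⊗ F.obj d ⊗ G d ⟶ Z)
    (hh : ∀ d d', P ◁ F.act d d' ▷ G d' ≫ h d' =
      P ◁ ((α_ _ _ _).hom ≫ F.obj d ◁ l d d') ≫ h d) :
    ∃! f : P ⊗ Q ⟶ Z, ∀ d, P ◁ q d ≫ f = h d := by
  obtain ⟨f, hf, -⟩ := hq.existsUnique _ (fun d => MonoidalClosed.curry (h d)) (by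
    intro d d'
    rw [← MonoidalClosed.curry_natural_left, hh, MonoidalClosed.curry_natural_left,
      Category.assoc])
  refine ⟨MonoidalClosed.uncurry f, fun d => ?_, fun g hg => hq.hom_ext_left fun d => ?_⟩
  · rw [← MonoidalClosed.uncurry_natural_left, hf, MonoidalClosed.uncurry_curry]
  · rw [hg d, ← MonoidalClosed.uncurry_natural_left, hf, MonoidalClosed.uncurry_curry]

variable [SymmetricCategory V]

theorem IsCoend.hom_ext_right {Q : V} {q : ∀ d, F.obj d ⊗ G d ⟶ Q} (hq : IsCoend F l q) {P Z : V}
    {f g : Q ⊗ P ⟶ Z} (h : ∀ d, q d ▷ P ≫ f = q d ▷ P ≫ g) : f = g := by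
  rw [← cancel_epi (β_ P Q).hom]
  refine hq.hom_ext_left fun d => ?_
  rw [BraidedCategory.braiding_naturality_right_assoc,
    BraidedCategory.braiding_naturality_right_assoc, h]

theorem IsCoend.hom_ext_middle {Q : V} {q : ∀ d, F.obj d ⊗ G d ⟶ Q} (hq : IsCoend F l q)
    {P P' Z : V} {f g : (P ⊗ Q) ⊗ P' ⟶ Z}
    (h : ∀ d, (P ◁ q d) ▷ P' ≫ f = (P ◁ q d) ▷ P' ≫ g) : f = g := by
  rw [← cancel_epi ((α_ P Q P').inv)]
  rw [← cancel_epi (P ◁ (β_ P' Q).hom), ← cancel_epi (α_ P P' Q).hom]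
  refine hq.hom_ext_left fun d => ?_
  have := h d
  have e : (P ⊗ P') ◁ q d ≫ (α_ P P' Q).hom ≫ P ◁ (β_ P' Q).hom ≫ (α_ P Q P').inv =
      (α_ P P' _).hom ≫ P ◁ (β_ P' _).hom ≫ (α_ P _ P').inv ≫ (P ◁ q d) ▷ P' := by
    rw [associator_naturality_right_assoc, ← MonoidalCategory.whiskerLeft_comp_assoc,
      BraidedCategory.braiding_naturality_right]
    simp
  rw [reassoc_of% e, reassoc_of% e, h]

theorem IsCoend.existsUnique_right {Q : V} {q : ∀ d, F.obj d ⊗ G d ⟶ Q} (hq : IsCoend F l q)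
    {P Z : V} (h : ∀ d, (F.obj d ⊗ G d) ⊗ P ⟶ Z)
    (hh : ∀ d d', F.act d d' ▷ G d' ▷ P ≫ h d' =
      ((α_ _ _ _).hom ≫ F.obj d ◁ l d d') ▷ P ≫ h d) :
    ∃! f : Q ⊗ P ⟶ Z, ∀ d, q d ▷ P ≫ f = h d := by
  obtain ⟨f, hf, -⟩ := hq.existsUnique_left (P := P) (fun d => (β_ _ _).hom ≫ h d) (by
    intro d d'
    rw [BraidedCategory.braiding_naturality_right_assoc,
      BraidedCategory.braiding_naturality_right_assoc, hh])
  have hf' (d : D) : q d ▷ P ≫ (β_ _ _).hom ≫ f = h d := by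
    rw [BraidedCategory.braiding_naturality_left_assoc, hf, SymmetricCategory.symmetry_assoc]
  refine ⟨(β_ _ _).hom ≫ f, hf', fun g hg => hq.hom_ext_right fun d => ?_⟩
  rw [hg d, hf']

theorem balanced_iff_braid {A A' H R R' Z : V} (a : A ⊗ H ⟶ A') (r : R' ⊗ H ⟶ R) (i : R ⊗ A ⟶ Z)
    (i' : R' ⊗ A' ⟶ Z) :
    R' ◁ a ≫ i' = R' ◁ (β_ A H).hom ≫ (α_ _ _ _).inv ≫ r ▷ A ≫ i ↔
      a ▷ R' ≫ (β_ _ _).hom ≫ i' =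
        (α_ _ _ _).hom ≫ A ◁ ((β_ _ _).hom ≫ r) ≫ (β_ _ _).hom ≫ i := by
  rw [← cancel_epi (β_ (A ⊗ H) R').hom, BraidedCategory.braiding_naturality_left_assoc]
  refine Eq.congr rfl ?_
  rw [MonoidalCategory.whiskerLeft_comp_assoc, BraidedCategory.braiding_naturality_right_assoc,
    BraidedCategory.braiding_tensor_left_hom, BraidedCategory.braiding_tensor_right_hom]
  simp

theorem balanced_unit {A A' H R R' Z : V} (a : A ⊗ H ⟶ A') (r : R' ⊗ H ⟶ R) (i : R ⊗ A ⟶ Z)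
    (i' : R' ⊗ A' ⟶ Z) (e : R' ◁ a ≫ i' = R' ◁ (β_ A H).hom ≫ (α_ _ _ _).inv ≫ r ▷ A ≫ i) :
    R' ◁ a ▷ 𝟙_ V ≫ R' ◁ (ρ_ _).hom ≫ i' = R' ◁ ((β_ A H).hom ▷ 𝟙_ V ≫ (α_ _ _ _).hom) ≫
      (α_ _ _ _).inv ≫ r ▷ (A ⊗ 𝟙_ V) ≫ R ◁ (ρ_ _).hom ≫ i := by
  rw [← MonoidalCategory.whiskerLeft_comp_assoc, rightUnitor_naturality,
    MonoidalCategory.whiskerLeft_comp_assoc, e, ← whisker_exchange_assoc]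
  simp

theorem balanced_whisker {A A' H R R' W Z : V} (a : A ⊗ H ⟶ A') (r : R' ⊗ H ⟶ R)
    (t : R ⊗ (A ⊗ W) ⟶ Z) (t' : R' ⊗ (A' ⊗ W) ⟶ Z)
    (e : R' ◁ a ▷ W ≫ t' =
      R' ◁ ((β_ A H).hom ▷ W ≫ (α_ _ _ _).hom) ≫ (α_ _ _ _).inv ≫ r ▷ (A ⊗ W) ≫ t) :
    a ▷ R' ▷ W ≫ (β_ A' R').hom ▷ W ≫ (α_ _ _ _).hom ≫ t' =
      ((α_ A H R').hom ≫ A ◁ ((β_ _ _).hom ≫ r)) ▷ W ≫ (β_ A R).hom ▷ W ≫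
        (α_ _ _ _).hom ≫ t := by
  have e' : (A ◁ r) ▷ W ≫ (β_ A R).hom ▷ W = (β_ A _).hom ▷ W ≫ r ▷ A ▷ W := by
    rw [← comp_whiskerRight, BraidedCategory.braiding_naturality_right, comp_whiskerRight]
  rw [← comp_whiskerRight_assoc, BraidedCategory.braiding_naturality_left, comp_whiskerRight_assoc,
    associator_naturality_middle_assoc, e, BraidedCategory.braiding_tensor_left_hom]
  simp only [MonoidalCategory.whiskerLeft_comp, comp_whiskerRight, Category.assoc]
  rw [reassoc_of% e', BraidedCategory.braiding_tensor_right_hom]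
  simp

/-- The colimit property quantifies over a parameter `W`, the coend property does not. The case `W =
I` gives the coend; conversely `- ⊗ W` preserves coends, so the parameter comes for free. -/
theorem WCocone.isColimit_iff_isCoend {F : EnrichedFunctor V D V} {R : EnrichedFunctor V Dᵒᵖ V}
    {c : WCocone F R} : c.IsColimit ↔
    IsCoend (RMod.of F) (G := fun d => R.obj (op d))
      (fun d d' => (β_ _ _).hom ≫ MonoidalClosed.uncurry (R.map (op d') (op d)))
      (fun d => (β_ _ _).hom ≫ MonoidalClosed.uncurry (c.ι d)) := by
  have hiff {W Z : V} (d : D) (f : W ⟶ (ihom c.pt).obj Z) (g : F.obj d ⊗ W ⟶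
      (ihom (R.obj (op d))).obj Z) : (c.ι d ⊗ₘ f) ≫ eComp V (R.obj (op d)) c.pt Z = g ↔
      ((β_ _ _).hom ≫ MonoidalClosed.uncurry (c.ι d)) ▷ W ≫ MonoidalClosed.uncurry f =
        (β_ _ _).hom ▷ W ≫ (α_ _ _ _).hom ≫ MonoidalClosed.uncurry g := by
    rw [← MonoidalClosed.uncurry_injective.eq_iff, uncurry_eComp, comp_whiskerRight_assoc,
      Iso.inv_comp_eq, cancel_epi]
  constructor
  · intro hc
    constructor
    · intro d d'
      have h := congrArg MonoidalClosed.uncurry (c.naturality d d')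
      refine (balanced_iff_braid _ _ _ _).1 ?_
      refine (MonoidalClosed.uncurry_natural_left _ _).symm.trans (h.trans ?_)
      refine (MonoidalClosed.uncurry_natural_left _ _).trans ?_
      exact congrArg _ (uncurry_eComp (R.map (op d') (op d)) _)
    · intro Z h hh
      let g (d : D) : F.obj d ⊗ 𝟙_ V ⟶ (ihom (R.obj (op d))).obj Z :=
        MonoidalClosed.curry (R.obj (op d) ◁ (ρ_ _).hom ≫ (β_ _ _).hom ≫ h d)
      obtain ⟨f, hf, hu⟩ := hc (𝟙_ V) Z ⟨g, by
          intro d d'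
          apply MonoidalClosed.uncurry_injective
          have e := (balanced_iff_braid (act F d d')
            (MonoidalClosed.uncurry (R.map (op d') (op d)))
            ((β_ _ _).hom ≫ h d) ((β_ _ _).hom ≫ h d')).2 (by
              simpa using hh d d')
          refine (MonoidalClosed.uncurry_natural_left _ _).trans ?_
          refine (congrArg (fun t => R.obj (op d') ◁ act F d d' ▷ 𝟙_ V ≫ t)
            (MonoidalClosed.uncurry_curry _)).trans ?_
          refine (balanced_unit _ _ _ _ e).trans (Eq.symm ?_)
          refine (congrArg MonoidalClosed.uncurry (Category.assoc _ _ _).symm).trans ?_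
          refine (MonoidalClosed.uncurry_natural_left _ _).trans ?_
          refine congrArg (fun t => _ ≫ t) ((uncurry_eComp (R.map (op d') (op d)) _).trans ?_)
          exact congrArg (fun t => (α_ _ _ _).inv ≫ _ ▷ _ ≫ t) (MonoidalClosed.uncurry_curry _)⟩
      have hiff' (d : D) (f : c.pt ⟶ Z) :
          (c.ι d ⊗ₘ MonoidalClosed.curry ((ρ_ _).hom ≫ f)) ≫ eComp V (R.obj (op d)) c.pt Z = g d ↔
            ((β_ _ _).hom ≫ MonoidalClosed.uncurry (c.ι d)) ≫ f = h d := by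
        rw [hiff, MonoidalClosed.uncurry_curry, MonoidalClosed.uncurry_curry,
          rightUnitor_naturality_assoc, ← cancel_epi (ρ_ (F.obj d ⊗ R.obj (op d))).hom]
        refine Eq.congr rfl ?_
        simp
      refine ⟨(ρ_ _).inv ≫ MonoidalClosed.uncurry f, fun d => (hiff' d _).1 ?_, fun k hk => ?_⟩
      · rw [Iso.hom_inv_id_assoc, MonoidalClosed.curry_uncurry]
        exact hf d
      · have := hu (MonoidalClosed.curry ((ρ_ _).hom ≫ k)) fun d => (hiff' d k).2 (hk d)
        rw [← this, MonoidalClosed.uncurry_curry, Iso.inv_hom_id_assoc]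
  · intro hc W Z θ
    obtain ⟨f, hf, hu⟩ := hc.existsUnique_right (P := W)
      (fun d => (β_ _ _).hom ▷ W ≫ (α_ _ _ _).hom ≫ MonoidalClosed.uncurry (θ.app d)) (by
        intro d d'
        refine balanced_whisker _ _ _ _ ?_
        have h := congrArg MonoidalClosed.uncurry (θ.naturality d d')
        refine (MonoidalClosed.uncurry_natural_left _ _).symm.trans (h.trans ?_)
        refine (congrArg MonoidalClosed.uncurry (Category.assoc _ _ _).symm).trans ?_
        refine (MonoidalClosed.uncurry_natural_left _ _).trans ?_
        exact congrArg (fun t => _ ≫ t) (uncurry_eComp (R.map (op d') (op d)) _))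
    refine ⟨MonoidalClosed.curry f, fun d => (hiff d _ _).2 ?_, fun k hk => ?_⟩
    · rw [MonoidalClosed.uncurry_curry]
      exact hf d
    · rw [MonoidalClosed.eq_curry_iff]
      exact hu _ fun d => (hiff d k _).1 (hk d)

end Coends

/-! ### Colimits in `K` as limits in `Kᵒᵖ` -/

section Opposites

variable {V : Type u} [Category.{v} V] [MonoidalCategory V] [SymmetricCategory V]

variable {D : Type w} [EnrichedCategory V D] {K : Type u₁} [EnrichedCategory V K]

/-- The `V`-functor `Dᵒᵖ ⥤ K` corresponding to `D ⥤ Kᵒᵖ`. -/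
def unopFunctor (J : EnrichedFunctor V D Kᵒᵖ) : EnrichedFunctor V Dᵒᵖ K where
  obj d := (J.obj d.unop).unop
  map d d' := J.map d'.unop d.unop
  map_id d := J.map_id d.unop
  map_comp d d' d'' := by
    have h := J.map_comp d''.unop d'.unop d.unop
    rw [eComp_op_eq, Category.assoc]
    refine (congrArg (fun t => (β_ _ _).hom ≫ t) (h.trans ?_)).trans
      (SymmetricCategory.symmetry_assoc _ _ _)
    exact BraidedCategory.braiding_naturality_assoc (J.map d''.unop d'.unop)
      (J.map d'.unop d.unop) _

/-- The `V`-functor `D ⥤ Kᵒᵖ` corresponding to `Dᵒᵖ ⥤ K`. -/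
def opFunctor' (R : EnrichedFunctor V Dᵒᵖ K) : EnrichedFunctor V D Kᵒᵖ where
  obj d := op (R.obj (op d))
  map d d' := R.map (op d') (op d)
  map_id d := R.map_id (op d)
  map_comp d d' d'' := by
    have h := R.map_comp (op d'') (op d') (op d)
    rw [eComp_op_eq, Category.assoc] at h
    refine Eq.trans ?_ (BraidedCategory.braiding_naturality_assoc (R.map (op d') (op d))
      (R.map (op d'') (op d')) (eComp V (R.obj (op d'')) (R.obj (op d')) (R.obj (op d)))).symm
    refine Eq.trans ?_ (congrArg (fun t => (β_ _ _).hom ≫ t) h)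
    exact (SymmetricCategory.symmetry_assoc _ _ _).symm

variable [MonoidalClosed V]

variable {F : EnrichedFunctor V D V}

/-- The cocone over `unopFunctor J` corresponding to a cone over `J : D ⥤ Kᵒᵖ`. -/
def WCone.unop {J : EnrichedFunctor V D Kᵒᵖ} (c : WCone F J) : WCocone F (unopFunctor J) where
  pt := c.pt.unop
  ι := c.π
  naturality d d' := by
    refine (c.naturality d d').trans ?_
    exact BraidedCategory.braiding_naturality_assoc (c.π d) (J.map d d')
      (eComp V (J.obj d').unop (J.obj d).unop c.pt.unop)

/-- The cone over `opFunctor' R` corresponding to a cocone over `R : Dᵒᵖ ⥤ K`. -/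
def WCocone.op {R : EnrichedFunctor V Dᵒᵖ K} (c : WCocone F R) : WCone F (opFunctor' R) where
  pt := Opposite.op c.pt
  π := c.ι
  naturality d d' := by
    refine (c.naturality d d').trans ?_
    exact (BraidedCategory.braiding_naturality_assoc (c.ι d) (R.map (Opposite.op d') (Opposite.op d))
      (eComp V (R.obj (Opposite.op d')) (R.obj (Opposite.op d)) c.pt)).symm

theorem cone_aux {A H A' W Q R R' : V} (a : A ⊗ H ⟶ A') (θ : A ⊗ W ⟶ R) (θ' : A' ⊗ W ⟶ R')
    (r : H ⟶ Q) (e : Q ⊗ R ⟶ R') :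
    a ▷ W ≫ θ' = (β_ A H).hom ▷ W ≫ (α_ _ _ _).hom ≫ (r ⊗ₘ θ) ≫ e ↔
    (α_ W A H).hom ≫ W ◁ a ≫ (β_ _ _).hom ≫ θ' =
      (((β_ _ _).hom ≫ θ) ⊗ₘ r) ≫ (β_ _ _).hom ≫ e := by
  rw [← cancel_epi ((α_ W A H).hom ≫ (β_ _ _).hom)]
  simp only [Category.assoc]
  rw [← BraidedCategory.braiding_naturality_right_assoc]
  refine Eq.congr rfl ?_
  rw [BraidedCategory.braiding_naturality_assoc, ← whisker_aux₂,
    BraidedCategory.braiding_tensor_right_hom, ← BraidedCategory.braiding_naturality_left_assoc,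
    BraidedCategory.braiding_tensor_left_hom]
  simp

theorem WCone.isLimit_iff_unop {J : EnrichedFunctor V D Kᵒᵖ} (c : WCone F J) :
    c.IsLimit ↔ c.unop.IsColimit := by
  have hcond {W A : V} {Y Z Z' : K} (f : W ⟶ (Z ⟶[V] Z')) (p : A ⟶ (Y ⟶[V] Z))
      (t : A ⊗ W ⟶ (Y ⟶[V] Z')) : (p ⊗ₘ f) ≫ eComp V Y Z Z' = t ↔
      (f ⊗ₘ p) ≫ (β_ _ _).hom ≫ eComp V Y Z Z' = (β_ _ _).hom ≫ t := by
    rw [BraidedCategory.braiding_naturality_assoc, cancel_epi]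
  constructor
  · intro h W X θ
    obtain ⟨f, hf, hu⟩ := h W (op X) ⟨fun d => (β_ _ _).hom ≫ θ.app d, fun d d' =>
      (cone_aux (act F d d') (θ.app d) (θ.app d') (J.map d d')
        (eComp V (J.obj d').unop (J.obj d).unop X)).1
        (θ.naturality d d')⟩
    exact ⟨f, fun d => (hcond _ _ _).2 (hf d), fun g hg => hu g fun d => (hcond _ _ _).1 (hg d)⟩
  · intro h W X θ
    have e (d : D) : (β_ _ _).hom ≫ (β_ _ _).hom ≫ θ.app d = θ.app d :=
      SymmetricCategory.symmetry_assoc _ _ _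
    obtain ⟨f, hf, hu⟩ := h W X.unop ⟨fun d => (β_ _ _).hom ≫ θ.app d, fun d d' =>
      (cone_aux (act F d d') ((β_ _ _).hom ≫ θ.app d) ((β_ _ _).hom ≫ θ.app d') (J.map d d')
        (eComp V (J.obj d').unop (J.obj d).unop X.unop)).2 (by
          rw [SymmetricCategory.symmetry_assoc, SymmetricCategory.symmetry_assoc]
          exact θ.naturality d d')⟩
    refine ⟨f, fun d => ((hcond _ _ _).1 (hf d)).trans (e d),
      fun g hg => hu g fun d => (hcond _ _ _).2 ((hg d).trans (e d).symm)⟩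

theorem WCocone.isColimit_iff_op {R : EnrichedFunctor V Dᵒᵖ K} (c : WCocone F R) :
    c.IsColimit ↔ c.op.IsLimit :=
  c.op.isLimit_iff_unop.symm

theorem isCoend_congr {F : RMod (V := V) D} {G : D → V}
    {l l' : ∀ d d' : D, (d ⟶[V] d') ⊗ G d' ⟶ G d}
    {Q : V} {q q' : ∀ d, F.obj d ⊗ G d ⟶ Q} (hl : ∀ d d', l d d' = l' d d')
    (hq : ∀ d, q d = q' d) : IsCoend F l q ↔ IsCoend F l' q' := by
  obtain rfl : l = l' := funext fun d => funext fun d' => hl d d'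
  obtain rfl : q = q' := funext fun d => hq d
  rfl

/-- The image of a cocone under `K(X, -)` is a colimit in `V` if and only if it is given by a
coend. -/
theorem isColimit_map_homFunctor_iff {J : EnrichedFunctor V D Kᵒᵖ} (c : WCone F J) (X : Kᵒᵖ) :
    (c.unop.map (homFunctor X.unop)).IsColimit ↔ IsCoend (RMod.of F) (lhom J X)
      (fun d => c.π d ▷ _ ≫ eComp V c.pt (J.obj d) X) := by
  have e {A : V} {Y Z : K} (f : A ⟶ (Y ⟶[V] Z)) : (β_ _ _).hom ≫
      MonoidalClosed.uncurry (f ≫ (homFunctor X.unop).map Y Z) =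
        f ▷ _ ≫ (β_ _ _).hom ≫ eComp V X.unop Y Z := by
    refine (congrArg (fun t => (β_ _ _).hom ≫ t) (MonoidalClosed.uncurry_natural_left _ _)).trans ?_
    refine (BraidedCategory.braiding_naturality_left_assoc _ _ _).symm.trans ?_
    exact congrArg (fun t => f ▷ _ ≫ (β_ _ _).hom ≫ t) (MonoidalClosed.uncurry_curry _)
  refine WCocone.isColimit_iff_isCoend.trans (isCoend_congr (fun d d' => ?_) fun d => ?_)
  · exact e (J.map d d')
  · exact e (c.π d)

variable (Φ : Set (Weight.{w} V)) [Limits.HasLimits V] [Limits.HasColimits V]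

/-- Presentability is put in the form used throughout: colimits of `K` become limit cones in `Kᵒᵖ`,
and preservation by `K(X, -)` becomes a coend formula. -/
theorem isPresentable_iff {X : K} : IsPresentable Φ X ↔
    ∀ (D : Type v) [EnrichedCategory V D] (F : EnrichedFunctor V D V), IsFlat Φ F →
      ∀ (J : EnrichedFunctor V D Kᵒᵖ) (c : WCone F J), c.IsLimit →
        IsCoend (RMod.of F) (lhom J (op X)) (fun d => c.π d ▷ _ ≫ eComp V c.pt (J.obj d) (op X)) := by
  constructor
  · intro h D _ F hF J c hc
    exact (isColimit_map_homFunctor_iff c (op X)).1 (h D F hF _ c.unop (c.isLimit_iff_unop.1 hc))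
  · intro h D _ F hF R c hc
    exact (isColimit_map_homFunctor_iff c.op (op X)).2
      (h D F hF _ c.op (c.isColimit_iff_op.1 hc))

end Opposites

/-! ### Limits in functor `V`-categories are pointwise -/

section PointwiseLimits

variable {V : Type u} [Category.{v} V] [MonoidalCategory V]

theorem RMod.isHom_act {C : Type u₁} [EnrichedCategory V C] (M : RMod (V := V) C) (X : C) :
    IsHom (M.obj X) (hom V X) M (M.act X) :=
  fun c d => (M.act_act X c d).symm

theorem tensorHom_whiskerLeft_ev {G W N φ H H' P R Z : V} (k : W ⟶ N) (π : φ ⟶ H) (m : H ⟶ H')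
    {e : G ⊗ N ⟶ P} {e'' : P ⊗ H' ⟶ Z} {n : N ⊗ H' ⟶ R} {e' : G ⊗ R ⟶ Z}
    (h : e ▷ H' ≫ e'' = (α_ _ _ _).hom ≫ G ◁ n ≫ e') :
    ((G ◁ k ≫ e) ⊗ₘ π) ≫ P ◁ m ≫ e'' =
      (α_ _ _ _).hom ≫ G ◁ ((k ⊗ₘ π) ≫ N ◁ m ≫ n) ≫ e' := by
  rw [MonoidalCategory.tensorHom_def, MonoidalCategory.tensorHom_def, comp_whiskerRight_assoc,
    Category.assoc, Category.assoc, ← MonoidalCategory.whiskerLeft_comp_assoc P,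
    ← whisker_exchange_assoc, h]
  simp

variable [SymmetricCategory V]

theorem tensorHom_act_swap {X P P' S S' E H φ : V} (f : X ⟶ P) (a : P ⊗ E ⟶ P') (p : P ⊗ H ⟶ S)
    (p' : P' ⊗ H ⟶ S') (a' : S ⊗ E ⟶ S') (π : φ ⟶ H)
    (h : p ▷ E ≫ a' = (α_ _ _ _).hom ≫ P ◁ (β_ _ _).hom ≫ (α_ _ _ _).inv ≫ a ▷ H ≫ p') :
    ((f ▷ E ≫ a) ⊗ₘ π) ≫ p' = (α_ _ _ _).hom ≫ X ◁ (β_ _ _).hom ≫ (α_ _ _ _).inv ≫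
      ((f ⊗ₘ π) ≫ p) ▷ E ≫ a' := by
  have h' : a ▷ H ≫ p' = (α_ _ _ _).hom ≫ P ◁ (β_ _ _).hom ≫ (α_ _ _ _).inv ≫ p ▷ E ≫ a' := by
    rw [h, Iso.inv_hom_id_assoc, ← MonoidalCategory.whiskerLeft_comp_assoc,
      SymmetricCategory.symmetry]
    simp
  have e : X ◁ (β_ E φ).hom ≫ (α_ _ _ _).inv ≫ (f ⊗ₘ π) ▷ E =
      X ◁ E ◁ π ≫ f ▷ (E ⊗ H) ≫ P ◁ (β_ E H).hom ≫ (α_ _ _ _).inv := by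
    rw [← whisker_exchange_assoc, ← MonoidalCategory.whiskerLeft_comp_assoc,
      BraidedCategory.braiding_naturality_right, MonoidalCategory.tensorHom_def']
    simp
  rw [MonoidalCategory.tensorHom_def', comp_whiskerRight, Category.assoc, Category.assoc, h',
    comp_whiskerRight_assoc, reassoc_of% e]
  simp

theorem braiding_whisker_act {G G' E W φ Z : V} (g : G ⊗ E ⟶ G') (k : G' ⊗ (W ⊗ φ) ⟶ Z) :
    (α_ (G ⊗ W) E φ).hom ≫ _ ◁ (β_ _ _).hom ≫ (α_ _ _ _).inv ≫ (α_ _ _ _).hom ▷ E ≫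
      (α_ _ _ _).hom ≫ G ◁ (β_ _ _).hom ≫ (α_ _ _ _).inv ≫ g ▷ _ ≫ k =
    ((α_ G W E).hom ≫ G ◁ (β_ _ _).hom ≫ (α_ _ _ _).inv ≫ g ▷ W) ▷ φ ≫ (α_ _ _ _).hom ≫ k := by
  have e : W ◁ (β_ E φ).hom ≫ (α_ _ _ _).inv ≫ (β_ (W ⊗ φ) E).hom =
      (α_ _ _ _).inv ≫ (β_ W E).hom ▷ φ ≫ (α_ _ _ _).hom := by
    rw [BraidedCategory.braiding_tensor_left_hom, Iso.inv_hom_id_assoc,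
      ← MonoidalCategory.whiskerLeft_comp_assoc, SymmetricCategory.symmetry]
    simp
  have e' : (G ⊗ W) ◁ (β_ E φ).hom ≫ (α_ _ _ _).inv ≫ (α_ _ _ _).hom ▷ E ≫ (α_ _ _ _).hom =
      (α_ _ _ _).hom ≫ G ◁ (W ◁ (β_ E φ).hom ≫ (α_ _ _ _).inv) := by
    simp
  rw [reassoc_of% e', ← MonoidalCategory.whiskerLeft_comp_assoc, Category.assoc, e]
  simp

theorem braiding_act_swap {G G' E W P P' : V} (g : G ⊗ E ⟶ G') (f : G ⊗ W ⟶ P) (f' : G' ⊗ W ⟶ P')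
    (a : P ⊗ E ⟶ P')
    (h : f ▷ E ≫ a = ((α_ G W E).hom ≫ G ◁ (β_ _ _).hom ≫ (α_ _ _ _).inv ≫ g ▷ W) ≫ f') :
    (α_ _ _ _).hom ≫ W ◁ g ≫ (β_ _ _).hom ≫ f' = ((β_ _ _).hom ≫ f) ▷ E ≫ a := by
  rw [comp_whiskerRight_assoc, h, BraidedCategory.braiding_naturality_right_assoc,
    BraidedCategory.braiding_tensor_right_hom]
  simp

variable [MonoidalClosed V]

variable {D : Type w} [EnrichedCategory V D] {A : Type u₁} [EnrichedCategory V A]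
  {φ : EnrichedFunctor V D V} {S : EnrichedFunctor V D A} {c : WCone φ S}

theorem isHom_proj (c : WCone φ S) (G : RMod (V := V) A) {W : V} (g : W ⟶ G.obj c.pt) :
    RMod.IsHom W (RMod.of φ) (G.restrict S) (fun d => (g ⊗ₘ c.π d) ≫ G.act c.pt (S.obj d)) := by
  have h : RMod.IsHom (G.obj c.pt) (RMod.of φ) (G.restrict S)
      (fun d => G.obj c.pt ◁ c.π d ≫ G.act c.pt (S.obj d)) := by
    intro d d'
    have hn := c.naturality d d'
    rw [← MonoidalCategory.whiskerLeft_comp_assoc, hn, MonoidalCategory.tensorHom_def]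
    simp only [MonoidalCategory.whiskerLeft_comp, comp_whiskerRight, Category.assoc]
    rw [← whisker_exchange_assoc, G.act_act]
    simp
  have := h.reindex g
  convert this using 2 with d
  rw [MonoidalCategory.tensorHom_def, Category.assoc]

theorem IsLimV.hom_ext {G : RMod (V := V) A} (h : IsLimV c G) {W : V} {f g : W ⟶ G.obj c.pt}
    (hfg : ∀ d, (f ⊗ₘ c.π d) ≫ G.act c.pt (S.obj d) = (g ⊗ₘ c.π d) ≫ G.act c.pt (S.obj d)) :
    f = g :=
  (h W _ (isHom_proj c G g)).unique hfg fun _ => rfl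

variable {E : Type u₂} [EnrichedCategory V E] [HasFunctorCategory V E V]

/-- Evaluated at `e`, a family into `[E, V](G, P (S d))` has parameter `G e ⊗ W` and factors
uniquely through the limit at `e`. Uniqueness makes these factorisations natural in `e`, so they
assemble to a morphism into the object of natural transformations. -/
theorem isLimit_map_of_pointwise (P : EnrichedFunctor V A (EnrichedFunctor V E V))
    (h : ∀ e, IsLimV c ((evMod V e).restrict P)) : (c.map P).IsLimit := by
  refine (isLimit_iff_isLimV _).2 fun G => (isLimV_map_iff c P _).2 fun W θ hθ => ?_
  choose f hf hu using fun e => h e (G.obj e ⊗ W) _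
    (hθ.comp (((RMod.isHom_act (evMod V e) G).restrict P).restrict S))
  have hnat : RMod.IsHom W (RMod.of G) (RMod.of (P.obj c.pt)) (fun e => (β_ _ _).hom ≫ f e) := by
    intro e e'
    refine braiding_act_swap (act G e e') (f e) (f e') (act (P.obj c.pt) e e') ?_
    -- Naturality in `e` is checked after projecting to each `d`, where it follows from the
    -- commutation of evaluation with the actions of `E`.
    refine (h e').hom_ext fun d => ?_
    refine (tensorHom_act_swap (f e) (act (P.obj c.pt) e e') _ _ (act (P.obj (S.obj d)) e e') (c.π d)
      (comm_whiskerLeft (P.map c.pt (S.obj d)) (ev_act (P.obj c.pt) (P.obj (S.obj d)) e e'))).trans ?_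
    refine (congrArg (fun t => (α_ _ _ _).hom ≫ (G.obj e ⊗ W) ◁ (β_ _ _).hom ≫ (α_ _ _ _).inv ≫
      t ▷ _ ≫ act (P.obj (S.obj d)) e e') (hf e d)).trans ?_
    refine Eq.trans ?_ (whisker_aux₁ _ _ _ _).symm
    refine Eq.trans ?_ (congrArg (fun t => _ ▷ φ.obj d ≫ t) (hf e' d)).symm
    refine Eq.trans ?_ (braiding_whisker_act (act G e e') (G.obj e' ◁ θ d ≫ ev G (P.obj (S.obj d)) e'))
    refine congrArg (fun t => (α_ _ _ _).hom ≫ (G.obj e ⊗ W) ◁ (β_ _ _).hom ≫ (α_ _ _ _).inv ≫ t)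
      ((comp_whiskerRight_assoc _ _ _ _).trans ?_)
    exact congrArg (fun t => (α_ _ _ _).hom ▷ _ ≫ t)
      (comm_whiskerLeft (θ d) (ev_act G (P.obj (S.obj d)) e e'))
  have hcond (k : W ⟶ natObj G (P.obj c.pt)) :
      (∀ d, (k ⊗ₘ c.π d) ≫ natObj G (P.obj c.pt) ◁ P.map c.pt (S.obj d) ≫
        eComp V G (P.obj c.pt) (P.obj (S.obj d)) = θ d) ↔
      ∀ e, G.obj e ◁ k ≫ ev G (P.obj c.pt) e = (β_ _ _).hom ≫ (β_ _ _).hom ≫ f e := by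
    have hd (e : E) (d : D) : ((G.obj e ◁ k ≫ ev G (P.obj c.pt) e) ⊗ₘ c.π d) ≫
        (P.obj c.pt).obj e ◁ P.map c.pt (S.obj d) ≫ ev _ _ e = (α_ _ _ _).hom ≫
          G.obj e ◁ ((k ⊗ₘ c.π d) ≫ natObj G (P.obj c.pt) ◁ P.map c.pt (S.obj d) ≫
            eComp V G (P.obj c.pt) (P.obj (S.obj d))) ≫ ev G (P.obj (S.obj d)) e := by
      exact tensorHom_whiskerLeft_ev k (c.π d) (P.map c.pt (S.obj d))
        ((evMod V e).act_act G (P.obj c.pt) (P.obj (S.obj d)))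
    constructor
    · intro hk e
      rw [SymmetricCategory.symmetry_assoc]
      refine hu e _ fun d => (hd e d).trans ?_
      rw [hk]
    · intro hk d
      refine natObj_ext_ev fun e => ?_
      refine (cancel_epi (α_ _ _ _).hom).1 ((hd e d).symm.trans ?_)
      rw [hk, SymmetricCategory.symmetry_assoc]
      exact hf e d
  obtain ⟨k, hk, hk'⟩ := existsUnique_natObj _ hnat
  exact ⟨k, (hcond k).2 hk, fun g hg => hk' g ((hcond g).1 hg)⟩

end PointwiseLimits

/-! ### Left Kan extensions of flat weights -/

section Lan

theorem lan_aux {V : Type u} [Category.{v} V] [MonoidalCategory V] [SymmetricCategory V]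
    {F N R R' Q Q' H : V} (u : R ⊗ F ⟶ Q) (u' : R' ⊗ F ⟶ Q') (k : Q ⊗ N ⟶ Q') (e : R ⊗ N ⟶ R')
    (m : H ⟶ N) (e₀ : R ⊗ H ⟶ R') (h₀ : R ◁ m ≫ e = e₀)
    (h : (α_ R F N).inv ≫ u ▷ N ≫ k = R ◁ (β_ _ _).hom ≫ (α_ _ _ _).inv ≫ e ▷ F ≫ u') :
    ((β_ _ _).hom ≫ u) ▷ H ≫ Q ◁ m ≫ k = (α_ F R H).hom ≫ F ◁ e₀ ≫ (β_ _ _).hom ≫ u' := by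
  subst h₀
  rw [Iso.inv_comp_eq] at h
  rw [comp_whiskerRight_assoc, ← whisker_exchange_assoc, h, ← whisker_exchange_assoc,
    MonoidalCategory.whiskerLeft_comp_assoc F,
    BraidedCategory.braiding_naturality_right_assoc F e, BraidedCategory.braiding_tensor_right_hom]
  simp

variable {V : Type u} [Category.{v} V] [MonoidalCategory V] [SymmetricCategory V]
  [MonoidalClosed V] [Limits.HasLimits V] [Limits.HasColimits V]

variable {C : Type v} [EnrichedCategory V C] {D : Type u₂} [EnrichedCategory V D]

/-- The left Kan extension `F * D(J, 1) : D ⥤ V` of `F` along `J`. -/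
def lan (F : EnrichedFunctor V C V) (J : EnrichedFunctor V C D) : EnrichedFunctor V D V :=
  (nerve J).comp V (colimFunctor F)

variable (F : EnrichedFunctor V C V) (J : EnrichedFunctor V C D)

/-- The coprojections of the coend computing the left Kan extension. -/
def lanι (c : C) (d : D) : F.obj c ⊗ (J.obj c ⟶[V] d) ⟶ (lan F J).obj d :=
  (β_ _ _).hom ≫ MonoidalClosed.uncurry ((colimCocone F (nerveObj J d)).ι c)

/-- The value at `d` is by definition the colimit of `D(J -, d)` weighted by `F`, and colimits in
`V` are coends. -/
theorem isCoend_lan (d : D) : IsCoend (RMod.of F) (lhom J d) (fun c => lanι F J c d) := by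
  refine (isCoend_congr (fun c c' => ?_) fun c => rfl).1
    (WCocone.isColimit_iff_isCoend.1 (colimCocone_isColimit F (nerveObj J d)))
  refine (congrArg (fun t => (β_ _ _).hom ≫ t) (uncurry_nerveObj_map J d (op c') (op c))).trans ?_
  refine (BraidedCategory.braiding_naturality_left_assoc (J.map c c') (J.obj c' ⟶[V] d) _).symm.trans
    ?_
  exact congrArg (fun t => _ ≫ t) (SymmetricCategory.symmetry_assoc _ _ _)

/-- On the summand `F c ⊗ D(J c, d)` the functor acts by composition in `D`; all later computations
with `lan` use only this and `isCoend_lan`. -/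
theorem lanι_act (c : C) (d d' : D) : lanι F J c d ▷ (d ⟶[V] d') ≫ act (lan F J) d d' =
    (α_ _ _ _).hom ≫ F.obj c ◁ eComp V (J.obj c) d d' ≫ lanι F J c d' := by
  have h := congrArg MonoidalClosed.uncurry (ι_colimMap F (nerveObj J d) (nerveObj J d') c)
  have h₁ := (uncurry_eComp _ _).symm.trans (h.trans (MonoidalClosed.uncurry_natural_left _ _))
  have h₂ := h₁.trans (congrArg (fun t => _ ≫ t) (uncurry_eComp _ _))
  refine Eq.trans ?_ (lan_aux _ _ _ _ (natLift (nerveFam J d d')) _ ?_ h₂)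
  · exact congrArg (fun t => _ ≫ t) (MonoidalClosed.uncurry_natural_left _ _)
  · refine (ev_natLift (nerveFam J d d') (op c)).trans ?_
    exact MonoidalClosed.uncurry_curry _

variable {Φ : Set (Weight.{w} V)} {A : Type u₁} [EnrichedCategory V A]

variable {F} in
-- The restricted extension is the composite of `a ↦ D(J -, i a)` with `F * -`. The first preserves
-- `Φ`-limits because limits in `[Cᵒᵖ, V]` are pointwise and each `D(J c, i -)` is continuous; the
-- second does by flatness.
theorem IsFlat.continuous_lan (hF : IsFlat Φ F) (i : EnrichedFunctor V A D)
    (hi : ∀ c, ((RMod.hom V (J.obj c)).restrict i).Continuous Φ) :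
    ((RMod.of (lan F J)).restrict i).Continuous Φ := by
  intro φ hφ S c hc
  have h₁ : (c.map (i.comp V (nerve J))).IsLimit := by
    refine isLimit_map_of_pointwise _ fun e => ?_
    refine (hi e.unop φ hφ S c hc).of_iso ?_
    exact
      { e := fun a => CategoryTheory.Iso.refl _
        act_hom := fun a a' => by
          refine (Category.comp_id _).trans (Eq.trans ?_
            ((congrArg (fun t => t ≫ _) (id_whiskerRight _ _)).trans (Category.id_comp _)).symm)
          refine Eq.symm ((congrArg (fun t => t ≫ _) (MonoidalCategory.whiskerLeft_comp _ _ _)).trans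
            ((Category.assoc _ _ _).trans (congrArg (fun t => _ ≫ t) ?_)))
          exact (ev_natLift (nerveFam J (i.obj a) (i.obj a')) e).trans
            (MonoidalClosed.uncurry_curry _) }
  have h₂ := (isLimV_map_iff _ _ _).1 ((isLimit_map_iff _ _).1 (hF φ hφ _ _ h₁))
  refine h₂.of_iso ?_
  exact
    { e := fun a => CategoryTheory.Iso.refl _
      act_hom := fun a a' => by
        refine (Category.comp_id _).trans (Eq.trans ?_
            ((congrArg (fun t => t ≫ _) (id_whiskerRight _ _)).trans (Category.id_comp _)).symm)
        refine ((congrArg (fun t => t ≫ _) (MonoidalCategory.whiskerLeft_comp _ _ _)).trans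
            ((Category.assoc _ _ _).trans (congrArg (fun t => _ ≫ t) ?_)))
        exact (act_comp_functor (nerve J) (colimFunctor F) _ _).symm }

end Lan

/-! ### Dense functors detect limit cones -/

section Reflection

variable {V : Type u} [Category.{v} V] [MonoidalCategory V]

theorem hom_act_act {B : Type u₁} [EnrichedCategory V B] (W X Y Z : B) :
    eComp V W X Y ▷ (Y ⟶[V] Z) ≫ eComp V W Y Z =
      (α_ _ _ _).hom ≫ (W ⟶[V] X) ◁ eComp V X Y Z ≫ eComp V W X Z :=
  (RMod.hom V W).act_act X Y Z

theorem tensorHom_eComp_unit {B : Type u₁} [EnrichedCategory V B] {P : V} {X Y Z : B}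
    (u : 𝟙_ V ⟶ (X ⟶[V] Y)) (p : P ⟶ (Y ⟶[V] Z)) :
    (u ⊗ₘ p) ≫ eComp V X Y Z = (λ_ P).hom ≫ p ≫ pre u Z := by
  rw [pre, leftUnitor_inv_naturality_assoc, Iso.hom_inv_id_assoc,
    MonoidalCategory.tensorHom_def', Category.assoc]

theorem IsCoend.comp_iso {D : Type w} [EnrichedCategory V D] {F : RMod (V := V) D} {G : D → V}
    {l : ∀ d d' : D, (d ⟶[V] d') ⊗ G d' ⟶ G d} {Q Q' : V} {q : ∀ d, F.obj d ⊗ G d ⟶ Q}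
    (hq : IsCoend F l q) (e : Q ⟶ Q') [IsIso e] : IsCoend F l (fun d => q d ≫ e) := by
  refine ⟨hq.balanced.postcomp e, fun Z h hh => ?_⟩
  obtain ⟨f, hf, hu⟩ := hq.existsUnique Z h hh
  refine ⟨inv e ≫ f, fun d => by simp [hf], fun g hg => ?_⟩
  rw [IsIso.eq_inv_comp]
  exact hu _ fun d => by simpa using hg d

variable [SymmetricCategory V] [MonoidalClosed V]

theorem IsCoend.of_toFunctor {D : Type w} [EnrichedCategory V D] {M : RMod (V := V) D} {G : D → V}
    {l : ∀ d d' : D, (d ⟶[V] d') ⊗ G d' ⟶ G d} {Q : V} {q : ∀ d, M.obj d ⊗ G d ⟶ Q}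
    (hq : IsCoend (RMod.of M.toFunctor) l q) : IsCoend M l q := by
  have hb {Z : V} (h : ∀ d, M.obj d ⊗ G d ⟶ Z) :
      Balanced (RMod.of M.toFunctor) l h ↔ Balanced M l h :=
    forall₂_congr fun d d' => Eq.congr
      (congrArg (fun t => t ▷ G d' ≫ h d') (act_toFunctor M d d')) rfl
  exact ⟨(hb _).1 hq.balanced, fun Z h hh => hq.existsUnique Z h ((hb h).2 hh)⟩

variable {D : Type w} [EnrichedCategory V D] {B : Type u₁} [EnrichedCategory V B]
  {T : Type u₂} [EnrichedCategory V T] {j : EnrichedFunctor V T B}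

theorem IsDense.hom_ext (hj : IsDense j) {X Z : B} {W : V} {f g : W ⟶ (Z ⟶[V] X)}
    (h : ∀ t, f ▷ _ ≫ eComp V Z X (j.obj t) = g ▷ _ ≫ eComp V Z X (j.obj t)) : f = g :=
  (hj X Z W _ ((RMod.isHom_hom g).restrict j)).unique h fun _ => rfl

theorem eComp_cone_aux {F W : V} {X C R Y : B} (f : W ⟶ (X ⟶[V] C)) (p : F ⟶ (C ⟶[V] R)) :
    ((f ⊗ₘ p) ≫ eComp V X C R) ▷ _ ≫ eComp V X R Y =
      (α_ _ _ _).hom ≫ W ◁ (p ▷ _ ≫ eComp V C R Y) ≫ f ▷ _ ≫ eComp V X C Y := by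
  rw [comp_whiskerRight_assoc, hom_act_act, whisker_exchange_assoc, MonoidalCategory.tensorHom_def]
  simp

theorem balanced_lhom_aux {F H F' W : V} {X R R' Y : B} (a : F ⊗ H ⟶ F')
    (θ : W ⊗ F ⟶ (X ⟶[V] R)) (θ' : W ⊗ F' ⟶ (X ⟶[V] R')) (r : H ⟶ (R ⟶[V] R'))
    (h : (α_ _ _ _).hom ≫ W ◁ a ≫ θ' = θ ▷ H ≫ _ ◁ r ≫ eComp V X R R') :
    W ◁ a ▷ _ ≫ (α_ _ _ _).inv ≫ θ' ▷ _ ≫ eComp V X R' Y =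
      W ◁ ((α_ _ _ _).hom ≫ F ◁ (r ▷ _ ≫ eComp V R R' Y)) ≫ (α_ _ _ _).inv ≫ θ ▷ _ ≫
        eComp V X R Y := by
  rw [← Iso.eq_inv_comp] at h
  rw [associator_inv_naturality_middle_assoc, ← comp_whiskerRight_assoc, h]
  simp only [comp_whiskerRight, Category.assoc, hom_act_act]
  rw [MonoidalCategory.whiskerLeft_comp_assoc W, associator_inv_naturality_right_assoc,
    whisker_exchange_assoc]
  simp

theorem isHom_lhom_aux {F W T : V} {X C R Y Y' : B} (q : F ⊗ (R ⟶[V] Y) ⟶ (C ⟶[V] Y))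
    (q' : F ⊗ (R ⟶[V] Y') ⟶ (C ⟶[V] Y')) (s : W ⊗ (C ⟶[V] Y) ⟶ (X ⟶[V] Y))
    (s' : W ⊗ (C ⟶[V] Y') ⟶ (X ⟶[V] Y')) (m : T ⟶ (Y ⟶[V] Y')) (θ : W ⊗ F ⟶ (X ⟶[V] R))
    (hq : q ▷ _ ≫ eComp V C Y Y' = (α_ _ _ _).hom ≫ F ◁ eComp V R Y Y' ≫ q')
    (hs : W ◁ q ≫ s = (α_ _ _ _).inv ≫ θ ▷ _ ≫ eComp V X R Y)
    (hs' : W ◁ q' ≫ s' = (α_ _ _ _).inv ≫ θ ▷ _ ≫ eComp V X R Y') :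
    (W ◁ q) ▷ T ≫ (α_ _ _ _).hom ≫ W ◁ (_ ◁ m ≫ eComp V C Y Y') ≫ s' =
      (W ◁ q) ▷ T ≫ s ▷ T ≫ _ ◁ m ≫ eComp V X Y Y' := by
  rw [← comp_whiskerRight_assoc, hs]
  have e : W ◁ q ▷ T ≫ W ◁ (_ ◁ m ≫ eComp V C Y Y') ≫ s' =
      W ◁ (_ ◁ m ≫ (α_ _ _ _).hom ≫ F ◁ eComp V R Y Y') ≫ W ◁ q' ≫ s' := by
    rw [← MonoidalCategory.whiskerLeft_comp_assoc, ← MonoidalCategory.whiskerLeft_comp_assoc,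
      ← whisker_exchange_assoc, hq]
    simp
  rw [associator_naturality_middle_assoc, e, hs']
  simp only [comp_whiskerRight, Category.assoc, MonoidalCategory.whiskerLeft_comp]
  rw [← whisker_exchange_assoc, ← whisker_exchange_assoc, hom_act_act,
    associator_inv_naturality_right_assoc, whisker_exchange_assoc]
  simp

/-- A cone is a limit if the functors `B(-, j t)` send it to a colimit. -/
theorem IsDense.isLimit_of_isCoend (hj : IsDense j) {F : EnrichedFunctor V D V}
    {R : EnrichedFunctor V D B} (c : WCone F R)
    (hc : ∀ t, IsCoend (RMod.of F) (lhom R (j.obj t))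
      (fun d => c.π d ▷ _ ≫ eComp V c.pt (R.obj d) (j.obj t))) : c.IsLimit := by
  refine (isLimit_iff_isLimV c).2 fun X W θ hθ => ?_
  -- A family `θ` induces, through the coend at each `t`, a map `W ⊗ B(c.pt, j t) ⟶ B(X, j t)`.
  -- These are natural in `t`, so density turns them into the wanted `W ⟶ B(X, c.pt)`.
  choose σ hσ hu using fun t => (hc t).existsUnique_left (P := W)
    (fun d => (α_ _ _ _).inv ≫ θ d ▷ _ ≫ eComp V X (R.obj d) (j.obj t)) (by
      intro d d'
      have h := hθ d d'
      exact balanced_lhom_aux _ _ _ _ h)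
  have hnat : RMod.IsHom W (nerveMod j c.pt) (nerveMod j X) σ := by
    intro t t'
    refine (hc t).hom_ext_middle fun d => ?_
    refine isHom_lhom_aux _ _ _ _ (j.map t t') (θ d) ?_ (hσ t d) (hσ t' d)
    rw [comp_whiskerRight_assoc, hom_act_act, associator_naturality_left_assoc,
      whisker_exchange_assoc]
  have hcond (f : W ⟶ (X ⟶[V] c.pt)) :
      (∀ d, (f ⊗ₘ c.π d) ≫ eComp V X c.pt (R.obj d) = θ d) ↔
        ∀ t, f ▷ _ ≫ eComp V X c.pt (j.obj t) = σ t := by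
    constructor
    · intro hf t
      refine hu t _ fun d => ?_
      rw [← hf, eComp_cone_aux, Iso.inv_hom_id_assoc]
    · intro hf d
      refine hj.hom_ext fun t => ?_
      rw [eComp_cone_aux, hf]
      refine (congrArg (fun s => (α_ _ _ _).hom ≫ s) (hσ t d)).trans (Iso.hom_inv_id_assoc _ _)
  obtain ⟨f, hf, hu'⟩ := hj c.pt X W σ hnat
  exact ⟨f, (hcond f).2 hf, fun g hg => hu' g ((hcond g).1 hg)⟩

/-- Limits are unique up to isomorphism. The comparison is recorded through the invertible maps `pre
u`, ready for transporting coend formulas from one limit cone to another. -/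
theorem WCone.IsLimit.exists_pre {F : EnrichedFunctor V D V} {S : EnrichedFunctor V D B}
    {c c' : WCone F S} (hc : c.IsLimit) (hc' : c'.IsLimit) :
    ∃ u : 𝟙_ V ⟶ (c.pt ⟶[V] c'.pt), (∀ Z, IsIso (pre u Z)) ∧
      ∀ d, c'.π d ≫ pre u (S.obj d) = c.π d := by
  have key {c c' : WCone F S} (hc' : c'.IsLimit) : ∃ u : 𝟙_ V ⟶ (c.pt ⟶[V] c'.pt),
      ∀ d, c'.π d ≫ pre u (S.obj d) = c.π d := by
    have h := isHom_proj c (RMod.hom V c.pt) (eId V c.pt)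
    obtain ⟨u, hu, -⟩ := (isLimit_iff_isLimV c').1 hc' c.pt _ _ h
    refine ⟨u, fun d => ?_⟩
    have := hu d
    beta_reduce at this
    rw [tensorHom_eComp_unit, tensorHom_eComp_unit, pre_eId, cancel_epi] at this
    simpa using this
  have hext {c : WCone F S} (hc : c.IsLimit) (w : 𝟙_ V ⟶ (c.pt ⟶[V] c.pt))
      (hw : ∀ d, c.π d ≫ pre w (S.obj d) = c.π d) : w = eId V c.pt := by
    refine ((isLimit_iff_isLimV c).1 hc c.pt).hom_ext fun d => ?_
    rw [tensorHom_eComp_unit, tensorHom_eComp_unit, hw, pre_eId, Category.comp_id]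
  obtain ⟨u, hu⟩ := key (c := c) hc'
  obtain ⟨u', hu'⟩ := key (c := c') hc
  refine ⟨u, fun Z => RMod.isIso_pre u u' (hext hc _ fun d => ?_) (hext hc' _ fun d => ?_) Z, hu⟩
  · rw [← pre_pre, reassoc_of% hu', hu]
  · rw [← pre_pre, reassoc_of% hu, hu']

/-- The functor `j` presents `B` as the opposite of the `V`-category of `Φ`-continuous functors on
its domain. -/
structure Presents (Φ : Set (Weight.{w} V)) (j : EnrichedFunctor V T B) : Prop where
  dense : IsDense j
  continuous : ∀ X, (nerveMod j X).Continuous Φ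
  exists_iso : ∀ M : RMod (V := V) T, M.Continuous Φ → ∃ X, Nonempty (RMod.Iso M (nerveMod j X))

end Reflection

/-! ### Flat colimits are computed on `T`, and presentable objects preserve the canonical ones -/

section Presentable

variable {V : Type u} [Category.{v} V] [MonoidalCategory V] [SymmetricCategory V]
  [MonoidalClosed V] [Limits.HasLimits V] [Limits.HasColimits V]

variable {Φ : Set (Weight.{w} V)} {B : Type u₁} [EnrichedCategory V B]
  {T : Type u₂} [EnrichedCategory V T] {j : EnrichedFunctor V T B}

/-- The pointwise coend `∫ᵈ F d ⊗ B(R d, j t)` is continuous in `t` by flatness, so it is `B(X, j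
t)` for some `X`. By construction the resulting cone with vertex `X` is sent to coends by each `B(-,
j t)`, so it is a limit; the given limit is isomorphic to it. -/
theorem Presents.isCoend_of_isLimit (hj : Presents Φ j) {D : Type v} [EnrichedCategory V D]
    {F : EnrichedFunctor V D V} (hF : IsFlat Φ F) {R : EnrichedFunctor V D B} (c : WCone F R)
    (hc : c.IsLimit) (t : T) : IsCoend (RMod.of F) (lhom R (j.obj t))
      (fun d => c.π d ▷ _ ≫ eComp V c.pt (R.obj d) (j.obj t)) := by
  obtain ⟨X, ⟨e⟩⟩ := hj.exists_iso _ (hF.continuous_lan R j fun d => hj.continuous (R.obj d))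
  have hq (t : T) := (isCoend_lan F R (j.obj t)).comp_iso (e.e t).hom
  have hnat (d : D) : RMod.IsHom (F.obj d) (nerveMod j (R.obj d)) (nerveMod j X)
      (fun t => lanι F R d (j.obj t) ≫ (e.e t).hom) := by
    refine RMod.IsHom.comp_iso (N := (RMod.of (lan F R)).restrict j) ?_ e
    refine RMod.IsHom.restrict (M := RMod.hom V (R.obj d)) (N := RMod.of (lan F R)) ?_ j
    intro b b'
    exact (lanι_act F R d b b').symm
  -- The coprojections `F d ⊗ B(R d, j t) ⟶ B(X, j t)` are natural in `t`, so by density they come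
  -- from morphisms `F d ⟶ B(X, R d)`.
  choose π hπ using fun d => (hj.dense (R.obj d) X (F.obj d) _ (hnat d)).exists
  let c' : WCone F R :=
    { pt := X
      π := π
      naturality := fun d d' => hj.dense.hom_ext fun t => by
        have h := (hq t).balanced d d'
        have h₁ := hπ d t
        have h₂ := hπ d' t
        beta_reduce at h h₁ h₂
        rw [← h₁, ← h₂] at h
        rw [comp_whiskerRight_assoc]
        exact h.trans (eComp_cone_aux (π d) (R.map d d')).symm }
  have hc' : ∀ t, IsCoend (RMod.of F) (lhom R (j.obj t))
      (fun d => c'.π d ▷ _ ≫ eComp V c'.pt (R.obj d) (j.obj t)) := by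
    intro t
    refine (isCoend_congr (fun _ _ => rfl) fun d => ?_).1 (hq t)
    exact (hπ d t).symm
  obtain ⟨u, hu, hu'⟩ := hc.exists_pre (hj.dense.isLimit_of_isCoend c' hc')
  have := hu (j.obj t)
  refine (isCoend_congr (fun _ _ => rfl) fun d => ?_).1 ((hc' t).comp_iso (pre u (j.obj t)))
  rw [← hu' d, Category.assoc, eComp_pre, comp_whiskerRight_assoc]

theorem Presents.isPresentable {K : Type u₁} [EnrichedCategory V K] {j : EnrichedFunctor V T Kᵒᵖ}
    (hj : Presents Φ j) (t : T) : IsPresentable Φ (j.obj t).unop :=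
  (isPresentable_iff Φ).2 fun _ _ _ hF _ c hc => hj.isCoend_of_isLimit hF c hc t

/-- The weight `B(X, j -)` is continuous, hence flat by assumption. Density exhibits `X` as the
limit of `j` with this weight, that is, as a flat colimit in `K`, and the presentable object `k`
preserves it. -/
theorem Presents.isCoend_comp {K : Type u₁} [EnrichedCategory V K] {T : Type v}
    [EnrichedCategory V T] {j : EnrichedFunctor V T Kᵒᵖ} (hj : Presents Φ j)
    (hΦ : ContinuousFlat Φ) (hT : IsComplete T Φ) (X k : Kᵒᵖ) (hk : IsPresentable Φ k.unop) :
    IsCoend (nerveMod j X) (lhom j k) (fun t => eComp V X (j.obj t) k) := by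
  let F := (nerveMod j X).toFunctor
  have hF : IsFlat Φ F := by
    refine hΦ T hT F ?_
    rw [isContinuous_iff, RMod.of_toFunctor]
    exact hj.continuous X
  have hact (s t : T) : act F s t = (nerveMod j X).act s t := act_toFunctor _ _ _
  let c : WCone F j :=
    { pt := X
      -- The value of the weight at `t` is `B(X, j t)` itself, so the canonical projections are
      -- identities.
      π := fun t => 𝟙 (X ⟶[V] j.obj t)
      naturality := fun s t => by
        refine ((Category.comp_id _).trans (hact s t)).trans ?_
        exact (congrArg (fun m => m ≫ eComp V X (j.obj s) (j.obj t)) (id_tensorHom _ _)).symm }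
  have hc : c.IsLimit := by
    refine (isLimit_iff_isLimV c).2 fun Z W θ hθ => ?_
    have hθ' : RMod.IsHom W (nerveMod j X) (nerveMod j Z) θ := fun s t =>
      (congrArg (fun m => (α_ _ _ _).hom ≫ W ◁ m ≫ θ t) (hact s t)).symm.trans (hθ s t)
    refine (existsUnique_congr fun f => forall_congr' fun t => ?_).1 (hj.dense X Z W θ hθ')
    refine Eq.congr ?_ rfl
    exact congrArg (fun s => s ≫ eComp V Z X (j.obj t)) (tensorHom_id f _).symm
  refine IsCoend.of_toFunctor ((isCoend_congr (fun _ _ => rfl) fun t => ?_).1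
    ((isPresentable_iff Φ).1 hk T F hF j c hc))
  exact (congrArg (fun s => s ≫ eComp V X (j.obj t) k) (id_whiskerRight _ _)).trans
    (Category.id_comp _)

end Presentable

/-! ### Absolutely dense functors and the co-Yoneda lemma -/

section Absolute

variable {V : Type u} [Category.{v} V] [MonoidalCategory V]

/-- The action of the identity of `c` is a unitor, so `act c c` is an epimorphism. -/
theorem RMod.cancel_act {C : Type u₁} [EnrichedCategory V C] (M : RMod (V := V) C) {c : C} {Z : V}
    {f g : M.obj c ⟶ Z} (h : M.act c c ≫ f = M.act c c ≫ g) : f = g := by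
  have e := M.act_id c
  rw [← cancel_epi (ρ_ (M.obj c)).hom, ← e, Category.assoc, Category.assoc, h]

variable {A : Type u₁} [EnrichedCategory V A] {T : Type u₂} [EnrichedCategory V T]

/-- The functor `p` is absolutely dense: `A(X, p -) ⊗ A(p -, k)` has coend `A(X, k)`. -/
def IsAbsolutelyDense (p : EnrichedFunctor V T A) : Prop :=
  ∀ X k, IsCoend (nerveMod p X) (lhom p k) (fun t => eComp V X (p.obj t) k)

theorem whiskerLeft_eComp_eId (M : V) (X k : A) {Z : V} (h : M ⊗ (X ⟶[V] k) ⟶ Z) :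
    (ρ_ _).inv ≫ _ ◁ eId V k ≫ (α_ _ _ _).hom ≫ M ◁ eComp V X k k ≫ h = h := by
  have e : (ρ_ (M ⊗ (X ⟶[V] k))).inv ≫ _ ◁ eId V k ≫ (α_ _ _ _).hom =
      M ◁ ((ρ_ _).inv ≫ _ ◁ eId V k) := by
    simp
  rw [reassoc_of% e, ← MonoidalCategory.whiskerLeft_comp_assoc, Category.assoc, e_comp_id,
    MonoidalCategory.whiskerLeft_id, Category.id_comp]

variable {p : EnrichedFunctor V T A}

theorem balanced_act (p : EnrichedFunctor V T A) (M : RMod (V := V) A) (k : A) :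
    Balanced (M.restrict p) (lhom p k) (fun t => M.act (p.obj t) k) := by
  intro s t
  have h := M.act_act (p.obj s) (p.obj t) k
  simp only [comp_whiskerRight, Category.assoc, h, MonoidalCategory.whiskerLeft_comp]
  simp

variable [MonoidalClosed V]

/-- The co-Yoneda lemma for an absolutely dense functor. -/
theorem IsAbsolutelyDense.isCoend_act (hp : IsAbsolutelyDense p) (M : RMod (V := V) A) (k : A) :
    IsCoend (M.restrict p) (lhom p k) (fun t => M.act (p.obj t) k) := by
  refine ⟨balanced_act p M k, fun Z h hh => ?_⟩
  -- For every `X` the coend for `A(X, k)` gives `H X : M X ⊗ A(X, k) ⟶ Z`, defined on `M X ⊗ A(X, p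
  -- t) ⊗ A(p t, k)` by acting on `M X` and applying `h t`.
  choose H hH using fun X => ((hp X k).existsUnique_left (P := M.obj X)
    (fun t => (α_ _ _ _).inv ≫ M.act X (p.obj t) ▷ _ ≫ h t) (by
      intro s t
      have e : M.obj X ◁ ((X ⟶[V] p.obj s) ◁ p.map s t ≫ eComp V X (p.obj s) (p.obj t)) ≫
          M.act X (p.obj t) = (α_ _ _ _).inv ≫ M.act X (p.obj s) ▷ _ ≫
            (M.restrict p).act s t := by
        rw [Iso.eq_inv_comp, ← whisker_exchange_assoc, M.act_act]
        simp
      rw [associator_inv_naturality_middle_assoc, ← comp_whiskerRight_assoc, e]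
      have := hh s t
      simp only [comp_whiskerRight, Category.assoc] at this ⊢
      rw [this, MonoidalCategory.whiskerLeft_comp_assoc (M.obj X), associator_inv_naturality_right_assoc,
        whisker_exchange_assoc]
      simp)).exists
  replace hH (X : A) (t : T) : M.obj X ◁ eComp V X (p.obj t) k ≫ H X =
    (α_ (M.obj X) (X ⟶[V] p.obj t) _).inv ≫ M.act X (p.obj t) ▷ _ ≫ h t := hH X t
  have hassoc (X Y : A) : M.act X Y ▷ _ ≫ H Y = (α_ _ _ _).hom ≫ _ ◁ eComp V X Y k ≫ H X := by
    refine (hp Y k).hom_ext_left fun t => ?_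
    have e : (M.obj X ⊗ (X ⟶[V] Y)) ◁ eComp V Y (p.obj t) k ≫ (α_ _ _ _).hom ≫
        _ ◁ eComp V X Y k = (α_ _ _ _).inv ≫ ((α_ _ _ _).hom ≫ _ ◁ eComp V X Y (p.obj t)) ▷ _ ≫
          (α_ _ _ _).hom ≫ _ ◁ eComp V X (p.obj t) k := by
      have h := hom_act_act (V := V) X Y (p.obj t) k
      rw [← Iso.inv_comp_eq] at h
      have h' := congrArg (fun m => M.obj X ◁ m) h
      simp only [MonoidalCategory.whiskerLeft_comp] at h'
      simp [h']
    rw [reassoc_of% e, hH, whisker_exchange_assoc, hH, associator_inv_naturality_left_assoc]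
    have := M.act_act X Y (p.obj t)
    rw [← comp_whiskerRight_assoc, this]
    simp
  have hH' (s : T) : H (p.obj s) = h s := by
    have e := congrArg (fun m => M.obj (p.obj s) ◁ m) (e_id_comp V (p.obj s) k)
    have e' := congrArg (fun m => m ▷ (p.obj s ⟶[V] k)) (M.act_id (p.obj s))
    simp only [MonoidalCategory.whiskerLeft_comp, MonoidalCategory.whiskerLeft_id,
      comp_whiskerRight] at e e'
    rw [← Category.id_comp (H _), ← e, Category.assoc, Category.assoc, hH,
      associator_inv_naturality_middle_assoc, reassoc_of% e']
    simp
  -- The factorisation inserts the identity of `k` in `H k`. It extends `h` because `H` is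
  -- compatible with the action (`hassoc`) and agrees with `h` on the objects `p s` (`hH'`).
  refine ⟨(ρ_ _).inv ≫ _ ◁ eId V k ≫ H k, fun t => ?_, fun g hg => M.cancel_act ?_⟩
  · rw [rightUnitor_inv_naturality_assoc, ← whisker_exchange_assoc, hassoc, hH']
    exact whiskerLeft_eComp_eId _ _ _ _
  · refine (hp k k).hom_ext_left fun t => ?_
    have e := M.act_act k (p.obj t) k
    rw [← Iso.inv_comp_eq] at e
    have hk : M.act k k ≫ (ρ_ _).inv ≫ M.obj k ◁ eId V k ≫ H k = H k := by
      rw [rightUnitor_inv_naturality_assoc, ← whisker_exchange_assoc, hassoc]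
      exact whiskerLeft_eComp_eId _ _ _ _
    rw [hk, hH, ← reassoc_of% e, hg]

variable [SymmetricCategory V]

/-- A family natural over an absolutely dense subcategory is uniquely determined. -/
theorem IsAbsolutelyDense.isHom_ext (hp : IsAbsolutelyDense p) {M N : RMod (V := V) A} {W : V}
    {σ τ : ∀ k, W ⊗ M.obj k ⟶ N.obj k} (hσ : RMod.IsHom W M N σ) (hτ : RMod.IsHom W M N τ)
    (h : ∀ t, σ (p.obj t) = τ (p.obj t)) (k : A) : σ k = τ k := by
  refine (hp.isCoend_act M k).hom_ext_left fun t => ?_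
  rw [← cancel_epi (α_ _ _ _).hom, hσ, hτ, h]

/-- By co-Yoneda `M k` is a coend of `M (p t) ⊗ A(p t, k)`, on which `σ t` followed by the action of
`N` defines `τ k`. With `isHom_ext` this says that restriction along `p` is fully faithful on
modules. -/
theorem IsAbsolutelyDense.exists_isHom (hp : IsAbsolutelyDense p) {M N : RMod (V := V) A} {W : V}
    {σ : ∀ t, W ⊗ M.obj (p.obj t) ⟶ N.obj (p.obj t)}
    (hσ : RMod.IsHom W (M.restrict p) (N.restrict p) σ) :
    ∃ τ : ∀ k, W ⊗ M.obj k ⟶ N.obj k, RMod.IsHom W M N τ ∧ ∀ t, τ (p.obj t) = σ t := by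
  choose τ hτ using fun k => ((hp.isCoend_act M k).existsUnique_left (P := W)
    (fun t => (α_ _ _ _).inv ≫ σ t ▷ _ ≫ N.act (p.obj t) k) (by
      intro s t
      have h := hσ s t
      have h' := balanced_act p N k s t
      rw [← Iso.eq_inv_comp] at h
      rw [associator_inv_naturality_middle_assoc, ← comp_whiskerRight_assoc, h]
      simp only [comp_whiskerRight, Category.assoc] at h' ⊢
      rw [h', MonoidalCategory.whiskerLeft_comp_assoc W, associator_inv_naturality_right_assoc,
        whisker_exchange_assoc]
      simp)).exists
  replace hτ (k : A) (t : T) : W ◁ M.act (p.obj t) k ≫ τ k =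
    (α_ W (M.obj (p.obj t)) _).inv ≫ σ t ▷ _ ≫ N.act (p.obj t) k := hτ k t
  refine ⟨τ, fun k k' => ?_, fun t => ?_⟩
  · refine (hp.isCoend_act M k).hom_ext_middle fun t => ?_
    have h := M.act_act (p.obj t) k k'
    rw [associator_naturality_middle_assoc, ← MonoidalCategory.whiskerLeft_comp_assoc W, h,
      ← comp_whiskerRight_assoc, hτ]
    simp only [comp_whiskerRight, Category.assoc, MonoidalCategory.whiskerLeft_comp]
    rw [hτ, N.act_act, associator_inv_naturality_right_assoc, whisker_exchange_assoc]
    simp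
  · have e : W ◁ (M.obj (p.obj t) ◁ eId V (p.obj t)) ≫ W ◁ M.act (p.obj t) (p.obj t) =
        W ◁ (ρ_ (M.obj (p.obj t))).hom := by
      rw [← MonoidalCategory.whiskerLeft_comp, M.act_id]
    rw [← cancel_epi (W ◁ (ρ_ (M.obj (p.obj t))).hom), ← e, Category.assoc, hτ,
      associator_inv_naturality_right_assoc, whisker_exchange_assoc, N.act_id, e]
    simp

variable {L : Type u₃} [EnrichedCategory V L] {E : EnrichedFunctor V A L}

/-- Compatibility with all of `L` follows from compatibility between objects coming from `T`:
co-Yoneda is applied first to the `A`-module `L(E (p t), E -)`, which frees the target, and then to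
`M` restricted along `E`, which frees the source. -/
theorem IsAbsolutelyDense.natural_of_natural (hp : IsAbsolutelyDense p) {M N : RMod (V := V) L}
    {W : V} {τ : ∀ k : A, W ⊗ M.obj (E.obj k) ⟶ N.obj (E.obj k)}
    (hτ : RMod.IsHom W (M.restrict E) (N.restrict E) τ)
    (h : ∀ s t, (α_ _ _ _).hom ≫ W ◁ M.act (E.obj (p.obj s)) (E.obj (p.obj t)) ≫ τ (p.obj t) =
      τ (p.obj s) ▷ _ ≫ N.act (E.obj (p.obj s)) (E.obj (p.obj t))) (k k' : A) :
    (α_ _ _ _).hom ≫ W ◁ M.act (E.obj k) (E.obj k') ≫ τ k' =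
      τ k ▷ _ ≫ N.act (E.obj k) (E.obj k') := by
  have hE (M : RMod (V := V) L) (Y : L) (s k : A) : M.obj Y ◁ ((Y ⟶[V] E.obj s) ◁ E.map s k ≫
      eComp V Y (E.obj s) (E.obj k)) ≫ M.act Y (E.obj k) =
        (α_ _ _ _).inv ≫ M.act Y (E.obj s) ▷ _ ≫ (M.restrict E).act s k := by
    rw [Iso.eq_inv_comp, ← whisker_exchange_assoc, M.act_act]
    simp
  have hE' (M : RMod (V := V) L) (s k : A) (Y : L) : (M.restrict E).act s k ▷ _ ≫ M.act (E.obj k) Y =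
      (α_ _ _ _).hom ≫ M.obj (E.obj s) ◁ (E.map s k ▷ _ ≫ eComp V _ (E.obj k) Y) ≫
        M.act (E.obj s) Y := by
    simp only [comp_whiskerRight, Category.assoc, M.act_act]
    simp
  have hτ' (s k : A) : W ◁ (M.restrict E).act s k ≫ τ k =
      (α_ W (M.obj (E.obj s)) _).inv ≫ τ s ▷ _ ≫ (N.restrict E).act s k := by
    rw [Iso.eq_inv_comp]
    exact hτ s k
  -- Source still in the image of `p`, target arbitrary.
  have key (t : T) (k : A) :
      (α_ _ _ _).hom ≫ W ◁ M.act (E.obj (p.obj t)) (E.obj k) ≫ τ k =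
        τ (p.obj t) ▷ _ ≫ N.act (E.obj (p.obj t)) (E.obj k) := by
    refine (hp.isCoend_act ((RMod.hom V (E.obj (p.obj t))).restrict E) k).hom_ext_left fun s => ?_
    rw [associator_naturality_right_assoc, ← MonoidalCategory.whiskerLeft_comp_assoc W, hE,
      whisker_exchange_assoc, hE]
    have hst := h t s
    rw [← Iso.eq_inv_comp] at hst
    rw [MonoidalCategory.whiskerLeft_comp_assoc, MonoidalCategory.whiskerLeft_comp_assoc, hτ',
      associator_inv_naturality_middle_assoc, ← comp_whiskerRight_assoc, hst]
    simp
  refine (hp.isCoend_act (M.restrict E) k).hom_ext_middle fun t => ?_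
  rw [associator_naturality_middle_assoc, ← MonoidalCategory.whiskerLeft_comp_assoc W, hE',
    ← comp_whiskerRight_assoc, hτ']
  have hk := key t k'
  rw [← Iso.eq_inv_comp] at hk
  rw [comp_whiskerRight_assoc, comp_whiskerRight_assoc, hE',
    MonoidalCategory.whiskerLeft_comp_assoc W, MonoidalCategory.whiskerLeft_comp_assoc W, hk,
    associator_inv_naturality_right_assoc, whisker_exchange_assoc]
  simp

end Absolute

/-! ### Extending isomorphisms and natural families from `T`; existence of functor `V`-categories -/

section Extension

variable {V : Type u} [Category.{v} V] [MonoidalCategory V] [SymmetricCategory V]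
  [MonoidalClosed V]

variable {A : Type u₁} [EnrichedCategory V A] {T : Type u₂} [EnrichedCategory V T]
  {p : EnrichedFunctor V T A}

/-- Both modules are coends of their restrictions to `T`, so the isomorphism and its inverse extend
along the coends and stay mutually inverse by uniqueness. -/
theorem IsAbsolutelyDense.nonempty_iso (hp : IsAbsolutelyDense p) {M N : RMod (V := V) A}
    (e : RMod.Iso (M.restrict p) (N.restrict p)) : Nonempty (RMod.Iso M N) := by
  have key {M N : RMod (V := V) A} (e : RMod.Iso (M.restrict p) (N.restrict p)) (k : A) :
      ∃ f : M.obj k ⟶ N.obj k, ∀ t, M.act (p.obj t) k ≫ f =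
        (e.e t).hom ▷ _ ≫ N.act (p.obj t) k := by
    refine ((hp.isCoend_act M k).existsUnique _ (fun t => (e.e t).hom ▷ _ ≫ N.act (p.obj t) k)
      fun s t => ?_).exists
    have h := balanced_act p N k s t
    rw [← comp_whiskerRight_assoc, e.act_hom, comp_whiskerRight_assoc]
    refine (congrArg (fun m => _ ≫ m) h).trans ?_
    rw [associator_naturality_left_assoc, whisker_exchange_assoc]
  choose f hf using key e
  choose g hg using key e.symm
  have hg' (k : A) (t : T) : N.act (p.obj t) k ≫ g k = (e.e t).inv ▷ _ ≫ M.act (p.obj t) k :=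
    hg k t
  refine ⟨⟨fun k => ⟨f k, g k, ?_, ?_⟩, fun k k' => ?_⟩⟩
  · refine (hp.isCoend_act M k).hom_ext fun t => ?_
    rw [reassoc_of% hf, hg', ← comp_whiskerRight_assoc, Iso.hom_inv_id]
    simp
  · refine (hp.isCoend_act N k).hom_ext fun t => ?_
    rw [reassoc_of% hg', hf, ← comp_whiskerRight_assoc, Iso.inv_hom_id]
    simp
  · refine (hp.isCoend_act M k).hom_ext_right fun t => ?_
    have h := M.act_act (p.obj t) k k'
    rw [reassoc_of% h, hf, ← comp_whiskerRight_assoc, hf, comp_whiskerRight_assoc, N.act_act,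
      associator_naturality_left_assoc, whisker_exchange_assoc]

variable {L : Type u₃} [EnrichedCategory V L] {E : EnrichedFunctor V A L}

theorem IsAbsolutelyDense.existsUnique_natural (hp : IsAbsolutelyDense p) {M N : RMod (V := V) L}
    {W : V} {σ : ∀ t, W ⊗ M.obj (E.obj (p.obj t)) ⟶ N.obj (E.obj (p.obj t))}
    (h : ∀ s t, (α_ _ _ _).hom ≫ W ◁ M.act (E.obj (p.obj s)) (E.obj (p.obj t)) ≫ σ t =
      σ s ▷ _ ≫ N.act (E.obj (p.obj s)) (E.obj (p.obj t))) :
    ∃! τ : ∀ k : A, W ⊗ M.obj (E.obj k) ⟶ N.obj (E.obj k),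
      (∀ k k', (α_ _ _ _).hom ≫ W ◁ M.act (E.obj k) (E.obj k') ≫ τ k' =
        τ k ▷ _ ≫ N.act (E.obj k) (E.obj k')) ∧ ∀ t, τ (p.obj t) = σ t := by
  have hE {τ : ∀ k : A, W ⊗ M.obj (E.obj k) ⟶ N.obj (E.obj k)} (hτ : ∀ k k', (α_ _ _ _).hom ≫
      W ◁ M.act (E.obj k) (E.obj k') ≫ τ k' = τ k ▷ _ ≫ N.act (E.obj k) (E.obj k')) :
      RMod.IsHom W (M.restrict E) (N.restrict E) τ := by
    intro k k'
    simp only [MonoidalCategory.whiskerLeft_comp, Category.assoc]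
    rw [← associator_naturality_right_assoc, hτ, whisker_exchange_assoc]
  obtain ⟨τ, hτ, hτ'⟩ := hp.exists_isHom (M := M.restrict E) (N := N.restrict E) (σ := σ) (by
    intro s t
    simp only [MonoidalCategory.whiskerLeft_comp, Category.assoc]
    rw [← associator_naturality_right_assoc, ← associator_naturality_right_assoc, h,
      whisker_exchange_assoc, whisker_exchange_assoc])
  refine ⟨τ, ⟨hp.natural_of_natural hτ fun s t => ?_, hτ'⟩, fun τ' h' => funext fun k => ?_⟩
  · rw [hτ', hτ', h]
  · exact hp.isHom_ext (hE h'.1) hτ (fun t => (h'.2 t).trans (hτ' t).symm) k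

/-- The full image of a family of objects. -/
def FullOn (_ : T → L) : Type u₂ := T

instance (f : T → L) : EnrichedCategory V (FullOn f) where
  Hom s t := f s ⟶[V] f t
  id s := eId V (f s)
  comp r s t := eComp V (f r) (f s) (f t)
  id_comp s t := e_id_comp V (f s) (f t)
  comp_id s t := e_comp_id V (f s) (f t)
  assoc q r s t := e_assoc V (f q) (f r) (f s) (f t)

variable (V) in
/-- The inclusion of a full image. -/
def FullOn.incl (f : T → L) : EnrichedFunctor V (FullOn f) L where
  obj t := f t
  map s t := 𝟙 (f s ⟶[V] f t)
  map_id s := Category.comp_id _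
  map_comp r s t := by
    refine (Category.comp_id _).trans (Eq.symm ?_)
    exact (congrArg (· ≫ eComp V (f r) (f s) (f t)) (id_tensorHom_id _ _)).trans
      (Category.id_comp _)

theorem comp_eq_iff_uncurry {W W' X Y : V} (g : W ⟶ W') (a : W' ⟶ (ihom X).obj Y)
    (b : W ⟶ (ihom X).obj Y) : g ≫ a = b ↔ g ▷ X ≫ (β_ _ _).hom ≫ MonoidalClosed.uncurry a =
      (β_ _ _).hom ≫ MonoidalClosed.uncurry b := by
  rw [BraidedCategory.braiding_naturality_left_assoc, cancel_epi,
    ← MonoidalClosed.uncurry_natural_left, MonoidalClosed.uncurry_injective.eq_iff]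

/-- The codomain of `L` need not be small, but a natural family over it amounts to a natural family
over its full image of `T`. The latter is small, and its object of natural transformations exists
since `V` is complete. -/
theorem IsAbsolutelyDense.hasFunctorCategory [Limits.HasLimits V] {T : Type v}
    [EnrichedCategory V T] {p : EnrichedFunctor V T A} (hp : IsAbsolutelyDense p)
    (L : IdOnObjects V A) : HasFunctorCategory V L.Cod V where
  exists_natObj F G := by
    let f (t : T) : L.Cod := p.obj t
    let i := FullOn.incl V f
    let N := natObj (i.comp V F) (i.comp V G)
    let fam := natObjFam (i.comp V F) (i.comp V G)
    have hact (F : EnrichedFunctor V L.Cod V) (s t : T) :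
        act (i.comp V F) s t = act F (f s) (f t) := by
      refine (act_comp_functor i F s t).trans ?_
      exact (congrArg (fun m => m ≫ act F (f s) (f t)) (MonoidalCategory.whiskerLeft_id _ _)).trans
        (Category.id_comp _)
    -- The universal family over the small full image extends to all objects of `L`.
    obtain ⟨τ, hτ, hτ'⟩ : ∃ τ : ∀ X : L.Cod, N ⊗ F.obj X ⟶ G.obj X,
        RMod.IsHom N (RMod.of F) (RMod.of G) τ ∧ ∀ t, τ (f t) = homOfGradedNat fam t := by
      obtain ⟨τ, ⟨hτ, hτ'⟩, -⟩ := hp.existsUnique_natural (E := L.functor) (M := RMod.of F)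
        (N := RMod.of G) (σ := homOfGradedNat fam) (fun s t => by
          have h := isHom_homOfGradedNat fam s t
          refine Eq.trans ?_ (h.trans ?_)
          · exact congrArg (fun m => (α_ _ _ _).hom ≫ N ◁ m ≫ homOfGradedNat fam t)
              (hact F s t).symm
          · exact congrArg (fun m => homOfGradedNat fam s ▷ _ ≫ m) (hact G s t))
      exact ⟨τ, hτ, hτ'⟩
    refine ⟨N, gradedNatOfHom τ hτ, fun W s => ?_⟩
    obtain ⟨g, hg, hu⟩ := natObjFam_isNatObj (i.comp V F) (i.comp V G) W (s.whisker i)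
    have hcond (g : W ⟶ N) : (∀ X, g ≫ (gradedNatOfHom τ hτ).app X = s.app X) ↔
        ∀ t, g ≫ fam.app t = (s.whisker i).app t := by
      have h₁ (X : L.Cod) : g ≫ (gradedNatOfHom τ hτ).app X = s.app X ↔
          g ▷ _ ≫ τ X = homOfGradedNat s X := by
        refine (comp_eq_iff_uncurry _ _ _).trans ?_
        exact Eq.congr (congrArg (fun m => g ▷ _ ≫ m) (homOfGradedNat_ofHom τ hτ X)) rfl
      have h₂ (t : T) : g ≫ fam.app t = (s.whisker i).app t ↔
          g ▷ _ ≫ τ (f t) = homOfGradedNat s (f t) := by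
        refine (comp_eq_iff_uncurry _ _ _).trans ?_
        exact Eq.congr (congrArg (fun m => g ▷ _ ≫ m) (hτ' t).symm) rfl
      refine (forall_congr' h₁).trans (Iff.trans ?_ (forall_congr' h₂).symm)
      refine ⟨fun h t => h _, fun h X => ?_⟩
      exact hp.isHom_ext (M := (RMod.of F).restrict L.functor) (N := (RMod.of G).restrict L.functor)
        ((hτ.reindex g).restrict L.functor) ((isHom_homOfGradedNat s).restrict L.functor) h X
    exact ⟨g, (hcond g).2 hg, fun k hk => hu k ((hcond k).1 hk)⟩

variable (V A) in
/-- The identity `V`-functor, as an identity-on-objects `V`-functor. -/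
def IdOnObjects.refl : IdOnObjects V A where
  hom X Y := X ⟶[V] Y
  id X := eId V X
  comp X Y Z := eComp V X Y Z
  id_comp X Y := e_id_comp V X Y
  comp_id X Y := e_comp_id V X Y
  assoc W X Y Z := e_assoc V W X Y Z
  map X Y := 𝟙 (X ⟶[V] Y)
  map_id X := Category.comp_id _
  map_comp X Y Z := by
    rw [Category.comp_id, id_tensorHom_id, Category.id_comp]

theorem IsAbsolutelyDense.hasFunctorCategory_self [Limits.HasLimits V] {T : Type v}
    [EnrichedCategory V T] {p : EnrichedFunctor V T A} (hp : IsAbsolutelyDense p) :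
    HasFunctorCategory V A V :=
  hp.hasFunctorCategory (IdOnObjects.refl V A)

end Extension

/-! ### Objects with an action of `L` -/

section Actions

variable {V : Type u} [Category.{v} V] [MonoidalCategory V]

variable {A : Type u₁} [EnrichedCategory V A] {B : Type u₂} [EnrichedCategory V B]

/-- An action of `L` on `B(X, ι -)` extending the canonical action of `A`. -/
@[ext]
structure LAction (L : IdOnObjects V A) (ι : EnrichedFunctor V A B) (X : B) where
  /-- the action -/
  act : ∀ k l : L.Cod, (X ⟶[V] ι.obj k) ⊗ (k ⟶[V] l) ⟶ (X ⟶[V] ι.obj l)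
  act_id : ∀ k : L.Cod, (X ⟶[V] ι.obj k) ◁ eId (C := L.Cod) V k ≫ act k k = (ρ_ (X ⟶[V] ι.obj k)).hom
  act_act : ∀ k l m : L.Cod, act k l ▷ (l ⟶[V] m) ≫ act l m =
    (α_ (X ⟶[V] ι.obj k) (k ⟶[V] l) (l ⟶[V] m)).hom ≫ _ ◁ eComp (C := L.Cod) V k l m ≫ act k m
  act_map : ∀ k l : A, (X ⟶[V] ι.obj k) ◁ L.functor.map k l ≫ act k l =
    (X ⟶[V] ι.obj k) ◁ ι.map k l ≫ eComp V X (ι.obj k) (ι.obj l)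

variable {L : IdOnObjects V A} {ι : EnrichedFunctor V A B}

/-- The module over `L` given by an action. -/
abbrev LAction.mod {X : B} (a : LAction L ι X) : RMod (V := V) L.Cod where
  obj k := X ⟶[V] ι.obj k
  act := a.act
  act_id := a.act_id
  act_act := a.act_act

/-- The morphism `f : W ⟶ B(Y, X)` is compatible with actions of `L` on `B(X, ι -)` and
`B(Y, ι -)`. -/
def Equivariant {W : V} {X Y : B} (a : LAction L ι X) (b : LAction L ι Y) (f : W ⟶ (Y ⟶[V] X)) :
    Prop :=
  RMod.IsHom W a.mod b.mod (fun k => f ▷ _ ≫ eComp V Y X (ι.obj k))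

variable [SymmetricCategory V] {K : Type u₂} [EnrichedCategory V K]
  {M : Type u₃} [EnrichedCategory V M]

/-- The `V`-functor `U` presents `M` as the `V`-category of objects `X` of `K` with an action of `L`
on `K(ι -, X)`. -/
structure Algebraic (L : IdOnObjects V A) (ι : EnrichedFunctor V A Kᵒᵖ)
    (U : EnrichedFunctor V M K) where
  /-- the action of `L` -/
  action : ∀ P : M, LAction L ι (op (U.obj P))
  mono_map : ∀ P Q, Mono (U.map P Q)
  lift_iff : ∀ (P Q : M) (W : V) (f : W ⟶ (U.obj P ⟶[V] U.obj Q)),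
    (∃ g, g ≫ U.map P Q = f) ↔ Equivariant (X := op (U.obj P)) (Y := op (U.obj Q)) (action P)
      (action Q) f
  exists_eq : ∀ (X : Kᵒᵖ) (a : LAction L ι X), ∃ P : M,
    (⟨op (U.obj P), action P⟩ : Σ X, LAction L ι X) = ⟨X, a⟩

end Actions

/-! ### Extensions of a functor along an identity-on-objects functor, up to equality of functors -/

section Transport

variable {V : Type u} [Category.{v} V] [MonoidalCategory V] [SymmetricCategory V]
  [MonoidalClosed V]

variable {A : Type u₁} [EnrichedCategory V A] {L : IdOnObjects V A}

/-- An extension of `F` along an identity-on-objects `V`-functor, as a module with the same values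
as `F`. -/
def extMod {F : EnrichedFunctor V A V} {S : EnrichedFunctor V L.Cod V}
    (h : F = L.functor.comp V S) : RMod (V := V) L.Cod where
  obj := F.obj
  act c d := eqToHom (by rw [h]; rfl) ▷ _ ≫ act S c d ≫ eqToHom (by rw [h]; rfl)
  act_id c := by
    subst h
    change _ ≫ 𝟙 _ ▷ _ ≫ act S c c ≫ 𝟙 _ = _
    rw [id_whiskerRight, Category.id_comp, Category.comp_id]
    exact (RMod.of S).act_id c
  act_act c d e := by
    subst h
    change (𝟙 (S.obj c) ▷ _ ≫ act S c d ≫ 𝟙 _) ▷ _ ≫ 𝟙 (S.obj d) ▷ _ ≫ act S d e ≫ 𝟙 _ =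
      _ ≫ _ ≫ 𝟙 (S.obj c) ▷ _ ≫ act S c e ≫ 𝟙 _
    simp only [id_whiskerRight, Category.id_comp, Category.comp_id]
    exact (RMod.of S).act_act c d e

theorem extMod_act {S : EnrichedFunctor V L.Cod V} (c d : L.Cod) :
    (extMod (rfl : L.functor.comp V S = L.functor.comp V S)).act c d = act S c d := by
  change 𝟙 _ ▷ _ ≫ act S c d ≫ 𝟙 _ = _
  simp

theorem extMod_map {F : EnrichedFunctor V A V} {S : EnrichedFunctor V L.Cod V}
    (h : F = L.functor.comp V S) (c d : A) :
    F.obj c ◁ L.functor.map c d ≫ (extMod h).act c d = act F c d := by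
  subst h
  refine (congrArg (fun m => _ ≫ m) (extMod_act c d)).trans ?_
  exact (act_comp_functor L.functor S c d).symm

variable [HasFunctorCategory V A V] [HasFunctorCategory V L.Cod V]

theorem ev_precomp (S S' : EnrichedFunctor V L.Cod V) (c : A) :
    S.obj c ◁ (precomp L.functor).map S S' ≫ ev (L.functor.comp V S) (L.functor.comp V S') c =
      ev S S' c :=
  ev_natLift ((natObjFam S S').whisker L.functor) c

theorem ev_comp_precomp (S S' : EnrichedFunctor V L.Cod V) {W : V} (g : W ⟶ natObj S S') (c : A) :
    S.obj c ◁ (g ≫ (precomp L.functor).map S S') ≫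
      ev (L.functor.comp V S) (L.functor.comp V S') c = S.obj c ◁ g ≫ ev S S' c :=
  (congrArg (fun m => m ≫ ev (L.functor.comp V S) (L.functor.comp V S') c)
    (MonoidalCategory.whiskerLeft_comp _ _ _)).trans ((Category.assoc _ _ _).trans
      (congrArg (fun m => S.obj c ◁ g ≫ m) (ev_precomp S S' c)))

/-- A natural transformation is determined by its components, and an identity-on-objects functor
misses none of them. -/
instance mono_precomp_map (S S' : EnrichedFunctor V L.Cod V) :
    Mono ((precomp L.functor).map S S') where
  right_cancellation g g' h := natObj_ext_ev fun c =>
    (ev_comp_precomp S S' g c).symm.trans ((congrArg (fun m => S.obj c ◁ m ≫ _) h).trans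
      (ev_comp_precomp S S' g' c))

/-- The hom-object in `[L, V]` embeds in the one in `[A, V]`, and a morphism factors through it
exactly when its components respect the larger action. The `eqToHom` is the one in the hom-objects
of the pullback. -/
theorem exists_precomp_iff {F F' : EnrichedFunctor V A V} {S S' : EnrichedFunctor V L.Cod V}
    (h : F = L.functor.comp V S) (h' : F' = L.functor.comp V S') {W : V} (k : W ⟶ natObj F F') :
    (∃ g : W ⟶ natObj S S', g ≫ (precomp L.functor).map S S' ≫
        eqToHom (by rw [h, h']; rfl) = k) ↔
      RMod.IsHom W (extMod h) (extMod h') (fun c => (β_ _ _).hom ≫ F.obj c ◁ k ≫ ev F F' c) := by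
  subst h h'
  have e (σ : ∀ c : L.Cod, W ⊗ S.obj c ⟶ S'.obj c) :
      RMod.IsHom W (extMod (rfl : L.functor.comp V S = L.functor.comp V S))
        (extMod (rfl : L.functor.comp V S' = L.functor.comp V S')) σ ↔
      RMod.IsHom W (RMod.of S) (RMod.of S') σ :=
    forall₂_congr fun c d => Eq.congr
      (congrArg (fun m => (α_ _ _ _).hom ≫ W ◁ m ≫ σ d) (extMod_act c d))
      (congrArg (fun m => σ c ▷ _ ≫ m) (extMod_act c d))
  refine Iff.trans ?_ (e _).symm
  constructor
  · rintro ⟨g, rfl⟩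
    have hg := isHom_homOfGradedNat ((natObjFam S S').reindex g)
    refine Eq.mp (congrArg (RMod.IsHom W (RMod.of S) (RMod.of S')) (funext fun c => ?_)) hg
    refine congrArg (fun m => (β_ _ _).hom ≫ m) ?_
    refine (MonoidalClosed.uncurry_natural_left _ _).trans ((ev_comp_precomp S S' g c).symm.trans ?_)
    exact congrArg (fun m => S.obj c ◁ (g ≫ m) ≫ _) (Category.comp_id _).symm
  · intro hk
    obtain ⟨g, hg, -⟩ := existsUnique_natObj _ hk
    refine ⟨g, natObj_ext_ev fun c => ?_⟩
    refine (congrArg (fun m => S.obj c ◁ (g ≫ m) ≫ _) (Category.comp_id _)).trans ?_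
    refine (ev_comp_precomp S S' g c).trans ((hg c).trans ?_)
    exact SymmetricCategory.symmetry_assoc _ _ _

end Transport

/-! ### Models of the theory are objects with an action of `L` -/

section Models

variable {V : Type u} [Category.{v} V] [MonoidalCategory V] [SymmetricCategory V]
  [MonoidalClosed V]

variable {A : Type u₁} [EnrichedCategory V A] {K : Type u₂} [EnrichedCategory V K]
  {J : EnrichedFunctor V A K} {L : IdOnObjects V Aᵒᵖ}

theorem enrichedFunctor_ext_map {C : Type u₁} [EnrichedCategory V C] {D : Type u₂}
    [EnrichedCategory V D] {o : C → D} {m m' : ∀ X Y : C, (X ⟶[V] Y) ⟶ (o X ⟶[V] o Y)} {h₁ h₂ h₁' h₂'}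
    (h : m = m') : (⟨o, m, h₁, h₂⟩ : EnrichedFunctor V C D) = ⟨o, m', h₁', h₂'⟩ := by
  subst h
  rfl

theorem act_nerveObj (X : K) (c d : Aᵒᵖ) : act (nerveObj J X) c d =
    ((op X) ⟶[V] (opFunctor J).obj c) ◁ (opFunctor J).map c d ≫ eComp V (op X) _ _ :=
  (act_comp_functor (opFunctor J) (homFunctor (op X)) c d).trans
    (congrArg (fun m => _ ≫ m) (act_homFunctor (op X) _ _))

variable [HasFunctorCategory V Aᵒᵖ V] [HasFunctorCategory V L.Cod V]

theorem ev_nerve {W : V} (X Y : K) (f : W ⟶ (X ⟶[V] Y)) (c : Aᵒᵖ) :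
    (β_ W ((nerveObj J X).obj c)).hom ≫ (nerveObj J X).obj c ◁ (f ≫ (nerve J).map X Y) ≫
        ev (nerveObj J X) (nerveObj J Y) c =
      f ▷ _ ≫ eComp V (op Y) (op X) ((opFunctor J).obj c) := by
  have h : (nerveObj J X).obj c ◁ (f ≫ (nerve J).map X Y) ≫ ev (nerveObj J X) (nerveObj J Y) c =
      (nerveObj J X).obj c ◁ f ≫ eComp V (J.obj c.unop) X Y := by
    refine (congrArg (fun m => m ≫ ev (nerveObj J X) (nerveObj J Y) c)
      (MonoidalCategory.whiskerLeft_comp _ _ _)).trans ((Category.assoc _ _ _).trans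
      (congrArg (fun m => _ ≫ m) ?_))
    exact (ev_natLift (nerveFam J X Y) c).trans (MonoidalClosed.uncurry_curry _)
  refine (congrArg (fun m => (β_ _ _).hom ≫ m) h).trans ?_
  exact (BraidedCategory.braiding_naturality_left_assoc f (J.obj c.unop ⟶[V] X) _).symm

/-- The action of `L` associated to a model. -/
def modelAction (P : VPullback (nerve J) (precomp (C := V) L.functor)) :
    LAction L (opFunctor J) (op P.fst) where
  act := (extMod P.eq).act
  act_id := (extMod P.eq).act_id
  act_act := (extMod P.eq).act_act
  act_map k l := (extMod_map P.eq k l).trans (act_nerveObj P.fst k l)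

/-- The pullback demands equality of functors, and an action provides it because its module has the
values `K(J k, X)` themselves. Recovering the pair `(X, a)` on the nose is what makes the comparison
functor surjective on objects. -/
theorem exists_model (X : K) (a : LAction L (opFunctor J) (op X)) :
    ∃ P : VPullback (nerve J) (precomp (C := V) L.functor),
      (⟨op P.fst, modelAction P⟩ : Σ X, LAction L (opFunctor J) X) = ⟨op X, a⟩ := by
  -- The object parts agree by definition; the actions agree by `act_map`.
  have h : nerveObj J X = L.functor.comp V a.mod.toFunctor := by
    have hm : (nerveObj J X).map = fun k l => L.functor.map k l ≫ a.mod.toFunctor.map k l := by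
      funext k l
      apply MonoidalClosed.uncurry_injective
      refine (act_nerveObj X k l).trans ((a.act_map k l).symm.trans ?_)
      refine Eq.trans ?_ (MonoidalClosed.uncurry_natural_left _ _).symm
      exact congrArg (fun m => _ ≫ m) (act_toFunctor a.mod k l).symm
    exact enrichedFunctor_ext_map (C := Aᵒᵖ) (D := V) hm
  refine ⟨⟨X, a.mod.toFunctor, h⟩, ?_⟩
  refine congrArg (Sigma.mk (op X)) ?_
  ext k l
  change 𝟙 _ ▷ _ ≫ VCat.act a.mod.toFunctor k l ≫ 𝟙 _ = _
  rw [id_whiskerRight, Category.id_comp, Category.comp_id]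
  exact act_toFunctor a.mod k l

variable [Limits.HasPullbacks V]

/-- Models of `L` are objects with an action of `L`. -/
theorem nonempty_algebraic_fstFunctor : Nonempty (Algebraic L (opFunctor J)
    (VPullback.fstFunctor (nerve J) (precomp (C := V) L.functor))) := by
  refine ⟨⟨modelAction, fun P Q => ⟨fun g g' h => ?_⟩, fun P Q W f => ?_, fun X a =>
    exists_model X.unop a⟩⟩
  · have h' : g ≫ VPullback.homFst P Q = g' ≫ VPullback.homFst P Q := h
    refine VPullback.hom_ext h' ?_
    -- The pullback condition determines the image of the second component from the first, and
    -- restriction along `L.functor` is monic on homs.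
    have e {W : V} (g : W ⟶ VPullback.hom P Q) :
        (g ≫ VPullback.homSnd P Q) ≫ (precomp L.functor).map P.snd Q.snd =
          g ≫ VPullback.homFst P Q ≫ (nerve J).map P.fst Q.fst ≫
            eqToHom (by rw [P.eq, Q.eq]) := by
      rw [← Category.assoc (VPullback.homFst P Q), VPullback.hom_condition]
      simp [VPullback.homEq]
    rw [← cancel_mono ((precomp L.functor).map P.snd Q.snd), e, e, reassoc_of% h']
  · have e := exists_precomp_iff (L := L) P.eq Q.eq (f ≫ (nerve J).map P.fst Q.fst)
    have e' : RMod.IsHom W (extMod P.eq) (extMod Q.eq) (fun c => (β_ _ _).hom ≫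
        (nerveObj J P.fst).obj c ◁ (f ≫ (nerve J).map P.fst Q.fst) ≫
          ev (nerveObj J P.fst) (nerveObj J Q.fst) c) ↔
        Equivariant (X := op P.fst) (Y := op Q.fst) (modelAction P) (modelAction Q) f :=
      iff_of_eq (congrArg (RMod.IsHom W (extMod P.eq) (extMod Q.eq))
        (funext fun c => ev_nerve P.fst Q.fst f c))
    refine Iff.trans ?_ (e.trans e')
    constructor
    · rintro ⟨g, rfl⟩
      exact ⟨g ≫ VPullback.homSnd P Q, (Category.assoc _ _ _).trans
        ((congrArg (fun m => g ≫ m) (VPullback.hom_condition P Q).symm).trans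
          (Category.assoc _ _ _).symm)⟩
    · rintro ⟨g, hg⟩
      exact ⟨VPullback.homLift f g hg.symm, VPullback.homLift_fst _ _ _⟩

end Models

/-! ### Universal arrows determine an enriched adjunction -/

section UniversalArrows

variable {V : Type u} [Category.{v} V] [MonoidalCategory V]

variable {K : Type u₁} [EnrichedCategory V K] {M : Type u₂} [EnrichedCategory V M]

theorem tensorHom_pre_eComp {W W' : V} {X X' Y Z : K} (a : W ⟶ (X' ⟶[V] Y)) (b : W' ⟶ (Y ⟶[V] Z))
    (h : 𝟙_ V ⟶ (X ⟶[V] X')) :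
    (a ⊗ₘ b) ≫ eComp V X' Y Z ≫ pre h Z = ((a ≫ pre h Y) ⊗ₘ b) ≫ eComp V X Y Z := by
  rw [eComp_pre, MonoidalCategory.tensorHom_def', MonoidalCategory.tensorHom_def']
  simp

theorem tensorHom_post_eComp {W W' : V} {X Y Y' Z : K} (a : W ⟶ (X ⟶[V] Y))
    (b : W' ⟶ (Y' ⟶[V] Z)) (h : 𝟙_ V ⟶ (Y ⟶[V] Y')) :
    ((a ≫ post h X) ⊗ₘ b) ≫ eComp V X Y' Z = (a ⊗ₘ (b ≫ pre h Z)) ≫ eComp V X Y Z := by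
  rw [tensorHom_def', tensorHom_def']
  simp only [comp_whiskerRight, MonoidalCategory.whiskerLeft_comp, Category.assoc]
  rw [post_eComp, ← whisker_exchange_assoc]

/-- The element `η : I ⟶ K(X, U P)` is a universal arrow from `X` to `U`. -/
def IsUniversal (U : EnrichedFunctor V M K) {X : K} {P : M} (η : 𝟙_ V ⟶ (X ⟶[V] U.obj P)) : Prop :=
  ∀ Q, IsIso (U.map P Q ≫ pre η (U.obj Q))

variable {U : EnrichedFunctor V M K} {P : K → M} {η : ∀ X, 𝟙_ V ⟶ (X ⟶[V] U.obj (P X))}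

/-- The transpose of a morphism to a hom-object. -/
def transpose {X : K} {P : M} {η : 𝟙_ V ⟶ (X ⟶[V] U.obj P)} (h : IsUniversal U η) {W : V} {Q : M}
    (f : W ⟶ (X ⟶[V] U.obj Q)) : W ⟶ (P ⟶[V] Q) :=
  have := h Q
  f ≫ inv (U.map P Q ≫ pre η (U.obj Q))

theorem transpose_spec {X : K} {P : M} {η : 𝟙_ V ⟶ (X ⟶[V] U.obj P)} (h : IsUniversal U η) {W : V}
    {Q : M} (f : W ⟶ (X ⟶[V] U.obj Q)) :
    transpose h f ≫ U.map P Q ≫ pre η (U.obj Q) = f := by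
  have := h Q
  rw [transpose, Category.assoc, IsIso.inv_hom_id, Category.comp_id]

theorem IsUniversal.hom_ext {X : K} {P : M} {η : 𝟙_ V ⟶ (X ⟶[V] U.obj P)} (h : IsUniversal U η)
    {W : V} {Q : M} {f g : W ⟶ (P ⟶[V] Q)}
    (hfg : f ≫ U.map P Q ≫ pre η (U.obj Q) = g ≫ U.map P Q ≫ pre η (U.obj Q)) : f = g :=
  have := h Q
  (cancel_mono _).1 hfg

/-- The action of the left adjoint on hom-objects. -/
def transposeMap (h : ∀ X, IsUniversal U (η X)) (X Y : K) : (X ⟶[V] Y) ⟶ (P X ⟶[V] P Y) :=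
  transpose (h X) (post (η Y) X)

theorem transposeMap_spec (h : ∀ X, IsUniversal U (η X)) (X Y : K) :
    transposeMap h X Y ≫ U.map (P X) (P Y) ≫ pre (η X) (U.obj (P Y)) = post (η Y) X :=
  transpose_spec _ _

theorem eId_comp_pre {X Y : K} (f : 𝟙_ V ⟶ (X ⟶[V] Y)) : eId V Y ≫ pre f Y = f := by
  rw [comp_pre, ← comp_post, post_eId, Category.comp_id]

theorem eId_comp_post {X Y : K} (f : 𝟙_ V ⟶ (X ⟶[V] Y)) : eId V X ≫ post f X = f := by
  rw [comp_post, ← comp_pre, pre_eId, Category.comp_id]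

/-- The left adjoint determined by universal arrows. -/
def leftAdjoint (h : ∀ X, IsUniversal U (η X)) : EnrichedFunctor V K M where
  obj := P
  map := transposeMap h
  map_id X := (h X).hom_ext (by
    rw [Category.assoc, transposeMap_spec, EnrichedFunctor.map_id_assoc, eId_comp_post,
      eId_comp_pre])
  map_comp X Y Z := (h X).hom_ext (by
    rw [Category.assoc, transposeMap_spec, Category.assoc, EnrichedFunctor.map_comp_assoc,
      tensorHom_comp_tensorHom_assoc, tensorHom_pre_eComp, Category.assoc, transposeMap_spec,
      ← Category.id_comp (post (η Y) X), tensorHom_post_eComp, Category.assoc, transposeMap_spec,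
      id_tensorHom, eComp_post])

/-- The counit of the adjunction determined by universal arrows. -/
def transposeCounit (h : ∀ X, IsUniversal U (η X)) (Q : M) : 𝟙_ V ⟶ (P (U.obj Q) ⟶[V] Q) :=
  transpose (h (U.obj Q)) (eId V (U.obj Q))

theorem transposeCounit_spec (h : ∀ X, IsUniversal U (η X)) (Q : M) :
    elComp (η (U.obj Q)) (elMap U (transposeCounit h Q)) = eId V (U.obj Q) := by
  rw [← comp_pre, Category.assoc, transposeCounit, transpose_spec]

theorem transposeCounit_naturality (h : ∀ X, IsUniversal U (η X)) (Q R : M) :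
    U.map Q R ≫ transposeMap h (U.obj Q) (U.obj R) ≫ post (transposeCounit h R) (P (U.obj Q)) =
      pre (transposeCounit h Q) R := by
  refine (h (U.obj Q)).hom_ext ?_
  simp only [Category.assoc]
  rw [reassoc_of% post_map U, ← pre_post, reassoc_of% transposeMap_spec h, post_post,
    reassoc_of% pre_map U, pre_pre, transposeCounit_spec h, transposeCounit_spec h, post_eId,
    pre_eId]

theorem transposeCounit_triangle (h : ∀ X, IsUniversal U (η X)) (X : K) :
    elComp (η X ≫ transposeMap h X (U.obj (P X))) (transposeCounit h (P X)) = eId V (P X) := by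
  refine (h X).hom_ext ?_
  rw [← comp_post, Category.assoc, Category.assoc, reassoc_of% post_map U, ← pre_post,
    reassoc_of% transposeMap_spec h, post_post, transposeCounit_spec, post_eId, Category.comp_id,
    EnrichedFunctor.map_id_assoc, eId_comp_pre]

/-- Universal arrows determine an adjunction. -/
def adjunctionOfUniversal (h : ∀ X, IsUniversal U (η X)) : VAdjunction (leftAdjoint h) U where
  unit :=
    { app := η
      naturality := fun X Y => by
        refine (Category.id_comp _).trans ((transposeMap_spec h X Y).symm.trans ?_)
        exact (Category.assoc _ _ _).symm }
  counit :=
    { app := transposeCounit h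
      naturality := fun Q R => (Category.assoc _ _ _).trans
        ((transposeCounit_naturality h Q R).trans (Category.id_comp _).symm) }
  left_triangle := transposeCounit_triangle h
  right_triangle := transposeCounit_spec h

theorem isUniversal_of_existsUnique {X : K} {P : M} {η : 𝟙_ V ⟶ (X ⟶[V] U.obj P)}
    (h : ∀ (Q : M) (W : V) (f : W ⟶ (X ⟶[V] U.obj Q)),
      ∃! g : W ⟶ (P ⟶[V] Q), g ≫ U.map P Q ≫ pre η (U.obj Q) = f) : IsUniversal U η := by
  intro Q
  obtain ⟨g, hg, -⟩ := h Q _ (𝟙 _)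
  refine ⟨g, (h Q _ _).unique (y₁ := _ ≫ g) (y₂ := 𝟙 _) ?_ (Category.id_comp _), hg⟩
  rw [Category.assoc, hg, Category.comp_id]

end UniversalArrows

/-! ### Free actions and their units -/

section FreeActions

variable {V : Type u} [Category.{v} V] [MonoidalCategory V]

variable {A : Type u₁} [EnrichedCategory V A] {B : Type u₂} [EnrichedCategory V B]
  {T : Type u₃} [EnrichedCategory V T] {L : IdOnObjects V A} {ι : EnrichedFunctor V A B}

theorem iso_conj_aux {N N' H P Z W : V} (e : N ≅ P) (m : H ⟶ N') (a : N ⊗ N' ⟶ Z) (z : Z ⟶ W)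
    (r : P ⊗ H ⟶ W) (h : N ◁ m ≫ a ≫ z = e.hom ▷ _ ≫ r) : P ◁ m ≫ e.inv ▷ _ ≫ a ≫ z = r := by
  rw [whisker_exchange_assoc, h, ← comp_whiskerRight_assoc, Iso.inv_hom_id, id_whiskerRight,
    Category.id_comp]

/-- Transport of an `L`-module along isomorphisms. -/
def LAction.ofIso {X : B} (N : RMod (V := V) L.Cod) (e : ∀ k : L.Cod, N.obj k ≅ (X ⟶[V] ι.obj k))
    (h : ∀ k l : A, N.obj k ◁ L.functor.map k l ≫ N.act k l ≫ (e l).hom =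
      (e k).hom ▷ _ ≫ (X ⟶[V] ι.obj k) ◁ ι.map k l ≫ eComp V X (ι.obj k) (ι.obj l)) :
    LAction L ι X where
  act k l := (e k).inv ▷ _ ≫ N.act k l ≫ (e l).hom
  act_id k := by
    have h := N.act_id k
    refine iso_conj_aux _ _ _ _ _ ?_
    rw [reassoc_of% h, rightUnitor_naturality]
  act_act k l m := by
    have h := N.act_act k l m
    have h' : (e l).hom ▷ (l ⟶[V] m) ≫ (e l).inv ▷ (l ⟶[V] m) = 𝟙 _ := by
      rw [← comp_whiskerRight, Iso.hom_inv_id, id_whiskerRight]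
    simp only [comp_whiskerRight, Category.assoc]
    rw [reassoc_of% h', reassoc_of% h, whisker_exchange_assoc, associator_naturality_left_assoc]
  act_map k l := iso_conj_aux _ _ _ _ _ (h k l)

/-- The action `a` is free on `X`, with unit `η`: the action of `L` on the image of `B(X, -)`
exhibits `B(X', ι -)` as a left Kan extension. -/
def IsFree (p : EnrichedFunctor V T A) {X X' : B} (a : LAction L ι X') (η : 𝟙_ V ⟶ (X' ⟶[V] X)) :
    Prop :=
  ∀ k : L.Cod, IsCoend (nerveMod (p.comp V ι) X) (lhom (p.comp V L.functor) k)
    (fun t => pre η (ι.obj (p.obj t)) ▷ _ ≫ a.act (p.obj t) k)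

theorem conj_act_aux {Q N N' P H W : V} (e : N ≅ P) (q : Q ⟶ N) (a : N ⊗ H ⟶ N') (z : N' ⟶ W)
    (r : Q ⊗ H ⟶ N') (h : q ▷ H ≫ a = r) : (q ≫ e.hom) ▷ H ≫ e.inv ▷ H ≫ a ≫ z = r ≫ z := by
  rw [← comp_whiskerRight_assoc, Category.assoc, Iso.hom_inv_id, Category.comp_id, reassoc_of% h]

theorem eId_whiskerRight_eComp {C : Type u₁} [EnrichedCategory V C] {F Z : V} {k l : C}
    (h : F ⊗ (k ⟶[V] l) ⟶ Z) :
    ((ρ_ F).inv ≫ F ◁ eId V k) ▷ (k ⟶[V] l) ≫ (α_ _ _ _).hom ≫ F ◁ eComp V k k l ≫ h = h := by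
  have e := congrArg (fun m => F ◁ m) (e_id_comp V k l)
  simp only [MonoidalCategory.whiskerLeft_comp, MonoidalCategory.whiskerLeft_id] at e
  simp only [comp_whiskerRight, Category.assoc]
  rw [associator_naturality_middle_assoc]
  simpa using congrArg (fun m => m ≫ h) e

theorem eId_lhom_aux {C : Type u₁} [EnrichedCategory V C] {F H Z : V} {x y : C}
    (m : H ⟶ (x ⟶[V] y)) (h : F ⊗ (x ⟶[V] y) ⟶ Z) :
    (ρ_ (F ⊗ H)).inv ≫ (F ⊗ H) ◁ eId V y ≫ (α_ _ _ _).hom ≫ F ◁ (m ▷ _ ≫ eComp V x y y) ≫ h =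
      F ◁ m ≫ h := by
  have e : (ρ_ (F ⊗ H)).inv ≫ (F ⊗ H) ◁ eId V y ≫ (α_ _ _ _).hom ≫
      F ◁ (m ▷ _ ≫ eComp V x y y) ≫ h = F ◁ m ≫ (ρ_ _).inv ≫ _ ◁ eId V y ≫ (α_ _ _ _).hom ≫
        F ◁ eComp V x y y ≫ h := by
    rw [rightUnitor_inv_naturality_assoc, ← whisker_exchange_assoc,
      associator_naturality_middle_assoc]
    simp
  rw [e, whiskerLeft_eComp_eId]

theorem rightUnitor_inv_aux {F F' I' Z : V} (g : F ⟶ F') (i : 𝟙_ V ⟶ I') (q : F' ⊗ I' ⟶ Z) :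
    g ≫ (ρ_ _).inv ≫ F' ◁ i ≫ q = (ρ_ _).inv ≫ F ◁ i ≫ g ▷ _ ≫ q := by
  rw [rightUnitor_inv_naturality_assoc, ← whisker_exchange_assoc]

theorem leftUnitor_aux {F H F' Z : V} (g : F ⊗ H ⟶ F') (s : F' ⟶ Z) :
    (α_ (𝟙_ V) F H).hom ≫ 𝟙_ V ◁ g ≫ (λ_ _).hom ≫ s = (λ_ F).hom ▷ H ≫ g ≫ s := by
  simp

theorem whiskerLeft_comp_congr {X H P P' Q Z : V} (m : H ⟶ P) {f : P ⟶ P'} {g : X ⊗ P' ⟶ Z}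
    {f' : P ⟶ Q} {g' : X ⊗ Q ⟶ Z} (h : X ◁ f ≫ g = X ◁ f' ≫ g') :
    X ◁ (m ≫ f) ≫ g = X ◁ (m ≫ f') ≫ g' := by
  rw [MonoidalCategory.whiskerLeft_comp_assoc, h, MonoidalCategory.whiskerLeft_comp_assoc]

theorem comp_whiskerRight_aux {F F₁ F₂ F₃ H Z : V} (x : F ⟶ F₁) (y : F₁ ⟶ F₂) (z : F₂ ⟶ F₃)
    (a : F₃ ⊗ H ⟶ Z) : (x ≫ y ≫ z) ▷ H ≫ a = (x ≫ y) ▷ H ≫ z ▷ H ≫ a := by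
  simp

variable [SymmetricCategory V] [MonoidalClosed V]

/-- If the values of an action are coends of `B(X, ι (p t)) ⊗ L(p t, k)`, inserting identities of
`L` gives maps `B(X, ι (p t)) ⟶ B(X', ι (p t))` natural in `t`. Density produces the unit `η` from
them, and linearity of `q` recovers `q` from `η` and the action. -/
theorem exists_isFree {p : EnrichedFunctor V T A} (hj : IsDense (p.comp V ι)) {X X' : B}
    (a : LAction L ι X') (q : ∀ (t : T) (k : L.Cod), (X ⟶[V] ι.obj (p.obj t)) ⊗
      (L.functor.obj (p.obj t) ⟶[V] k) ⟶ (X' ⟶[V] ι.obj k))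
    (hq : ∀ k, IsCoend (nerveMod (p.comp V ι) X) (lhom (p.comp V L.functor) k) (fun t => q t k))
    (hact : ∀ t k l, q t k ▷ (k ⟶[V] l) ≫ a.act k l = (α_ _ _ _).hom ≫
      (X ⟶[V] ι.obj (p.obj t)) ◁ eComp V (L.functor.obj (p.obj t)) k l ≫ q t l) :
    ∃ η : 𝟙_ V ⟶ (X' ⟶[V] X), IsFree p a η := by
  let s (t : T) : (X ⟶[V] ι.obj (p.obj t)) ⟶ (X' ⟶[V] ι.obj (p.obj t)) :=
    (ρ_ _).inv ≫ _ ◁ eId V (L.functor.obj (p.obj t)) ≫ q t (p.obj t)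
  have hs (t : T) (k : L.Cod) : s t ▷ _ ≫ a.act (p.obj t) k = q t k := by
    have h := hact t (p.obj t) k
    have e : s t ▷ (L.functor.obj (p.obj t) ⟶[V] k) ≫ a.act (p.obj t) k =
        ((ρ_ _).inv ≫ _ ◁ eId V (L.functor.obj (p.obj t))) ▷ _ ≫ q t (p.obj t) ▷ _ ≫
          a.act (p.obj t) k := comp_whiskerRight_aux _ _ _ _
    refine e.trans ((congrArg (fun m => _ ≫ m) h).trans ?_)
    exact eId_whiskerRight_eComp _
  have hnat (t t' : T) : (nerveMod (p.comp V ι) X).act t t' ≫ s t' =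
      s t ▷ _ ≫ (nerveMod (p.comp V ι) X').act t t' := by
    -- On morphisms coming from `T` the action of `L` is composition in `B`, by `act_map`.
    have hm : (X' ⟶[V] ι.obj (p.obj t)) ◁ (p.map t t' ≫ ι.map (p.obj t) (p.obj t')) ≫
        eComp V X' (ι.obj (p.obj t)) (ι.obj (p.obj t')) = (X' ⟶[V] ι.obj (p.obj t)) ◁
          (p.map t t' ≫ L.functor.map (p.obj t) (p.obj t')) ≫ a.act (p.obj t) (p.obj t') :=
      (whiskerLeft_comp_congr _ (a.act_map _ _)).symm
    have h₁ : s t ▷ _ ≫ (nerveMod (p.comp V ι) X').act t t' = (X ⟶[V] ι.obj (p.obj t)) ◁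
        (p.map t t' ≫ L.functor.map (p.obj t) (p.obj t')) ≫ q t (p.obj t') := by
      refine (congrArg (fun m => s t ▷ _ ≫ m) hm).trans ?_
      refine (whisker_exchange_assoc _ _ _).symm.trans ?_
      exact congrArg (fun m => _ ≫ m) (hs t (p.obj t'))
    refine Eq.trans ?_ h₁.symm
    have hb := (hq (p.obj t')).balanced t t'
    beta_reduce at hb
    have h₂ := congrArg (fun m => (ρ_ _).inv ≫ _ ◁ eId V (L.functor.obj (p.obj t')) ≫ m) hb
    refine Eq.trans ?_ (h₂.trans (eId_lhom_aux _ _))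
    exact rightUnitor_inv_aux _ _ _
  obtain ⟨η, hη, -⟩ := hj X X' (𝟙_ V) (fun t => (λ_ _).hom ≫ s t) (by
    intro t t'
    exact (leftUnitor_aux _ _).trans ((congrArg (fun m => (λ_ _).hom ▷ _ ≫ m) (hnat t t')).trans
      (comp_whiskerRight_assoc _ _ _ _).symm))
  refine ⟨η, fun k => (isCoend_congr (fun _ _ => rfl) fun t => ?_).1 (hq k)⟩
  refine (hs t k).symm.trans (congrArg (fun m => m ▷ _ ≫ a.act (p.obj t) k) ?_)
  have h : η ▷ _ ≫ eComp V X' X (ι.obj (p.obj t)) = (λ_ _).hom ≫ s t := hη t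
  rw [pre, h, Iso.inv_hom_id_assoc]

end FreeActions

/-! ### Existence of free actions -/

section Existence

variable {V : Type u} [Category.{v} V] [MonoidalCategory V] [SymmetricCategory V]
  [MonoidalClosed V] [Limits.HasLimits V] [Limits.HasColimits V]

variable {Φ : Set (Weight.{w} V)} {A : Type u₁} [EnrichedCategory V A] {B : Type u₂}
  [EnrichedCategory V B] {T : Type v} [EnrichedCategory V T] {L : IdOnObjects V A}
  {ι : EnrichedFunctor V A B} {p : EnrichedFunctor V T A}

/-- Continuity of all `A(k, p -)` means that `p` preserves `Φ`-limits; so does `L.functor`, and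
representables of `L` turn the resulting limits into limits in `V`. -/
theorem continuous_nerveMod_comp (hL : IsContinuous Φ L.functor)
    (hp : ∀ k, (nerveMod p k).Continuous Φ) (k : L.Cod) :
    (nerveMod (p.comp V L.functor) k).Continuous Φ := by
  intro φ hφ S c hc
  have h₁ : (c.map p).IsLimit :=
    (isLimit_iff_isLimV _).2 fun X => (isLimV_map_iff c p _).2 (hp X φ hφ S c hc)
  have h₂ := (isLimit_iff_isLimV _).1 (hL φ hφ _ _ h₁) k
  rw [nerveMod, RMod.restrict_comp]
  exact (isLimV_map_iff c p _).1 ((isLimV_map_iff (c.map p) L.functor _).1 h₂)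

/-- The left Kan extension of `B(X, -)` along `T ⥤ L`. -/
def freeMod (L : IdOnObjects V A) (ι : EnrichedFunctor V A B) (p : EnrichedFunctor V T A) (X : B) :
    RMod (V := V) L.Cod :=
  RMod.of (lan (nerveMod (p.comp V ι) X).toFunctor (p.comp V L.functor))

/-- The weight `B(X, ι p -)` is continuous, hence flat, so its Kan extension along `T ⥤ L` is
continuous when restricted back to `T`. It is therefore represented there by some `X'`, and absolute
density extends the isomorphism from `T` to all of `A`. -/
theorem exists_iso_freeMod (hΦ : ContinuousFlat Φ) (hT : IsComplete T Φ)
    (hj : Presents Φ (p.comp V ι)) (hp : IsAbsolutelyDense p)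
    (hp' : ∀ k, (nerveMod p k).Continuous Φ) (hL : IsContinuous Φ L.functor) (X : B) :
    ∃ X', Nonempty (RMod.Iso ((freeMod L ι p X).restrict L.functor) (nerveMod ι X')) := by
  have hF : IsFlat Φ (nerveMod (p.comp V ι) X).toFunctor := by
    refine hΦ T hT _ ?_
    rw [isContinuous_iff, RMod.of_toFunctor]
    exact hj.continuous X
  obtain ⟨X', ⟨e⟩⟩ := hj.exists_iso _ (hF.continuous_lan (p.comp V L.functor) (p.comp V L.functor)
    fun c => continuous_nerveMod_comp hL hp' _)
  refine ⟨X', hp.nonempty_iso ?_⟩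
  have h₁ := RMod.restrict_comp p L.functor (freeMod L ι p X)
  have h₂ := RMod.restrict_comp p ι (RMod.hom V X')
  rw [← h₁, ← h₂]
  exact e

theorem exists_isFree_ofIso {X X' : B} (hj : IsDense (p.comp V ι))
    (e : ∀ k : L.Cod, (freeMod L ι p X).obj k ≅ (X' ⟶[V] ι.obj k))
    (h : ∀ k l : A, (freeMod L ι p X).obj k ◁ L.functor.map k l ≫ (freeMod L ι p X).act k l ≫
      (e l).hom = (e k).hom ▷ _ ≫ (X' ⟶[V] ι.obj k) ◁ ι.map k l ≫ eComp V X' (ι.obj k) (ι.obj l)) :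
    ∃ η : 𝟙_ V ⟶ (X' ⟶[V] X), IsFree p (LAction.ofIso (freeMod L ι p X) e h) η := by
  refine exists_isFree hj _ (fun t k =>
    lanι (nerveMod (p.comp V ι) X).toFunctor (p.comp V L.functor) t k ≫ (e k).hom) (fun k => ?_)
      fun t k l => ?_
  · have : IsIso (C := V) (X := (lan (nerveMod (p.comp V ι) X).toFunctor
        (p.comp V L.functor)).obj k) (e k).hom := (e k).isIso_hom
    refine IsCoend.of_toFunctor ?_
    exact (isCoend_lan (nerveMod (p.comp V ι) X).toFunctor (p.comp V L.functor) k).comp_iso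
      (e k).hom
  · refine (conj_act_aux _ _ _ _ _
      (lanι_act (nerveMod (p.comp V ι) X).toFunctor (p.comp V L.functor) t k l)).trans ?_
    exact (Category.assoc _ _ _).trans (congrArg (fun m => _ ≫ m) (Category.assoc _ _ _))

theorem exists_free (hΦ : ContinuousFlat Φ) (hT : IsComplete T Φ)
    (hj : Presents Φ (p.comp V ι)) (hp : IsAbsolutelyDense p)
    (hp' : ∀ k, (nerveMod p k).Continuous Φ) (hL : IsContinuous Φ L.functor) (X : B) :
    ∃ (X' : B) (a : LAction L ι X') (η : 𝟙_ V ⟶ (X' ⟶[V] X)), IsFree p a η := by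
  obtain ⟨X', ⟨e⟩⟩ := exists_iso_freeMod hΦ hT hj hp hp' hL X
  exact ⟨X', _, exists_isFree_ofIso hj.dense (fun k => e.e k)
    fun k l => (Category.assoc _ _ _).symm.trans (e.act_hom k l)⟩

end Existence

/-! ### The universal property of free actions -/

section UniversalProperty

variable {V : Type u} [Category.{v} V] [MonoidalCategory V]

theorem RMod.isHom_congr {C : Type u₁} [EnrichedCategory V C] {o o' : C → V}
    {m m' : ∀ c d, o c ⊗ (c ⟶[V] d) ⟶ o d} {n n' : ∀ c d, o' c ⊗ (c ⟶[V] d) ⟶ o' d}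
    {h₁ h₂ h₁' h₂' k₁ k₂ k₁' k₂'} {W : V} (hm : ∀ c d, m c d = m' c d)
    (hn : ∀ c d, n c d = n' c d) (σ : ∀ c, W ⊗ o c ⟶ o' c) :
    IsHom W (⟨o, m, h₁, h₂⟩ : RMod (V := V) C) ⟨o', n, k₁, k₂⟩ σ ↔
      IsHom W (⟨o, m', h₁', h₂'⟩ : RMod (V := V) C) ⟨o', n', k₁', k₂'⟩ σ := by
  obtain rfl : m = m' := by funext c d; exact hm c d
  obtain rfl : n = n' := by funext c d; exact hn c d
  rfl

theorem RMod.IsHom.balanced_act {T : Type u₁} [EnrichedCategory V T] {C : Type u₂}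
    [EnrichedCategory V C] {E : EnrichedFunctor V T C} {F : RMod (V := V) T} {N : RMod (V := V) C}
    {W : V} {σ : ∀ t, W ⊗ F.obj t ⟶ N.obj (E.obj t)} (hσ : IsHom W F (N.restrict E) σ) (k : C)
    (s t : T) : W ◁ F.act s t ▷ _ ≫ (α_ _ _ _).inv ≫ σ t ▷ _ ≫ N.act (E.obj t) k =
      W ◁ ((α_ _ _ _).hom ≫ F.obj s ◁ lhom E k s t) ≫ (α_ _ _ _).inv ≫ σ s ▷ _ ≫
        N.act (E.obj s) k := by
  have h := hσ s t
  have h' := VCat.balanced_act E N k s t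
  rw [← Iso.eq_inv_comp] at h
  rw [associator_inv_naturality_middle_assoc, ← comp_whiskerRight_assoc, h]
  simp only [comp_whiskerRight, Category.assoc] at h' ⊢
  rw [h', MonoidalCategory.whiskerLeft_comp_assoc W, associator_inv_naturality_right_assoc,
    whisker_exchange_assoc]
  simp

theorem isHom_coend_aux {W F G H P N N' Q Q' E : V} (q : F ⊗ G ⟶ Q) (q' : F ⊗ E ⟶ Q')
    (a : Q ⊗ H ⟶ Q') (e : G ⊗ H ⟶ E) (τ : W ⊗ Q ⟶ N) (τ' : W ⊗ Q' ⟶ N') (φ : W ⊗ F ⟶ P)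
    (n : P ⊗ G ⟶ N) (n' : P ⊗ E ⟶ N') (b : N ⊗ H ⟶ N')
    (hq : q ▷ H ≫ a = (α_ _ _ _).hom ≫ F ◁ e ≫ q')
    (hτ : W ◁ q ≫ τ = (α_ _ _ _).inv ≫ φ ▷ G ≫ n) (hτ' : W ◁ q' ≫ τ' = (α_ _ _ _).inv ≫ φ ▷ E ≫ n')
    (hb : n ▷ H ≫ b = (α_ _ _ _).hom ≫ P ◁ e ≫ n') :
    (W ◁ q) ▷ H ≫ (α_ _ _ _).hom ≫ W ◁ a ≫ τ' = (W ◁ q) ▷ H ≫ τ ▷ H ≫ b := by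
  rw [associator_naturality_middle_assoc, ← MonoidalCategory.whiskerLeft_comp_assoc W, hq,
    ← comp_whiskerRight_assoc, hτ]
  simp only [comp_whiskerRight, Category.assoc, MonoidalCategory.whiskerLeft_comp]
  rw [hτ', hb, associator_inv_naturality_right_assoc, whisker_exchange_assoc]
  simp

theorem act_assoc_aux {F F' G H E N N' : V} (x : F' ⟶ F) (n : F ⊗ G ⟶ N) (b : N ⊗ H ⟶ N')
    (e : G ⊗ H ⟶ E) (n' : F ⊗ E ⟶ N') (hb : n ▷ H ≫ b = (α_ _ _ _).hom ≫ F ◁ e ≫ n') :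
    (x ▷ G ≫ n) ▷ H ≫ b = (α_ _ _ _).hom ≫ F' ◁ e ≫ x ▷ E ≫ n' := by
  rw [comp_whiskerRight_assoc, hb, whisker_exchange_assoc, associator_naturality_left_assoc]

theorem isHom_coend_comp_aux {W F F' G Q N : V} {P : V} (x : F' ⟶ F) (a : F ⊗ G ⟶ Q) (τ : W ⊗ Q ⟶ N)
    (σ : W ⊗ F ⟶ P) (n : P ⊗ G ⟶ N)
    (h : (α_ _ _ _).hom ≫ W ◁ a ≫ τ = σ ▷ G ≫ n) :
    W ◁ (x ▷ G ≫ a) ≫ τ = (α_ _ _ _).inv ≫ (W ◁ x ≫ σ) ▷ G ≫ n := by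
  rw [comp_whiskerRight_assoc, ← h]
  simp

theorem unit_coend_aux {W F' G P Q : V} (i : 𝟙_ V ⟶ G) (x : F' ⟶ Q)
    (q : F' ⊗ G ⟶ Q) (τ : W ⊗ Q ⟶ P) (φ : W ⊗ F' ⟶ P) (n : P ⊗ G ⟶ P)
    (hq : (ρ_ _).inv ≫ F' ◁ i ≫ q = x) (h : W ◁ q ≫ τ = (α_ _ _ _).inv ≫ φ ▷ G ≫ n)
    (hn : P ◁ i ≫ n = (ρ_ P).hom) : W ◁ x ≫ τ = φ := by
  subst hq
  simp only [MonoidalCategory.whiskerLeft_comp, Category.assoc]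
  rw [h, associator_inv_naturality_right_assoc, whisker_exchange_assoc, hn]
  simp

variable {A : Type u₁} [EnrichedCategory V A] {B : Type u₂} [EnrichedCategory V B]
  {T : Type u₃} [EnrichedCategory V T] {L : IdOnObjects V A} {ι : EnrichedFunctor V A B}

theorem LAction.restrict_act {X : B} (a : LAction L ι X) (p : EnrichedFunctor V T A) (s t : T) :
    (a.mod.restrict (p.comp V L.functor)).act s t = (nerveMod (p.comp V ι) X).act s t :=
  whiskerLeft_comp_congr _ (a.act_map _ _)

variable {p : EnrichedFunctor V T A} {X X' Y : B} {a : LAction L ι X'} {η : 𝟙_ V ⟶ (X' ⟶[V] X)}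

theorem free_act (a : LAction L ι X') (η : 𝟙_ V ⟶ (X' ⟶[V] X)) (x k l : L.Cod) :
    (pre η (ι.obj x) ▷ _ ≫ a.act x k) ▷ _ ≫ a.act k l =
      (α_ _ _ _).hom ≫ (X ⟶[V] ι.obj x) ◁ eComp V x k l ≫ pre η (ι.obj x) ▷ _ ≫ a.act x l :=
  act_assoc_aux _ _ _ _ _ (a.act_act x k l)

theorem whiskerLeft_pre_eComp {W : V} {Z : B} (g : W ⟶ (Y ⟶[V] X')) (η : 𝟙_ V ⟶ (X' ⟶[V] X)) :
    W ◁ pre η Z ≫ g ▷ _ ≫ eComp V Y X' Z = (g ≫ post η Y) ▷ _ ≫ eComp V Y X Z := by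
  rw [whisker_exchange_assoc, ← post_eComp, comp_whiskerRight_assoc]

/-- An equivariant `g` is determined on the coend by its composite with `η`: this is the source of
uniqueness in `IsFree.existsUnique`. -/
theorem Equivariant.free {b : LAction L ι Y} {W : V} {g : W ⟶ (Y ⟶[V] X')}
    (hg : Equivariant a b g) (η : 𝟙_ V ⟶ (X' ⟶[V] X)) (x k : L.Cod) :
    W ◁ (pre η (ι.obj x) ▷ _ ≫ a.act x k) ≫ g ▷ _ ≫ eComp V Y X' (ι.obj k) =
      (α_ _ _ _).inv ≫ ((g ≫ post η Y) ▷ _ ≫ eComp V Y X (ι.obj x)) ▷ _ ≫ b.act x k := by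
  rw [← whiskerLeft_pre_eComp]
  exact isHom_coend_comp_aux _ _ _ _ _ (hg x k)

variable [SymmetricCategory V] [MonoidalClosed V]

/-- The free action is a coend, so `f` followed by the action on `Y` extends to an `L`-linear family
`τ`. Its restriction to `T` comes from a morphism `g` by density, and `g` induces `τ` on every
object by absolute density. -/
theorem IsFree.existsUnique (ha : IsFree p a η) (hj : IsDense (p.comp V ι))
    (hp : IsAbsolutelyDense p) (b : LAction L ι Y) {W : V} (f : W ⟶ (Y ⟶[V] X)) :
    ∃! g : W ⟶ (Y ⟶[V] X'), Equivariant a b g ∧ g ≫ post η Y = f := by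
  let φ (x : L.Cod) : W ⊗ (X ⟶[V] ι.obj x) ⟶ (Y ⟶[V] ι.obj x) := f ▷ _ ≫ eComp V Y X (ι.obj x)
  have hφ : RMod.IsHom W (nerveMod (p.comp V ι) X) (nerveMod (p.comp V ι) Y)
      (fun t => φ (p.obj t)) := (RMod.isHom_hom f).restrict (p.comp V ι)
  have hφ' : RMod.IsHom W (nerveMod (p.comp V ι) X) (b.mod.restrict (p.comp V L.functor))
      (fun t => φ (p.obj t)) :=
    (RMod.isHom_congr (fun _ _ => rfl) (fun s t => (b.restrict_act p s t).symm) _).1 hφ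
  choose τ hτ using fun k => ((ha k).existsUnique_left (P := W) _ (hφ'.balanced_act k)).exists
  replace hτ (k : L.Cod) (t : T) : W ◁ (pre η (ι.obj (p.obj t)) ▷ _ ≫ a.act (p.obj t) k) ≫ τ k =
    (α_ _ _ _).inv ≫ φ (p.obj t) ▷ _ ≫ b.act (p.obj t) k := hτ k t
  have hnat : RMod.IsHom W a.mod b.mod τ := by
    intro k l
    refine (ha k).hom_ext_middle fun t => ?_
    exact isHom_coend_aux _ _ _ _ _ _ _ _ _ _ (free_act a η (p.obj t) k l) (hτ k t) (hτ l t)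
      (b.act_act (p.obj t) k l)
  have hT : RMod.IsHom W (nerveMod (p.comp V ι) X') (nerveMod (p.comp V ι) Y)
      (fun t => τ (p.obj t)) :=
    (RMod.isHom_congr (a.restrict_act p) (b.restrict_act p) _).1 (hnat.restrict (p.comp V L.functor))
  obtain ⟨g, hg, -⟩ := hj X' Y W _ hT
  -- By construction this holds for `k` in the image of `p`; both sides are `A`-linear, so it holds
  -- for all `k`.
  have hg' (k : A) : g ▷ _ ≫ eComp V Y X' (ι.obj k) = τ k := by
    refine hp.isHom_ext (M := nerveMod ι X') (N := nerveMod ι Y)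
      ((RMod.isHom_hom g).restrict ι) ?_ hg k
    exact (RMod.isHom_congr a.act_map b.act_map _).1 (hnat.restrict L.functor)
  have hE : Equivariant a b g := by
    have e : (fun k => g ▷ _ ≫ eComp V Y X' (ι.obj k)) = τ := funext hg'
    exact Eq.mpr (congrArg (RMod.IsHom W a.mod b.mod) e) hnat
  refine ⟨g, ⟨hE, hj.hom_ext fun t => ?_⟩, fun k hk => ?_⟩
  · refine (whiskerLeft_pre_eComp g η).symm.trans ?_
    refine (congrArg (fun m => W ◁ pre η (ι.obj (p.obj t)) ≫ m) (hg' (p.obj t))).trans ?_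
    refine unit_coend_aux _ _ _ _ _ _ ?_ (hτ (p.obj t) t) (b.act_id (p.obj t))
    refine (rightUnitor_inv_aux _ _ _).symm.trans ?_
    have h := a.act_id (p.obj t)
    rw [h, Iso.inv_hom_id, Category.comp_id]
  · refine hj.hom_ext fun t => Eq.trans ?_ (hg' (p.obj t)).symm
    refine (ha (p.obj t)).hom_ext_left fun s => ?_
    refine (hk.1.free η (p.obj s) (p.obj t)).trans (Eq.trans ?_ (hτ (p.obj t) s).symm)
    rw [hk.2]

end UniversalProperty

/-! ### Composition with elements in the opposite `V`-category -/

section OppositeElements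

variable {V : Type u} [Category.{v} V] [MonoidalCategory V] [SymmetricCategory V]

variable {K : Type u₁} [EnrichedCategory V K]

theorem post_op {X Y Z : K} (f : 𝟙_ V ⟶ (Z ⟶[V] Y)) :
    post (C := Kᵒᵖ) (Y := op Y) (Z := op Z) f (op X) = pre f X := by
  have h : (ρ_ (Y ⟶[V] X)).inv ≫ (Y ⟶[V] X) ◁ f ≫ (β_ (Y ⟶[V] X) (Z ⟶[V] Y)).hom ≫
      eComp V Z Y X = pre f X := by
    rw [BraidedCategory.braiding_naturality_right_assoc, pre, braiding_tensorUnit_right]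
    simp
  exact h

theorem pre_op {X Y Z : K} (f : 𝟙_ V ⟶ (Y ⟶[V] X)) :
    pre (C := Kᵒᵖ) (X := op X) (Y := op Y) f (op Z) = post f Z := by
  have h : (λ_ (Z ⟶[V] Y)).inv ≫ f ▷ (Z ⟶[V] Y) ≫ (β_ (Y ⟶[V] X) (Z ⟶[V] Y)).hom ≫
      eComp V Z Y X = post f Z := by
    rw [BraidedCategory.braiding_naturality_left_assoc, post, braiding_tensorUnit_left]
    simp
  exact h

theorem elComp_op {X Y Z : K} (f : 𝟙_ V ⟶ (Y ⟶[V] X)) (g : 𝟙_ V ⟶ (Z ⟶[V] Y)) :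
    elComp (C := Kᵒᵖ) (X := op X) (Y := op Y) (Z := op Z) f g = elComp (C := K) g f := by
  rw [← comp_post, post_op, comp_pre]

end OppositeElements

/-! ### Actions determined by algebra structures -/

section EquivariantElements

variable {V : Type u} [Category.{v} V] [MonoidalCategory V]

variable {A : Type u₁} [EnrichedCategory V A] {B : Type u₂} [EnrichedCategory V B]
  {L : IdOnObjects V A} {ι : EnrichedFunctor V A B}

theorem whiskerRight_eComp_pre {W : V} {X Y Y' Z : B} (f : W ⟶ (Y ⟶[V] X))
    (e : 𝟙_ V ⟶ (Y' ⟶[V] Y)) :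
    (f ≫ pre e X) ▷ _ ≫ eComp V Y' X Z = f ▷ _ ≫ eComp V Y X Z ≫ pre e Z := by
  rw [eComp_pre, comp_whiskerRight_assoc]

theorem leftUnitor_inv_aux {F H F' N P Z : V} (e : 𝟙_ V ⟶ N) (a : F ⊗ H ⟶ F') (c : N ⊗ F' ⟶ Z)
    (d : N ⊗ F ⟶ P) (b : P ⊗ H ⟶ Z) :
    (α_ (𝟙_ V) F H).hom ≫ 𝟙_ V ◁ a ≫ e ▷ _ ≫ c = (e ▷ _ ≫ d) ▷ H ≫ b ↔
      a ≫ (λ_ _).inv ≫ e ▷ _ ≫ c = ((λ_ _).inv ≫ e ▷ _ ≫ d) ▷ H ≫ b := by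
  rw [← cancel_epi ((λ_ F).inv ▷ H), leftUnitor_inv_naturality_assoc]
  simp

theorem equivariant_element_iff {X Y : B} {a : LAction L ι X} {b : LAction L ι Y}
    {e : 𝟙_ V ⟶ (Y ⟶[V] X)} : Equivariant a b e ↔
      ∀ k l : L.Cod, a.act k l ≫ pre e (ι.obj l) = pre e (ι.obj k) ▷ _ ≫ b.act k l :=
  forall₂_congr fun _ _ => leftUnitor_inv_aux _ _ _ _ _

variable {X X' Y Y' : B}

/-- By `ha` and `hb` both actions are recovered from `a'` and `b'` by entering through the unit and
leaving through the structure map. The two squares let `f` pass through this description as the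
equivariant `g`. -/
theorem equivariant_of_algebra {a : LAction L ι X} {a' : LAction L ι X'} {b : LAction L ι Y}
    {b' : LAction L ι Y'} {η : 𝟙_ V ⟶ (X' ⟶[V] X)} {e : 𝟙_ V ⟶ (X ⟶[V] X')}
    {η' : 𝟙_ V ⟶ (Y' ⟶[V] Y)} {e' : 𝟙_ V ⟶ (Y ⟶[V] Y')}
    (ha : ∀ k l : L.Cod, (pre η (ι.obj k) ▷ _ ≫ a'.act k l) ≫ pre e (ι.obj l) = a.act k l)
    (hb : ∀ k l : L.Cod, (pre η' (ι.obj k) ▷ _ ≫ b'.act k l) ≫ pre e' (ι.obj l) = b.act k l)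
    {W : V} {f : W ⟶ (Y ⟶[V] X)} {g : W ⟶ (Y' ⟶[V] X')} (hg : Equivariant a' b' g)
    (h₁ : g ≫ post η Y' = f ≫ pre η' X) (h₂ : f ≫ post e Y = g ≫ pre e' X') :
    Equivariant a b f := by
  intro k l
  rw [← Iso.eq_inv_comp]
  have h := hg.free η k l
  rw [h₁] at h
  have e₁ : W ◁ a.act k l ≫ f ▷ _ ≫ eComp V Y X (ι.obj l) =
      (W ◁ (pre η (ι.obj k) ▷ _ ≫ a'.act k l) ≫ g ▷ _ ≫ eComp V Y' X' (ι.obj l)) ≫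
        pre e' (ι.obj l) := by
    rw [← ha, MonoidalCategory.whiskerLeft_comp_assoc, whiskerLeft_pre_eComp, h₂,
      whiskerRight_eComp_pre]
    simp only [Category.assoc]
  refine e₁.trans ((congrArg (fun m => m ≫ _) h).trans ?_)
  simp only [Category.assoc]
  rw [whiskerRight_eComp_pre, ← hb]
  simp only [comp_whiskerRight, Category.assoc]

/-- The action of `L` determined by an algebra structure. -/
def LAction.ofAlgebra (a : LAction L ι X') (η : 𝟙_ V ⟶ (X' ⟶[V] X)) (e : 𝟙_ V ⟶ (X ⟶[V] X'))
    (h₁ : ∀ k : B, pre η k ≫ pre e k = 𝟙 _)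
    (h₂ : ∀ k l : L.Cod, (pre e (ι.obj k) ≫ pre η (ι.obj k)) ▷ _ ≫ a.act k l ≫ pre e (ι.obj l) =
      a.act k l ≫ pre e (ι.obj l)) : LAction L ι X where
  act k l := pre η (ι.obj k) ▷ _ ≫ a.act k l ≫ pre e (ι.obj l)
  act_id k := by
    have h := a.act_id k
    rw [whisker_exchange_assoc, reassoc_of% h, rightUnitor_naturality_assoc, h₁, Category.comp_id]
  act_act k l m := by
    have h := free_act a η k l m
    have h' : (pre η (ι.obj k) ▷ _ ≫ a.act k l ≫ pre e (ι.obj l)) ▷ _ ≫ pre η (ι.obj l) ▷ _ ≫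
        a.act l m ≫ pre e (ι.obj m) = (pre η (ι.obj k) ▷ _ ≫ a.act k l) ▷ _ ≫
          (pre e (ι.obj l) ≫ pre η (ι.obj l)) ▷ _ ≫ a.act l m ≫ pre e (ι.obj m) := by
      simp only [comp_whiskerRight, Category.assoc]
    rw [h', h₂, reassoc_of% h]
  act_map k l := by
    have h := a.act_map k l
    refine (whisker_exchange_assoc _ _ _).trans ?_
    refine (congrArg (fun m => _ ≫ m) ((Category.assoc _ _ _).symm.trans
      ((congrArg (fun m => m ≫ _) h).trans (Category.assoc _ _ _)))).trans ?_
    rw [eComp_pre, whisker_exchange_assoc, ← comp_whiskerRight_assoc, h₁]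
    simp

/-- This supplies the hypothesis `h₂` of `LAction.ofAlgebra`. In monad terms, naturality of the unit
replaces `η ∘ α` by `Tα ∘ η_T`; equivariance moves `Tα` past the action; associativity replaces `α ∘
Tα` by `α ∘ μ`; and `μ` cancels `η_T`. -/
theorem algebra_act {X Y Z : B} {a : LAction L ι Y} {a' : LAction L ι Z} {α : 𝟙_ V ⟶ (X ⟶[V] Y)}
    {η : 𝟙_ V ⟶ (Y ⟶[V] X)} {η' : 𝟙_ V ⟶ (Z ⟶[V] Y)} {α' μ : 𝟙_ V ⟶ (Y ⟶[V] Z)}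
    (hn : elComp η α = elComp α' η') (h : elComp α α' = elComp α μ)
    (hα : ∀ k l : L.Cod, a'.act k l ≫ pre α' (ι.obj l) = pre α' (ι.obj k) ▷ _ ≫ a.act k l)
    (hμ : ∀ k l : L.Cod, (pre η' (ι.obj k) ▷ _ ≫ a'.act k l) ≫ pre μ (ι.obj l) = a.act k l)
    (k l : L.Cod) : (pre α (ι.obj k) ≫ pre η (ι.obj k)) ▷ _ ≫ a.act k l ≫ pre α (ι.obj l) =
      a.act k l ≫ pre α (ι.obj l) := by
  rw [pre_pre, hn, ← pre_pre, comp_whiskerRight_assoc, ← reassoc_of% hα, pre_pre, h, ← pre_pre,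
    ← hμ]
  simp only [Category.assoc]

end EquivariantElements

/-! ### The comparison functor is an equivalence -/

section Monadicity

variable {V : Type u} [Category.{v} V] [MonoidalCategory V] [SymmetricCategory V]

variable {A : Type u₁} [EnrichedCategory V A] {K : Type u₂} [EnrichedCategory V K]
  {M : Type u₃} [EnrichedCategory V M] {T : Type v} [EnrichedCategory V T]
  {L : IdOnObjects V A} {ι : EnrichedFunctor V A Kᵒᵖ} {U : EnrichedFunctor V M K}
  {p : EnrichedFunctor V T A}

theorem pre_comp_pre_op {X Y : K} {η : 𝟙_ V ⟶ (X ⟶[V] Y)} {e : 𝟙_ V ⟶ (Y ⟶[V] X)}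
    (h : elComp η e = eId V X) (k : Kᵒᵖ) :
    pre (C := Kᵒᵖ) (X := op Y) (Y := op X) η k ≫ pre (C := Kᵒᵖ) (X := op X) (Y := op Y) e k =
      𝟙 _ := by
  rw [pre_pre, elComp_op, h]
  exact pre_eId (C := Kᵒᵖ) (op X) k

namespace Algebraic

variable (S : Algebraic L ι U)

theorem equivariant_map {P Q : M} {W : V} (g : W ⟶ (P ⟶[V] Q)) :
    Equivariant (X := op (U.obj P)) (Y := op (U.obj Q)) (S.action P) (S.action Q)
      (g ≫ U.map P Q) :=
  (S.lift_iff P Q W _).1 ⟨g, rfl⟩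

theorem act_pre {P Q : M} (g : 𝟙_ V ⟶ (P ⟶[V] Q)) (k l : L.Cod) :
    (S.action P).act k l ≫ pre (C := Kᵒᵖ) (X := op (U.obj Q)) (elMap U g) (ι.obj l) =
      pre (C := Kᵒᵖ) (X := op (U.obj Q)) (Y := op (U.obj P)) (elMap U g) (ι.obj k) ▷ _ ≫
        (S.action Q).act k l :=
  equivariant_element_iff.1 (S.equivariant_map g) k l

/-- Since `g` is equivariant and is split by `η`, the action on `P` is determined by the one on `Q`.
It is applied to the unit and counit, with `Q` the free object on `U P`. -/
theorem act_eq {P Q : M} {η : 𝟙_ V ⟶ (U.obj P ⟶[V] U.obj Q)} {g : 𝟙_ V ⟶ (Q ⟶[V] P)}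
    (h : elComp η (elMap U g) = eId V (U.obj P)) (k l : L.Cod) :
    (pre (C := Kᵒᵖ) (X := op (U.obj Q)) (Y := op (U.obj P)) η (ι.obj k) ▷ _ ≫
      (S.action Q).act k l) ≫ pre (C := Kᵒᵖ) (X := op (U.obj P)) (elMap U g) (ι.obj l) =
        (S.action P).act k l := by
  rw [Category.assoc, act_pre, ← comp_whiskerRight_assoc, pre_comp_pre_op h, id_whiskerRight,
    Category.id_comp]

/-- An element `η : I ⟶ K(X, U P)` exhibits `P` as the free object on `X`. -/
abbrev IsFreeOn (p : EnrichedFunctor V T A) {X : K} {P : M} (η : 𝟙_ V ⟶ (X ⟶[V] U.obj P)) : Prop :=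
  IsFree (X := op X) (X' := op (U.obj P)) p (S.action P) η

theorem exists_isFreeOn (h : ∀ X : Kᵒᵖ, ∃ (X' : Kᵒᵖ) (a : LAction L ι X') (η : 𝟙_ V ⟶ (X' ⟶[V] X)),
    IsFree p a η) (X : K) : ∃ (P : M) (η : 𝟙_ V ⟶ (X ⟶[V] U.obj P)), S.IsFreeOn p η := by
  obtain ⟨X', a, η, ha⟩ := h (op X)
  obtain ⟨P, hP⟩ := S.exists_eq X' a
  cases hP
  exact ⟨P, η, ha⟩

theorem isUniversal [MonoidalClosed V] (hj : IsDense (p.comp V ι)) (hp : IsAbsolutelyDense p)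
    {X : K} {P : M} {η : 𝟙_ V ⟶ (X ⟶[V] U.obj P)} (h : S.IsFreeOn p η) : IsUniversal U η := by
  refine isUniversal_of_existsUnique fun Q W f => ?_
  obtain ⟨g, ⟨hg, hg'⟩, hu⟩ := h.existsUnique hj hp (S.action Q) (W := W) f
  obtain ⟨k, hk⟩ := (S.lift_iff P Q W g).2 hg
  refine ⟨k, ?_, fun k' hk' => ?_⟩
  · beta_reduce
    rw [← Category.assoc, hk, ← post_op]
    exact hg'
  · have := S.mono_map P Q
    rw [← cancel_mono (U.map P Q), hk]
    refine hu _ ⟨S.equivariant_map k', ?_⟩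
    refine Eq.trans ?_ hk'
    rw [← Category.assoc, ← post_op]

variable {F : EnrichedFunctor V K M} (adj : VAdjunction F U)

theorem VNatTrans.naturality_element {K' : Type u₃} [EnrichedCategory V K']
    {F G : EnrichedFunctor V K K'} (σ : VNatTrans F G) {X Y : K} (f : 𝟙_ V ⟶ (X ⟶[V] Y)) :
    elComp (elMap F f) (σ.app Y) = elComp (σ.app X) (elMap G f) := by
  have h := congrArg (fun m => f ≫ m) (σ.naturality X Y)
  rw [← comp_post, ← comp_pre, Category.assoc, Category.assoc]
  exact h

theorem algebra_act {X : K} {α : 𝟙_ V ⟶ (U.obj (F.obj X) ⟶[V] X)}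
    (ha : elComp (elMap U (elMap F α)) α = elComp (elMap U (adj.ε (F.obj X))) α) (k l : L.Cod) :
    (pre (C := Kᵒᵖ) (X := op X) (Y := op (U.obj (F.obj X))) α (ι.obj k) ≫
        pre (C := Kᵒᵖ) (X := op (U.obj (F.obj X))) (Y := op X) (adj.unit.app X) (ι.obj k)) ▷ _ ≫
      (S.action (F.obj X)).act k l ≫
        pre (C := Kᵒᵖ) (X := op X) (Y := op (U.obj (F.obj X))) α (ι.obj l) =
      (S.action (F.obj X)).act k l ≫
        pre (C := Kᵒᵖ) (X := op X) (Y := op (U.obj (F.obj X))) α (ι.obj l) := by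
  have hn : elComp α (adj.unit.app X) =
      elComp (adj.unit.app (U.obj (F.obj X))) (elMap U (elMap F α)) := by
    refine Eq.trans ?_ ((VNatTrans.naturality_element adj.unit α).trans ?_)
    · exact congrArg (fun m => elComp m (adj.unit.app X)) (Category.comp_id α).symm
    · exact congrArg (elComp _) (Category.assoc _ _ _).symm
  exact VCat.algebra_act ((elComp_op _ _).trans (hn.trans (elComp_op _ _).symm))
    ((elComp_op _ _).trans (ha.trans (elComp_op _ _).symm)) (S.act_pre (elMap F α))
    (S.act_eq (adj.right_triangle (F.obj X))) k l

/-- The action of `L` on the underlying object of an algebra. -/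
def algebraAction {X : K} {α : 𝟙_ V ⟶ (U.obj (F.obj X) ⟶[V] X)}
    (hu : elComp (adj.unit.app X) α = eId V X)
    (ha : elComp (elMap U (elMap F α)) α = elComp (elMap U (adj.ε (F.obj X))) α) :
    LAction L ι (op X) :=
  (S.action (F.obj X)).ofAlgebra (X := op X) (adj.unit.app X) α (pre_comp_pre_op hu)
    (S.algebra_act adj ha)

/-- The algebra gives `X` an action of `L`, hence a `P` over `X`. Its structure map `α` is
equivariant for this action, so it is the image of a morphism from the free object to `P`, which has
to be the counit. -/
theorem exists_map_eq (S : Algebraic L ι U) (hadj : ∀ X, IsUniversal U (adj.unit.app X)) {X : K}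
    {α : 𝟙_ V ⟶ (U.obj (F.obj X) ⟶[V] X)} (hu : elComp (adj.unit.app X) α = eId V X)
    (ha : elComp (elMap U (elMap F α)) α = elComp (elMap U (adj.ε (F.obj X))) α) :
    ∃ P, ∃ h : U.obj P = X, h ▸ elMap U (adj.ε P) = α := by
  obtain ⟨P, hP⟩ := S.exists_eq (op X) (S.algebraAction adj hu ha)
  obtain rfl : U.obj P = X := congrArg (fun s => s.1.unop) hP
  have hP' : S.action P = S.algebraAction adj hu ha := eq_of_heq (Sigma.mk.inj hP).2
  have h : Equivariant (X := op (U.obj (F.obj (U.obj P)))) (Y := op (U.obj P))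
      (S.action (F.obj (U.obj P))) (S.action P) α := by
    rw [hP', equivariant_element_iff]
    intro k l
    refine (S.algebra_act adj ha k l).symm.trans ?_
    exact comp_whiskerRight_assoc _ _ _ _
  obtain ⟨g, hg⟩ := (S.lift_iff _ _ _ _).2 h
  refine ⟨P, rfl, ?_⟩
  -- Both are transposes of the identity: one by the triangle identity, the other by the unit law of
  -- the algebra.
  have e : adj.ε P = g := (hadj (U.obj P)).hom_ext (by
    rw [← Category.assoc, ← Category.assoc, hg]
    refine (comp_pre _ _).trans (Eq.trans (adj.right_triangle P) (hu.symm.trans ?_))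
    exact (comp_pre _ _).symm)
  rw [← hg, e]

variable [Limits.HasEqualizers V]

/-- Morphisms of `M` are the equivariant morphisms of underlying objects, so it suffices that the
universal algebra morphism is equivariant. -/
theorem comparison_fullyFaithful (S : Algebraic L ι U) : FullyFaithful adj.comparison := by
  intro P Q
  have h : Equivariant (X := op (U.obj P)) (Y := op (U.obj Q)) (S.action P) (S.action Q)
      (algHomι (adj.comparisonObj P) (adj.comparisonObj Q)) := by
    have hc := algHomι_condition (adj.comparisonObj P) (adj.comparisonObj Q)
    have hn := adj.unit.naturality (U.obj P) (U.obj Q)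
    -- The image under `F` is equivariant because it lies in `M`; the two squares are naturality of
    -- the unit and the equation defining algebra morphisms.
    refine equivariant_of_algebra (S.act_eq (adj.right_triangle P)) (S.act_eq (adj.right_triangle Q))
      (S.equivariant_map (algHomι (adj.comparisonObj P) (adj.comparisonObj Q) ≫ F.map _ _)) ?_ ?_
    · refine (congrArg (fun m => _ ≫ m) (post_op _)).trans (Eq.trans ?_
        (congrArg (fun m => _ ≫ m) (pre_op _)).symm)
      have h := congrArg (fun m => algHomι (adj.comparisonObj P) (adj.comparisonObj Q) ≫ m)
        ((Category.id_comp _).symm.trans hn)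
      refine Eq.trans ?_ h.symm
      exact (congrArg (fun m => m ≫ _) (Category.assoc _ _ _)).trans (Category.assoc _ _ _)
    · refine (congrArg (fun m => _ ≫ m) (post_op _)).trans (Eq.trans hc ?_)
      refine Eq.trans ?_ (congrArg (fun m => _ ≫ m) (pre_op _)).symm
      exact (Category.assoc _ _ _).symm.trans (congrArg (fun m => m ≫ _)
        (Category.assoc _ _ _).symm)
  obtain ⟨g, hg⟩ := (S.lift_iff P Q _ _).2 h
  have := S.mono_map P Q
  have hc := adj.comparisonMap_ι P Q
  refine ⟨g, (cancel_mono (U.map P Q)).1 ?_, (cancel_mono (algHomι (adj.comparisonObj P)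
    (adj.comparisonObj Q))).1 ?_⟩
  · exact (Category.assoc _ _ _).trans ((congrArg (fun m => adj.comparisonMap P Q ≫ m) hg).trans
      (hc.trans (Category.id_comp _).symm))
  · exact (Category.assoc _ _ _).trans ((congrArg (fun m => g ≫ m) hc).trans
      (hg.trans (Category.id_comp _).symm))

theorem comparison_essSurj (S : Algebraic L ι U) (hadj : ∀ X, IsUniversal U (adj.unit.app X)) :
    adj.comparison.forget.EssSurj where
  mem_essImage Y := by
    obtain ⟨P, h⟩ : ∃ P, adj.comparisonObj P = ForgetEnrichment.to V Y := by
      generalize ForgetEnrichment.to V Y = Z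
      obtain ⟨X, α, hu, ha⟩ := Z
      obtain ⟨P, rfl, rfl⟩ := S.exists_map_eq adj hadj hu
        ((congrArg (elComp · α) (elMap_comp F U α)).symm.trans ha)
      exact ⟨P, rfl⟩
    exact ⟨ForgetEnrichment.of V P, ⟨eqToIso (congrArg (ForgetEnrichment.of V) h)⟩⟩

end Algebraic

end Monadicity

/-! ### Commutation of coends -/

section Interchange

variable {V : Type u} [Category.{v} V] [MonoidalCategory V] [SymmetricCategory V]
  [MonoidalClosed V]

variable {D : Type u₁} [EnrichedCategory V D] {T : Type u₂} [EnrichedCategory V T]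

/-- Coends over `T` of coends over `D`: a family of coends over `T` is preserved by the coends over
`D` if the pieces are. -/
theorem IsCoend.interchange {φ : RMod (V := V) D} {Fd : D → RMod (V := V) T} {F : RMod (V := V) T}
    {G : T → V} {lG : ∀ s s' : T, (s ⟶[V] s') ⊗ G s' ⟶ G s} {Y : V} {Yd : D → V}
    {lF : ∀ (s : T) (d d' : D), (d ⟶[V] d') ⊗ (Fd d').obj s ⟶ (Fd d).obj s}
    {lY : ∀ d d' : D, (d ⟶[V] d') ⊗ Yd d' ⟶ Yd d}
    {q : ∀ d s, φ.obj d ⊗ (Fd d).obj s ⟶ F.obj s} {r : ∀ d s, (Fd d).obj s ⊗ G s ⟶ Yd d}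
    {r' : ∀ s, F.obj s ⊗ G s ⟶ Y} {y : ∀ d, φ.obj d ⊗ Yd d ⟶ Y}
    (hq : ∀ s, IsCoend φ (lF s) (fun d => q d s)) (hr : ∀ d, IsCoend (Fd d) lG (r d))
    (hr' : IsCoend F lG r')
    (hy : ∀ d s, φ.obj d ◁ r d s ≫ y d = (α_ _ _ _).inv ≫ q d s ▷ _ ≫ r' s)
    (hl : ∀ (d d' : D) (s : T), (d ⟶[V] d') ◁ r d' s ≫ lY d d' =
      (α_ _ _ _).inv ≫ lF s d d' ▷ _ ≫ r d s)
    (hact : ∀ (d : D) (s s' : T), q d s ▷ _ ≫ F.act s s' =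
      (α_ _ _ _).hom ≫ φ.obj d ◁ (Fd d).act s s' ≫ q d s') :
    IsCoend φ lY y := by
  refine ⟨fun d d' => (hr d').hom_ext_left fun s => ?_, fun Z h hh => ?_⟩
  · have hb := (hq s).balanced d d'
    beta_reduce at hb
    rw [whisker_exchange_assoc, hy, associator_inv_naturality_left_assoc,
      ← comp_whiskerRight_assoc, hb, associator_naturality_right_assoc,
      ← MonoidalCategory.whiskerLeft_comp_assoc, hl]
    simp only [MonoidalCategory.whiskerLeft_comp, comp_whiskerRight, Category.assoc]
    rw [hy]
    simp
  -- A family balanced over `D` descends, for each `s`, along the coend over `D` tensored with `G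
  -- s`; the maps obtained are balanced over `T` and descend once more.
  · choose h' hh' using fun s => ((hq s).existsUnique_right (P := G s)
      (fun d => (α_ _ _ _).hom ≫ φ.obj d ◁ r d s ≫ h d) (by
        intro d d'
        have hd := hh d d'
        rw [associator_naturality_left_assoc, ← whisker_exchange_assoc, hd,
          associator_naturality_right_assoc, ← MonoidalCategory.whiskerLeft_comp_assoc, hl]
        simp)).exists
    replace hh' (s : T) (d : D) : q d s ▷ _ ≫ h' s = (α_ _ _ _).hom ≫ φ.obj d ◁ r d s ≫ h d :=
      hh' s d
    obtain ⟨f, hf, hu⟩ := hr'.existsUnique Z h' (by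
      intro s s'
      rw [← cancel_epi (α_ _ _ _).inv]
      refine (hq s).hom_ext_right fun d => ?_
      have hb := (hr d).balanced s s'
      rw [Iso.inv_hom_id_assoc, ← whisker_exchange_assoc, hh', associator_inv_naturality_left_assoc,
        ← comp_whiskerRight_assoc, hact]
      simp only [comp_whiskerRight, Category.assoc]
      rw [hh', associator_naturality_middle_assoc, ← MonoidalCategory.whiskerLeft_comp_assoc, hb]
      simp)
    refine ⟨f, fun d => (hr d).hom_ext_left fun s => ?_, fun g hg => hu g fun s => ?_⟩
    · rw [reassoc_of% hy, hf, hh', Iso.inv_hom_id_assoc]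
    · refine (hq s).hom_ext_right fun d => ?_
      have e := hy d s
      rw [Iso.eq_inv_comp] at e
      rw [hh', ← hg, ← reassoc_of% e]

end Interchange

/-! ### The induced monad preserves flat colimits -/

section Accessibility

variable {V : Type u} [Category.{v} V] [MonoidalCategory V] [SymmetricCategory V]

variable {A : Type u₁} [EnrichedCategory V A] {K : Type u₂} [EnrichedCategory V K]
  {M : Type u₃} [EnrichedCategory V M] {T : Type v} [EnrichedCategory V T]
  {L : IdOnObjects V A} {ι : EnrichedFunctor V A Kᵒᵖ} {U : EnrichedFunctor V M K}
  {p : EnrichedFunctor V T A} {F : EnrichedFunctor V K M}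

/-- The coend presentation of the free model is natural in the object it is free on. This provides
the compatibilities needed for `IsCoend.interchange`. -/
theorem Algebraic.free_map (S : Algebraic L ι U) (adj : VAdjunction F U) {X Y : K} {W : V}
    (u : W ⟶ (X ⟶[V] Y)) (x k : L.Cod) :
    W ◁ (pre (C := Kᵒᵖ) (X := op (U.obj (F.obj X))) (Y := op X) (adj.unit.app X) (ι.obj x) ▷ _ ≫
        (S.action (F.obj X)).act x k) ≫ (u ≫ (F.comp V U).map X Y) ▷ _ ≫
          eComp V (op (U.obj (F.obj Y))) (op (U.obj (F.obj X))) (ι.obj k) =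
      (α_ _ _ _).inv ≫ (u ▷ _ ≫ eComp V (op Y) (op X) (ι.obj x)) ▷ _ ≫
        pre (C := Kᵒᵖ) (X := op (U.obj (F.obj Y))) (Y := op Y) (adj.unit.app Y) (ι.obj x) ▷ _ ≫
          (S.action (F.obj Y)).act x k := by
  have hn := adj.unit.naturality X Y
  have h := (S.equivariant_map (u ≫ F.map X Y)).free (X := op X) (adj.unit.app X) x k
  have e : ((u ≫ F.map X Y) ≫ U.map _ _) ≫ post (C := Kᵒᵖ) (Y := op (U.obj (F.obj X))) (Z := op X)
      (adj.unit.app X) (op (U.obj (F.obj Y))) =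
        u ≫ pre (C := Kᵒᵖ) (X := op (U.obj (F.obj Y))) (Y := op Y) (adj.unit.app Y) (op X) := by
    refine (congrArg (fun m => _ ≫ m) (post_op _)).trans (Eq.trans ?_
      (congrArg (fun m => u ≫ m) (pre_op _)).symm)
    refine Eq.trans ?_ (congrArg (fun m => u ≫ m) ((Category.id_comp _).symm.trans hn)).symm
    exact (congrArg (fun m => m ≫ _) (Category.assoc _ _ _)).trans (Category.assoc _ _ _)
  have hw := (congrArg (fun m => m ▷ _ ≫ eComp V (op (U.obj (F.obj Y))) (op X) (ι.obj x)) e).trans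
    (whiskerRight_eComp_pre (B := Kᵒᵖ) (X := op X) (Y := op Y) (Y' := op (U.obj (F.obj Y)))
      (Z := ι.obj x) u (adj.unit.app Y))
  refine Eq.trans ?_ (h.trans
    ((congrArg (fun m => (α_ _ _ _).inv ≫ m ▷ _ ≫ (S.action (F.obj Y)).act x k) hw).trans ?_))
  · exact congrArg (fun m => _ ≫ m ▷ _ ≫ _) (Category.assoc _ _ _).symm
  · simp only [comp_whiskerRight, Category.assoc]

variable [MonoidalClosed V] [Limits.HasLimits V] [Limits.HasColimits V] {Φ : Set (Weight.{w} V)}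

/-- By density it is enough to check the image cone under each `B(-, j t)`. There the free models
are coends over `s` of `B(X, j s) ⊗ L(s, t)`, the flat colimit is already preserved in the factor
`B(X, j s)`, and the two coends commute. -/
theorem Algebraic.isAccessible (S : Algebraic L ι U) (adj : VAdjunction F U)
    (hj : Presents Φ (p.comp V ι)) (hfree : ∀ X, S.IsFreeOn p (adj.unit.app X)) :
    IsAccessible Φ (F.comp V U) := by
  intro D _ φ hφ R c hc
  have hc' := c.isColimit_iff_op.1 hc
  refine (WCocone.isColimit_iff_op _).2 (hj.dense.isLimit_of_isCoend _ fun t => ?_)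
  refine IsCoend.interchange (T := T)
    (Fd := fun d => nerveMod (p.comp V ι) (op (R.obj (op d))))
    (F := nerveMod (p.comp V ι) (op c.pt)) (lG := lhom (p.comp V L.functor) (p.obj t))
    (fun s => hj.isCoend_of_isLimit hφ c.op hc' s) (fun d => hfree (R.obj (op d)) (p.obj t))
    (hfree c.pt (p.obj t)) (fun d s => ?_) (fun d d' s => ?_) fun d s s' => ?_
  · exact S.free_map adj (c.ι d) (p.obj s) (p.obj t)
  · exact S.free_map adj (R.map (op d') (op d)) (p.obj s) (p.obj t)
  · exact ((RMod.isHom_hom (c.op.π d)).restrict (p.comp V ι) s s').symm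

end Accessibility

/-! ### Factoring the presentation through the presentable objects -/

section Presentables

variable {V : Type u} [Category.{v} V] [MonoidalCategory V] [SymmetricCategory V]
  [MonoidalClosed V]

variable {K : Type u₁} [EnrichedCategory V K] {T : Type u₂} [EnrichedCategory V T]

/-- The lift of a `V`-functor to the opposite of a full sub-`V`-category. -/
def FullSub.liftOp {P : K → Prop} (j : EnrichedFunctor V T Kᵒᵖ) (h : ∀ t, P (j.obj t).unop) :
    EnrichedFunctor V T (FullSub P)ᵒᵖ where
  obj t := op ⟨(j.obj t).unop, h t⟩
  map s t := j.map s t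
  map_id t := j.map_id t
  map_comp r s t := j.map_comp r s t

theorem FullSub.liftOp_incl {P : K → Prop} (j : EnrichedFunctor V T Kᵒᵖ)
    (h : ∀ t, P (j.obj t).unop) :
    (FullSub.liftOp j h).comp V (opFunctor (FullSub.incl V P)) = j :=
  enrichedFunctor_ext_map (o := j.obj) (m' := j.map) (h₁' := j.map_id) (h₂' := j.map_comp)
    (funext fun s => funext fun t => Category.comp_id (j.map s t))

variable [Limits.HasLimits V] [Limits.HasColimits V] {Φ : Set (Weight.{w} V)}

theorem Presents.isAbsolutelyDense_liftOp {T : Type v} [EnrichedCategory V T]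
    {j : EnrichedFunctor V T Kᵒᵖ} (hj : Presents Φ j) (hΦ : ContinuousFlat Φ)
    (hT : IsComplete T Φ) :
    IsAbsolutelyDense (FullSub.liftOp (P := fun X : K => IsPresentable Φ X) j hj.isPresentable) :=
  fun X k => hj.isCoend_comp hΦ hT (op X.unop.obj) (op k.unop.obj) k.unop.property

theorem Presents.continuous_liftOp {j : EnrichedFunctor V T Kᵒᵖ} (hj : Presents Φ j)
    (k : (Presentables Φ K)ᵒᵖ) :
    (nerveMod (FullSub.liftOp (P := fun X : K => IsPresentable Φ X) j hj.isPresentable)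
      k).Continuous Φ :=
  hj.continuous (op k.unop.obj)

end Presentables

end VCat

end

theorem mainTheorem3 {V : Type u} [Category.{v} V] [MonoidalCategory V] [SymmetricCategory V]
    [MonoidalClosed V] [Limits.HasLimits V] [Limits.HasColimits V]
    (Φ : Set (VCat.Weight.{w} V)) (hΦ : VCat.ContinuousFlat Φ)
    (K : Type u₁) [EnrichedCategory V K] (hK : VCat.IsLocallyPresentable Φ K)
    (L : VCat.LawvereTheory Φ K) :
    ∃ (_ : VCat.HasFunctorCategory V (VCat.Presentables Φ K)ᵒᵖ V)
      (_ : VCat.HasFunctorCategory V L.Cod V)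
      (F : EnrichedFunctor V K L.Models) (adj : VCat.VAdjunction F L.forget),
      VCat.IsEquivalence adj.comparison ∧ VCat.IsAccessible Φ adj.toMonad.T := by
  obtain ⟨T, _, j, hT, hd, hc, hi⟩ := VCat.exists_isDense hK
  have hj : VCat.Presents Φ j := ⟨hd, hc, hi⟩
  let p := VCat.FullSub.liftOp (P := fun X : K => VCat.IsPresentable Φ X) j hj.isPresentable
  let J := VCat.FullSub.incl V fun X : K => VCat.IsPresentable Φ X
  have hp : VCat.IsAbsolutelyDense p := hj.isAbsolutelyDense_liftOp hΦ hT
  -- Composing `p` with the inclusion gives back `j` on the nose, so the presentation by `j`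
  -- transfers by rewriting.
  have hpJ : VCat.Presents Φ (p.comp V (VCat.opFunctor J)) := by
    rw [VCat.FullSub.liftOp_incl]
    exact hj
  have inst₁ : VCat.HasFunctorCategory V (VCat.Presentables Φ K)ᵒᵖ V := hp.hasFunctorCategory_self
  have inst₂ : VCat.HasFunctorCategory V L.Cod V := hp.hasFunctorCategory L.toIdOnObjects
  obtain ⟨S⟩ := VCat.nonempty_algebraic_fstFunctor (L := L.toIdOnObjects) (J := J)
  choose P η hη using S.exists_isFreeOn
    (VCat.exists_free hΦ hT hpJ hp hj.continuous_liftOp L.continuous)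
  have hU (X : K) := S.isUniversal hpJ.dense hp (hη X)
  let adj := VCat.adjunctionOfUniversal hU
  exact ⟨inst₁, inst₂, VCat.leftAdjoint hU, adj,
    ⟨S.comparison_fullyFaithful adj, S.comparison_essSurj adj hU⟩, S.isAccessible adj hpJ hη⟩
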